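/- Let $A$ be a Borel space (a topological space homeomorphic to a Borel subset of a Polish space) with its Borel $\sigma$-algebra $\mathcal B(A)$, and let $\lambda$ be a nonzero finite measure on $\mathcal B(A)$. **Lift.** There are a finite measure $\lambda'$ on $\mathbb R$ with $\lambda'(\{r\})=0$ for all $r$ and a Borel map $\pi:\mathbb R\to A$ such that $\lambda=\lambda'\circ\pi^{-1}$. Fix any such pair $(\lambda',\pi)$. **Setting.** Let $\Omega$ be the set of sequences $\omega=(t_n,r_n)_{n\ge1}$ in $(0,\infty)\times\mathbb R$ with $t_n<t_{n+1}\to\infty$; put $T_n(\omega)=t_n$, $R_n(\omega)=r_n$, $T_0=0$, and let $\mathcal F$ be the $\sigma$-algebra generated by all $T_n,R_n$. Let $\mathbb P$ be the probability on $(\Omega,\mathcal F)$ under which $(T_n,R_n)_{n\ge 1}$ is a Poisson process with intensity $\lambda'$: the $T_n-T_{n-1}$ are independent and exponential with parameter $\lambda'(\mathbb R)$, the $R_n$ are independent with law $\lambda'/\lambda'(\mathbb R)$, and the sequences $(T_n)$ and $(R_n)$ are independent. Let $A_n=\pi(R_n)$, $\mu=\sum_{n\ge1}\delta_{(T_n,A_n)}$,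 let $\mathcal F^\mu_t=\sigma(\mu((0,s]\times C):0\le s\le t,\ C\in\mathcal B(A))$, $\mathbb F^\mu=(\mathcal F^\mu_t)_{t\ge0}$, $\mathcal F^\mu_\infty=\sigma(\bigcup_t\mathcal F^\mu_t)$, and let $\mathcal P(\mathbb F^\mu)$ be the predictable $\sigma$-algebra on $\Omega\times[0,\infty)$. Let $\nu:\Omega\times[0,\infty)\times A\to\mathbb R$ be $\mathcal P(\mathbb F^\mu)\otimes\mathcal B(A)$-measurable with $c\le\nu_t(\omega,a)\le C$ for all $(\omega,t,a)$, for some constants $0<c\le C<\infty$, and put $$\kappa^\nu_t=\exp\Big(\int_0^t\!\int_A(1-\nu_s(a))\,\lambda(da)\,ds\Big)\prod_{T_n\le t}\nu_{T_n}(A_n),\qquad t\ge0.$$ **Conclusions.** (a) $\kappa^\nu$ is an $\mathbb F^\mu$-martingale under $\mathbb P$. (b) There is a unique probability $\mathbb P^\nu$ on $(\Omega,\mathcal F^\mu_\infty)$ such that $\mathbb P^\nu(d\omega)=\kappa^\nu_t(\omega)\,\mathbb P(d\omega)$ on $\mathcal F^\mu_t$ for every $t\ge0$. (c) The $\mathbb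 F^\mu$-compensator of $(T_n,A_n)_{n\ge1}$ under $\mathbb P^\nu$ is $\mu^{\nu}(dt\,da)=\nu_t(a)\,\lambda(da)\,dt$: it is a transition kernel from $(\Omega,\mathcal F^\mu_\infty)$ to $(0,\infty)\times A$ which is a.s. finite on each $(0,t]\times A$, the processes $\mu^\nu((0,t]\times C)$ are $\mathbb F^\mu$-predictable, $\mu^\nu(\{t\}\times A)\le1$, and for all $n\ge1$ and $C\in\mathcal B(A)$ the process $\mu((0,t\wedge T_n]\times C)-\mu^\nu((0,t\wedge T_n]\times C)$, $t\ge0$, is an $\mathbb F^\mu$-martingale under $\mathbb P^\nu$. Moreover there is a sequence $(T^\nu_n,A^\nu_n)_{n\ge1}$ of $\mathcal F$-measurable random variables such that (i) $(T^\nu_n,A^\nu_n)$ takes values in $(0,\infty)\times A$ and $T^\nu_n<T^\nu_{n+1}$ for every $n\ge 1$; (ii) $T^\nu_n\to\infty$ as $n\to\infty$; (iii) the law of $(T^\nu_n,A^\nu_n)_{n\ge1}$ under $\mathbb P$ equals the law of $(T_n,A_n)_{n\ge1}$ under $\mathbb P^\nu$. This sequence can be chosen of the following form. There are Borel functions $\nu^{(n)}_t(t_1,a_1,\dots,t_n,a_n,a)$,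 $n\ge0$, with values in $[c,C]$, such that $\nu_t(\omega,a)=\nu^{(n)}_t(T_1(\omega),A_1(\omega),\dots,T_n(\omega),A_n(\omega),a)$ whenever $T_n(\omega)<t\le T_{n+1}(\omega)$ (or $0\le t\le T_1(\omega)$, if $n=0$), and $A^\nu_n=\pi(R^\nu_n)$ with $\mathcal F$-measurable real $R^\nu_n$, where, with $T_0^\nu=0$ and $H_n=(T_1^\nu,A_1^\nu,\dots,T_n^\nu,A_n^\nu)$, for every $n\ge0$, $$T^\nu_{n+1}=\min\Big\{t\ge T^\nu_n:\ \frac1{\lambda(A)}\int_{T_n^\nu}^t\!\int_A\nu^{(n)}_s(H_n,a)\,\lambda(da)\,ds\ \ge\ T_{n+1}-T_n\Big\}$$ everywhere on $\Omega$, and, $\mathbb P$-almost surely, $$R^\nu_{n+1}=\min\Big\{b\in\mathbb R:\ \frac{\int_{(-\infty,b]}\nu^{(n)}_{T^\nu_{n+1}}(H_n,\pi(r))\,\lambda'(dr)}{\int_{\mathbb R}\nu^{(n)}_{T^\nu_{n+1}}(H_n,\pi(r))\,\lambda'(dr)}\ \ge\ \frac{\lambda'((-\infty,R_{n+1}])}{\lambda'(\mathbb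 R)}\Big\}.$$ -/

import Mathlib

open MeasureTheory ProbabilityTheory Set Filter Topology
open scoped NNReal ENNReal

noncomputable section

/-! Marked point processes are sequences `X : ℕ → Ω → ℝ≥0 × E`; the pair with index `n` in the usual
numbering `1, 2, …` is `X (n - 1)`, so `X 0` is the first time together with the first mark. -/

/-- A path of a non-explosive marked point process with finite arrival times: the times are
positive, strictly increasing and tend to infinity. -/
def IsMarkedPath {E : Type*} (x : ℕ → ℝ≥0 × E) : Prop :=
  (∀ n, 0 < (x n).1) ∧ (∀ n, (x n).1 < (x (n + 1)).1) ∧ Tendsto (fun n => (x n).1) atTop atTop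

/-- The canonical space of a marked point process with marks in `E`. Its σ-algebra (the one of a
subtype of a product) is the smallest one making all times and marks measurable. -/
abbrev MarkedPath (E : Type*) : Type _ := {x : ℕ → ℝ≥0 × E // IsMarkedPath x}

/-- The canonical process. -/
def canonicalProcess (E : Type*) (n : ℕ) (ω : MarkedPath E) : ℝ≥0 × E := ω.1 n

/-- Apply a map to the marks of a marked point process and keep the times. -/
def mapMarks {Ω E A : Type*} (π : E → A) (X : ℕ → Ω → ℝ≥0 × E) (n : ℕ) (ω : Ω) : ℝ≥0 × A :=
  ((X n ω).1, π (X n ω).2)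

/-- The time preceding the time with index `n`; it is `0` for the first one. -/
def prevTime {Ω E : Type*} (X : ℕ → Ω → ℝ≥0 × E) : ℕ → Ω → ℝ≥0
  | 0, _ => 0
  | n + 1, ω => (X n ω).1

/-- The interarrival times. -/
def interarrival {Ω E : Type*} (X : ℕ → Ω → ℝ≥0 × E) (n : ℕ) (ω : Ω) : ℝ :=
  ((X n ω).1 : ℝ) - (prevTime X n ω : ℝ)

/-- The law of the whole sequence. -/
def seqLaw {Ω E : Type*} [MeasurableSpace E] {m : MeasurableSpace Ω} (P : Measure Ω)
    (X : ℕ → Ω → ℝ≥0 × E) : Measure (ℕ → ℝ≥0 × E) :=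
  P.map (fun ω n => X n ω)

/-- A Poisson process with intensity `lam`. -/
structure IsPoissonProcess {Ω E : Type*} [MeasurableSpace E] {m : MeasurableSpace Ω}
    (X : ℕ → Ω → ℝ≥0 × E) (lam : Measure E) (P : Measure Ω) : Prop where
  hasLaw_interarrival : ∀ n, HasLaw (interarrival X n) (expMeasure (lam.real univ)) P
  hasLaw_mark : ∀ n, HasLaw (fun ω => (X n ω).2) ((lam univ)⁻¹ • lam) P
  iIndepFun_interarrival : iIndepFun (interarrival X) P
  iIndepFun_mark : iIndepFun (fun n ω => (X n ω).2) P
  indepFun_times_marks : IndepFun (fun ω n => (X n ω).1) (fun ω n => (X n ω).2) P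

/-- The random measure `∑ₙ δ_(Tₙ, Aₙ)`. -/
def pointMeasure {Ω E : Type*} [MeasurableSpace E] (X : ℕ → Ω → ℝ≥0 × E) (ω : Ω) :
    Measure (ℝ≥0 × E) :=
  Measure.sum fun n => Measure.dirac (X n ω)

/-- `σ(μ((0,s] × C) : s ∈ [0,t], C measurable)`. -/
def naturalSigma {Ω E : Type*} [MeasurableSpace E] (X : ℕ → Ω → ℝ≥0 × E) (t : ℝ≥0) :
    MeasurableSpace Ω :=
  ⨆ (s : ℝ≥0) (_ : s ≤ t) (C : Set E) (_ : MeasurableSet C),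
    MeasurableSpace.comap (fun ω => pointMeasure X ω (Ioc 0 s ×ˢ C)) inferInstance

/-- The σ-algebra `ℱ_∞` generated by the natural filtration. -/
def naturalSigmaTop {Ω E : Type*} [MeasurableSpace E] (X : ℕ → Ω → ℝ≥0 × E) : MeasurableSpace Ω :=
  ⨆ t : ℝ≥0, naturalSigma X t

theorem naturalSigma_mono {Ω E : Type*} [MeasurableSpace E] (X : ℕ → Ω → ℝ≥0 × E) :
    Monotone (naturalSigma X) := by
  intro t u htu
  refine iSup_le fun s => iSup_le fun hs => ?_
  exact le_iSup_of_le s (le_iSup_of_le (hs.trans htu) le_rfl)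

/-- The natural filtration, on any σ-algebra that contains `ℱ_∞`. -/
def naturalFiltration {Ω E : Type*} [MeasurableSpace E] (X : ℕ → Ω → ℝ≥0 × E)
    {m : MeasurableSpace Ω} (h : naturalSigmaTop X ≤ m) : Filtration ℝ≥0 m where
  seq := naturalSigma X
  mono' := naturalSigma_mono X
  le' t := (le_iSup (naturalSigma X) t).trans h

theorem naturalSigmaTop_le {Ω E : Type*} [MeasurableSpace E] {m : MeasurableSpace Ω}
    {X : ℕ → Ω → ℝ≥0 × E} (hX : ∀ n, Measurable (X n)) : naturalSigmaTop X ≤ m := by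
  refine iSup_le fun t => iSup_le fun s => iSup_le fun _ => iSup_le fun C => iSup_le fun hC => ?_
  have hS : MeasurableSet (Ioc (0 : ℝ≥0) s ×ˢ C) := measurableSet_Ioc.prod hC
  refine Measurable.comap_le ?_
  simp only [pointMeasure, Measure.sum_apply _ hS, Measure.dirac_apply' _ hS]
  exact Measurable.tsum fun n => (measurable_one.indicator hS).comp (hX n)

theorem measurable_mapMarks_canonical {E A : Type*} [MeasurableSpace E] [MeasurableSpace A]
    {π : E → A} (hπ : Measurable π) (n : ℕ) : Measurable (mapMarks π (canonicalProcess E) n) := by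
  have h : Measurable (canonicalProcess E n) := (measurable_pi_apply n).comp measurable_subtype_coe
  exact h.fst.prodMk (hπ.comp h.snd)

/-- The process `(Tₙ, Aₙ)` with `Aₙ = π (Rₙ)` on the canonical space of `(Tₙ, Rₙ)`. -/
def liftedProcess {A : Type*} (π : ℝ → A) : ℕ → MarkedPath ℝ → ℝ≥0 × A :=
  mapMarks π (canonicalProcess ℝ)

/-- The natural filtration of `(Tₙ, π (Rₙ))` on the canonical space of `(Tₙ, Rₙ)`. -/
def liftedFiltration {A : Type*} [MeasurableSpace A] {π : ℝ → A} (hπ : Measurable π) :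
    Filtration ℝ≥0 (inferInstance : MeasurableSpace (MarkedPath ℝ)) :=
  naturalFiltration (liftedProcess π) (naturalSigmaTop_le (measurable_mapMarks_canonical hπ))

/-- Lebesgue measure on `[0, ∞)`. -/
def timeMeasure : Measure ℝ≥0 := (volume.restrict (Ici (0 : ℝ))).map Real.toNNReal

/-- A random field is predictable if it is measurable for the product of the predictable
σ-algebra (on time and chance) and the σ-algebra of the marks. -/
def IsPredictableField {Ω A : Type*} [MeasurableSpace A] {m : MeasurableSpace Ω}
    (ℱ : Filtration ℝ≥0 m) (ν : Ω → ℝ≥0 → A → ℝ) : Prop :=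
  Measurable[ℱ.predictable.prod inferInstance]
    (fun p : (ℝ≥0 × Ω) × A => ν p.1.2 p.1.1 p.2)

/-- The random measure `ρ` on `(0, ∞) × A` is the compensator of the marked point process `X` under
the probability `P` with respect to the filtration `ℱ`. -/
structure IsCompensator {Ω A : Type*} [MeasurableSpace A] {m : MeasurableSpace Ω}
    (ℱ : Filtration ℝ≥0 m) (P : Measure Ω) (X : ℕ → Ω → ℝ≥0 × A)
    (ρ : Ω → Measure (ℝ≥0 × A)) : Prop where
  measurable : Measurable ρ
  zero_null : ∀ ω, ρ ω ({0} ×ˢ univ) = 0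
  predictable : ∀ C : Set A, MeasurableSet C →
    Measurable[ℱ.predictable] (fun p : ℝ≥0 × Ω => ρ p.2 (Ioc 0 p.1 ×ˢ C))
  ae_finite : ∀ᵐ ω ∂P, ∀ t : ℝ≥0, ρ ω (Ioc 0 t ×ˢ univ) < ∞
  martingale : ∀ (n : ℕ) (C : Set A), MeasurableSet C →
    Martingale (fun (t : ℝ≥0) ω =>
      (pointMeasure X ω (Ioc 0 (min t (X n ω).1) ×ˢ C)).toReal
        - (ρ ω (Ioc 0 (min t (X n ω).1) ×ˢ C)).toReal) ℱ P
  atom_le_one : ∀ ω t, ρ ω ({t} ×ˢ univ) ≤ 1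

/-- The random measure `νₜ(a) lam(da) dt`. -/
def intensityMeasure {Ω A : Type*} [MeasurableSpace A] (lam : Measure A) (ν : Ω → ℝ≥0 → A → ℝ)
    (ω : Ω) : Measure (ℝ≥0 × A) :=
  (timeMeasure.prod lam).withDensity fun p => ENNReal.ofReal (ν ω p.1 p.2)

/-- The exponential process
`κₜ = exp (∫₀ᵗ ∫ (1 - νₛ(a)) lam(da) ds) ∏_{Tₙ ≤ t} ν_{Tₙ}(Aₙ)`. -/
def expProcess {Ω A : Type*} [MeasurableSpace A] (X : ℕ → Ω → ℝ≥0 × A) (lam : Measure A)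
    (ν : Ω → ℝ≥0 → A → ℝ) (t : ℝ≥0) (ω : Ω) : ℝ :=
  Real.exp (∫ s in Iic t, ∫ a, (1 - ν ω s a) ∂lam ∂timeMeasure)
    * ∏ᶠ (n : ℕ) (_ : (X n ω).1 ≤ t), ν ω (X n ω).1 (X n ω).2

/-- `Q` is a probability on `ℱ_∞` with `dQ = κₜ dP` on each `ℱₜ` of the natural filtration. -/
def IsGirsanovProbability {Ω A : Type*} [MeasurableSpace A] {m : MeasurableSpace Ω}
    (P : Measure Ω) (X : ℕ → Ω → ℝ≥0 × A) (κ : ℝ≥0 → Ω → ℝ)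
    (Q : @Measure Ω (naturalSigmaTop X)) : Prop :=
  IsProbabilityMeasure Q ∧
    ∀ (t : ℝ≥0) (B : Set Ω), MeasurableSet[naturalSigma X t] B →
      Q B = ∫⁻ ω in B, ENNReal.ofReal (κ t ω) ∂P

/-- A lift of a measure on `A` to a finite measure without atoms on the real line. -/
structure IsNonatomicLift {A : Type*} [MeasurableSpace A] (lam : Measure A) (lam' : Measure ℝ)
    (π : ℝ → A) : Prop where
  finite : IsFiniteMeasure lam'
  measurable : Measurable π
  map_eq : lam'.map π = lam
  nonatomic : ∀ r, lam' {r} = 0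

/-- The Borel functions `g n` of the first `n` points, time and mark represent the predictable
field `ν`: on `Tₙ < t ≤ Tₙ₊₁` one has `νₜ(a) = g n (T₁, A₁, …, Tₙ, Aₙ) t a`, and on `0 ≤ t ≤ T₁` one
has `νₜ(a) = g 0 t a`. -/
structure IsFieldRepresentation {Ω A : Type*} [MeasurableSpace A] (X : ℕ → Ω → ℝ≥0 × A)
    (ν : Ω → ℝ≥0 → A → ℝ) (g : (n : ℕ) → (Fin n → ℝ≥0 × A) → ℝ≥0 → A → ℝ) : Prop where
  measurable : ∀ n,
    Measurable (fun p : (Fin n → ℝ≥0 × A) × ℝ≥0 × A => g n p.1 p.2.1 p.2.2)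
  eq : ∀ n ω t a, (n = 0 ∨ prevTime X n ω < t) → t ≤ (X n ω).1 →
    ν ω t a = g n (fun i => X i ω) t a

/-- The points of `Z` (with real marks) come from those of `Y` by the time changes
`T'ₙ₊₁ = min {t ≥ T'ₙ : θₜ ≥ Tₙ₊₁ - Tₙ}`,
`θₜ = lam(A)⁻¹ ∫_{T'ₙ}^t ∫ g n (T'₁, π R'₁, …, T'ₙ, π R'ₙ) s a lam(da) ds`,
for the times and, almost surely, by the inverse distribution functions
`R'ₙ₊₁ = min {b : F_b ≥ F (Rₙ₊₁)}` for the marks, where `F` is the distribution function of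
`lam'/lam'(ℝ)` and `F_b` that of the probability proportional to
`g n (T'₁, π R'₁, …, T'ₙ, π R'ₙ) T'ₙ₊₁ (π r) lam'(dr)`. -/
structure IsTimeChange {Ω A : Type*} [MeasurableSpace A] {m : MeasurableSpace Ω} (P : Measure Ω)
    (lam : Measure A) (lam' : Measure ℝ) (π : ℝ → A)
    (g : (n : ℕ) → (Fin n → ℝ≥0 × A) → ℝ≥0 → A → ℝ) (Y Z : ℕ → Ω → ℝ≥0 × ℝ) : Prop where
  time : ∀ n ω, IsLeast {t : ℝ≥0 | prevTime Z n ω ≤ t ∧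
    interarrival Y n ω ≤ (lam.real univ)⁻¹ *
      ∫ s in Ioc (prevTime Z n ω) t, ∫ a, g n (fun i => mapMarks π Z i ω) s a ∂lam ∂timeMeasure}
    (Z n ω).1
  mark : ∀ᵐ ω ∂P, ∀ n, IsLeast {b : ℝ |
    lam'.real (Iic (Y n ω).2) / lam'.real univ ≤
      (∫ r in Iic b, g n (fun i => mapMarks π Z i ω) (Z n ω).1 (π r) ∂lam') /
        (∫ r, g n (fun i => mapMarks π Z i ω) (Z n ω).1 (π r) ∂lam')}
    (Z n ω).2

end

set_option linter.unusedSectionVars false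

/-! ### Lebesgue measure on `[0, ∞)` -/

/-! A field that is predictable for the natural filtration is, between two successive points, a
Borel function `g n` of the first `n` points, of time and of the mark
(`exists_fieldRepresentation`). Everything therefore reduces to the conditional law of the next
point given the history. Under intensity `g` this law has the density `g * exp (-cumRate)` after the
last time, with respect to `dt lam(da)`. This is `stepDensity`, and `HasIntensity` says that a
process has these conditional laws.

Two processes on the canonical space under `P` have an intensity in this sense. The lifted Poisson
process has intensity `1`, by independence of its interarrival times and marks
(`IsPoissonProcess.hasIntensity_one`). The time change has intensity `g`
(`IsPoissonProcess.hasIntensity_of_pointStep`). It is driven by the same innovations: inverting the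
cumulated rate turns the exponential waiting time into the required time, and a quantile transform
turns the mark with law `lam' / lam'(ℝ)` into the required mark (`lintegral_step`). Since `g ≤ C`,
each interarrival time of the Poisson process is at most `C` times the new one, so the time change
explodes nowhere and defines a measurable map `W` of the canonical space into itself.

The likelihood ratio of the first `n` points of the two processes is a product of ratios of step
densities (`lintegral_history_eq`). On the event that exactly `n` points have come up to time `t`,
this product times the ratio of the probabilities of no further point up to `t` is the exponential
process at `t`. Hence the law of `W` has density `expProcess` on each σ-algebra of the filtration
(`measure_preimage_eq_lintegral_expProcess`).

So the required probability is the image of `P` under `W`, and no extension theorem is needed. Its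
existence yields the martingale property, because the integral of the density at time `t` over a
past event is the probability of that event, whatever `t` is. Uniqueness holds because the events of
finite time form a π-system that generates `ℱ_∞`. The equality of laws in (iii) is a change of
variables under `W`.

For the compensator, each point is treated separately. Given the history, the probability that the
next point falls in `(s, t] × B` and the expected intensity accumulated there before that point are
the same integral, by Fubini (`setLIntegral_increment`). Summing over finitely many points gives the
stopped martingales. -/

theorem timeMeasure_Ioc (a b : ℝ≥0) : timeMeasure (Ioc a b) = ENNReal.ofReal (b - a) := by
  have h : (Real.toNNReal ⁻¹' Ioc a b) ∩ Ici (0 : ℝ) = Ioc (a : ℝ) b := by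
    ext x
    simp only [mem_inter_iff, mem_preimage, mem_Ioc, mem_Ici]
    constructor
    · rintro ⟨⟨h1, h2⟩, h3⟩
      exact ⟨(Real.lt_toNNReal_iff_coe_lt).1 h1, (Real.toNNReal_le_iff_le_coe).1 h2⟩
    · rintro ⟨h1, h2⟩
      exact ⟨⟨(Real.lt_toNNReal_iff_coe_lt).2 h1, (Real.toNNReal_le_iff_le_coe).2 h2⟩,
        a.2.trans h1.le⟩
  rw [timeMeasure, Measure.map_apply measurable_real_toNNReal measurableSet_Ioc,
    Measure.restrict_apply (measurable_real_toNNReal measurableSet_Ioc), h, Real.volume_Ioc]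

theorem timeMeasure_singleton (a : ℝ≥0) : timeMeasure {a} = 0 := by
  rw [timeMeasure, Measure.map_apply measurable_real_toNNReal (measurableSet_singleton _),
    Measure.restrict_apply (measurable_real_toNNReal (measurableSet_singleton _))]
  have h : (Real.toNNReal ⁻¹' {a}) ∩ Ici (0 : ℝ) ⊆ {(a : ℝ)} := by
    rintro x ⟨hx, hx0⟩
    simp only [mem_preimage, mem_singleton_iff, mem_Ici] at hx hx0 ⊢
    rw [← hx, Real.coe_toNNReal _ hx0]
  exact measure_mono_null h Real.volume_singleton

instance nullSingletonClass_timeMeasure : NullSingletonClass timeMeasure := ⟨timeMeasure_singleton⟩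

theorem timeMeasure_Iic (b : ℝ≥0) : timeMeasure (Iic b) = ENNReal.ofReal b := by
  have h : Iic b = {0} ∪ Ioc 0 b := by
    ext x
    simp only [mem_Iic, singleton_union, mem_insert_iff, mem_Ioc]
    rcases eq_or_ne x 0 with rfl | hx
    · simp
    · simp [hx, pos_iff_ne_zero]
  rw [h, measure_union (by simp) measurableSet_Ioc, timeMeasure_singleton, timeMeasure_Ioc]
  simp

instance isFiniteMeasureOnCompacts_timeMeasure : IsFiniteMeasureOnCompacts timeMeasure := by
  refine ⟨fun K hK => ?_⟩
  obtain ⟨b, hb⟩ := hK.bddAbove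
  refine (measure_mono (t := Iic b) fun x hx => hb hx).trans_lt ?_
  rw [timeMeasure_Iic]
  exact ENNReal.ofReal_lt_top

instance sigmaFinite_timeMeasure : SigmaFinite timeMeasure := by
  infer_instance

/-! ### Rates of the next point -/

section Step

variable {H A : Type*} [MeasurableSpace H] [MeasurableSpace A]

/-- A jointly measurable field with values in `[c, C]`, where `c > 0`. -/
structure IsBoundedField (g : H → ℝ≥0 → A → ℝ) (c C : ℝ) : Prop where
  measurable : Measurable fun p : H × ℝ≥0 × A => g p.1 p.2.1 p.2.2
  pos : 0 < c
  bounds : ∀ h t a, c ≤ g h t a ∧ g h t a ≤ C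

/-- The total rate `∫ g h s a lam(da)` at time `s`. -/
noncomputable def rate (lam : Measure A) (g : H → ℝ≥0 → A → ℝ) (h : H) (s : ℝ≥0) : ℝ :=
  ∫ a, g h s a ∂lam

/-- The cumulated rate on `(T h, v]`. -/
noncomputable def cumRate (lam : Measure A) (g : H → ℝ≥0 → A → ℝ) (T : H → ℝ≥0) (h : H)
    (v : ℝ≥0) : ℝ :=
  ∫ s in Ioc (T h) v, rate lam g h s ∂timeMeasure

/-- The first time at which the mean rate cumulated since `T h` reaches `x`. -/
noncomputable def timeStep (lam : Measure A) (g : H → ℝ≥0 → A → ℝ) (T : H → ℝ≥0) (h : H)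
    (x : ℝ) : ℝ≥0 :=
  sInf {v : ℝ≥0 | T h ≤ v ∧ x ≤ (lam.real univ)⁻¹ * cumRate lam g T h v}

/-- The density of the next point. -/
noncomputable def stepDensity (lam : Measure A) (g : H → ℝ≥0 → A → ℝ) (T : H → ℝ≥0) (h : H)
    (p : ℝ≥0 × A) : ℝ≥0∞ :=
  if T h < p.1 then ENNReal.ofReal (g h p.1 p.2 * Real.exp (-cumRate lam g T h p.1)) else 0

namespace IsBoundedField

variable {g : H → ℝ≥0 → A → ℝ} {c C : ℝ} (hg : IsBoundedField g c C) (lam : Measure A)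
  [IsFiniteMeasure lam] {T : H → ℝ≥0} (hT : Measurable T)

include hg

theorem nonneg (h : H) (t : ℝ≥0) (a : A) : 0 ≤ g h t a := hg.pos.le.trans (hg.bounds h t a).1

theorem abs_le (h : H) (t : ℝ≥0) (a : A) : ‖g h t a‖ ≤ C := by
  rw [Real.norm_of_nonneg (hg.nonneg h t a)]
  exact (hg.bounds h t a).2

theorem measurable_section (h : H) (t : ℝ≥0) : Measurable (g h t) :=
  hg.measurable.comp (measurable_const.prodMk (measurable_const.prodMk measurable_id))

theorem integrable_section (h : H) (t : ℝ≥0) : Integrable (g h t) lam :=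
  .of_bound (hg.measurable_section h t).aestronglyMeasurable C (.of_forall fun a => hg.abs_le h t a)

theorem measurable_rate : Measurable fun p : H × ℝ≥0 => rate lam g p.1 p.2 := by
  have : StronglyMeasurable fun q : (H × ℝ≥0) × A => g q.1.1 q.1.2 q.2 :=
    (hg.measurable.comp ((measurable_fst.comp measurable_fst).prodMk
      ((measurable_snd.comp measurable_fst).prodMk measurable_snd))).stronglyMeasurable
  exact this.integral_prod_right.measurable

theorem measurable_rate_section (h : H) : Measurable (rate lam g h) :=
  (hg.measurable_rate lam).comp (measurable_const.prodMk measurable_id)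

theorem le_rate (h : H) (s : ℝ≥0) : c * lam.real univ ≤ rate lam g h s := by
  have := integral_mono (μ := lam) (integrable_const c) (hg.integrable_section lam h s)
    fun a => (hg.bounds h s a).1
  simpa [mul_comm, rate] using this

theorem rate_le (h : H) (s : ℝ≥0) : rate lam g h s ≤ C * lam.real univ := by
  have := integral_mono (μ := lam) (hg.integrable_section lam h s) (integrable_const C)
    fun a => (hg.bounds h s a).2
  simpa [mul_comm, rate] using this

theorem rate_nonneg (h : H) (s : ℝ≥0) : 0 ≤ rate lam g h s :=
  integral_nonneg fun a => hg.nonneg h s a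

theorem ofReal_rate (h : H) (s : ℝ≥0) :
    ENNReal.ofReal (rate lam g h s) = ∫⁻ a, ENNReal.ofReal (g h s a) ∂lam :=
  ofReal_integral_eq_lintegral_ofReal (hg.integrable_section lam h s)
    (.of_forall fun a => hg.nonneg h s a)

theorem integrableOn_rate (h : H) (a b : ℝ≥0) :
    IntegrableOn (rate lam g h) (Ioc a b) timeMeasure := by
  refine IntegrableOn.of_bound ?_ (hg.measurable_rate_section lam h).aestronglyMeasurable
    (C * lam.real univ) (.of_forall fun s => ?_)
  · rw [timeMeasure_Ioc]; exact ENNReal.ofReal_lt_top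
  · rw [Real.norm_of_nonneg (hg.rate_nonneg lam h s)]
    exact hg.rate_le lam h s

theorem le_setIntegral_rate (h : H) {a b : ℝ≥0} (hab : a ≤ b) :
    c * lam.real univ * (b - a) ≤ ∫ s in Ioc a b, rate lam g h s ∂timeMeasure := by
  have := setIntegral_mono (μ := timeMeasure) (s := Ioc a b)
    (f := fun _ => c * lam.real univ) (by
      refine integrableOn_const ?_
      rw [timeMeasure_Ioc]; exact ENNReal.ofReal_ne_top) (hg.integrableOn_rate lam h a b)
    fun s => hg.le_rate lam h s
  rw [setIntegral_const, Measure.real, timeMeasure_Ioc,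
    ENNReal.toReal_ofReal (sub_nonneg.2 (by exact_mod_cast hab)), smul_eq_mul] at this
  linarith

theorem setIntegral_rate_le (h : H) {a b : ℝ≥0} (hab : a ≤ b) :
    ∫ s in Ioc a b, rate lam g h s ∂timeMeasure ≤ C * lam.real univ * (b - a) := by
  have := setIntegral_mono (μ := timeMeasure) (s := Ioc a b)
    (g := fun _ => C * lam.real univ) (hg.integrableOn_rate lam h a b) (by
      refine integrableOn_const ?_
      rw [timeMeasure_Ioc]; exact ENNReal.ofReal_ne_top)
    fun s => hg.rate_le lam h s
  rw [setIntegral_const, Measure.real, timeMeasure_Ioc,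
    ENNReal.toReal_ofReal (sub_nonneg.2 (by exact_mod_cast hab)), smul_eq_mul] at this
  linarith

theorem cumRate_sub (h : H) {v w : ℝ≥0} (hv : T h ≤ v) (hvw : v ≤ w) :
    cumRate lam g T h w - cumRate lam g T h v = ∫ s in Ioc v w, rate lam g h s ∂timeMeasure := by
  rw [cumRate, cumRate, ← Ioc_union_Ioc_eq_Ioc hv hvw,
    setIntegral_union (Ioc_disjoint_Ioc_of_le le_rfl) measurableSet_Ioc
      (hg.integrableOn_rate lam h _ _) (hg.integrableOn_rate lam h _ _)]
  ring

omit hg in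
theorem cumRate_of_le {h : H} {v : ℝ≥0} (hv : v ≤ T h) : cumRate lam g T h v = 0 := by
  rw [cumRate, Ioc_eq_empty (not_lt.2 hv), setIntegral_empty]

theorem ofReal_cumRate (h : H) (v : ℝ≥0) :
    ENNReal.ofReal (cumRate lam g T h v)
      = ∫⁻ s in Ioc (T h) v, ENNReal.ofReal (rate lam g h s) ∂timeMeasure :=
  ofReal_integral_eq_lintegral_ofReal (hg.integrableOn_rate lam h _ _)
    (.of_forall fun s => hg.rate_nonneg lam h s)

theorem cumRate_nonneg (h : H) (v : ℝ≥0) : 0 ≤ cumRate lam g T h v :=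
  integral_nonneg fun s => hg.rate_nonneg lam h s

include hT in
theorem measurable_cumRate : Measurable fun p : H × ℝ≥0 => cumRate lam g T p.1 p.2 := by
  -- The moving limits of integration are put into an indicator, so that the integral runs over a
  -- fixed measure and depends measurably on its parameters.
  have h1 : StronglyMeasurable fun q : (H × ℝ≥0) × ℝ≥0 =>
      ({q : (H × ℝ≥0) × ℝ≥0 | T q.1.1 < q.2 ∧ q.2 ≤ q.1.2}).indicator
        (fun q => rate lam g q.1.1 q.2) q := by
    refine (Measurable.indicator (f := fun q : (H × ℝ≥0) × ℝ≥0 => rate lam g q.1.1 q.2)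
      ?_ ?_).stronglyMeasurable
    · exact (hg.measurable_rate lam).comp
        ((measurable_fst.comp measurable_fst).prodMk measurable_snd)
    · have h2 : Measurable fun q : (H × ℝ≥0) × ℝ≥0 => T q.1.1 := hT.comp measurable_fst.fst
      have h3 : Measurable fun q : (H × ℝ≥0) × ℝ≥0 => q.1.2 := measurable_fst.snd
      have h4 : MeasurableSet {q : (H × ℝ≥0) × ℝ≥0 | q.2 ≤ q.1.2} :=
        measurableSet_le measurable_snd h3
      exact (measurableSet_lt h2 measurable_snd).inter h4
  have h2 := (StronglyMeasurable.integral_prod_right (ν := timeMeasure) (f := fun p s =>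
    ({q : (H × ℝ≥0) × ℝ≥0 | T q.1.1 < q.2 ∧ q.2 ≤ q.1.2}).indicator
        (fun q => rate lam g q.1.1 q.2) (p, s)) h1).measurable
  convert h2 using 2 with p
  rw [cumRate, ← integral_indicator measurableSet_Ioc]
  rfl

theorem cumRate_mono (h : H) : Monotone (cumRate lam g T h) := by
  intro v w hvw
  rcases le_total (T h) v with hv | hv
  · have h1 := hg.cumRate_sub lam h hv hvw
    have h2 : 0 ≤ ∫ s in Ioc v w, rate lam g h s ∂timeMeasure :=
      integral_nonneg fun s => hg.rate_nonneg lam h s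
    linarith
  · rw [cumRate_of_le lam hv]
    exact hg.cumRate_nonneg lam h w

end IsBoundedField

end Step

/-! ### The next time -/

namespace IsBoundedField

variable {H A : Type*} [MeasurableSpace H] [MeasurableSpace A]
variable {g : H → ℝ≥0 → A → ℝ} {c C : ℝ} (hg : IsBoundedField g c C) (lam : Measure A)
  [IsFiniteMeasure lam] {T : H → ℝ≥0} (hT : Measurable T)

include hg

/-- The rate is bounded, so the cumulated rate is Lipschitz. -/
theorem continuous_cumRate (h : H) : Continuous (cumRate lam g T h) := by
  -- The sign of `C` can only be read off from a value of `g`, and none need exist; the absolute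
  -- value makes the constant nonnegative in any case.
  set K : ℝ≥0 := (|C| * lam.real univ).toNNReal
  have hK : (K : ℝ) = |C| * lam.real univ := Real.coe_toNNReal _ (by positivity)
  have key : ∀ v w : ℝ≥0, v ≤ w →
      cumRate lam g T h w - cumRate lam g T h v ≤ |C| * lam.real univ * (w - v) := by
    intro v w hvw
    have hvw' : (v : ℝ) ≤ w := by exact_mod_cast hvw
    have hC : ∀ x y : ℝ, x ≤ y → C * lam.real univ * (y - x) ≤ |C| * lam.real univ * (y - x) := by
      intro x y hxy
      have := le_abs_self C
      have h2 : 0 ≤ lam.real univ := measureReal_nonneg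
      have h3 : 0 ≤ y - x := sub_nonneg.2 hxy
      gcongr
    rcases le_total (T h) v with hv | hv
    · rw [hg.cumRate_sub lam h hv hvw]
      exact (hg.setIntegral_rate_le lam h hvw).trans (hC _ _ hvw')
    · rw [cumRate_of_le lam hv, sub_zero]
      rcases le_total (T h) w with hw | hw
      · have hw' : ((T h : ℝ≥0) : ℝ) ≤ w := by exact_mod_cast hw
        have hv' : (v : ℝ) ≤ T h := by exact_mod_cast hv
        refine (hg.setIntegral_rate_le lam h hw).trans ((hC _ _ hw').trans ?_)
        gcongr
      · rw [cumRate_of_le lam hw]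
        have : (0 : ℝ) ≤ w - v := sub_nonneg.2 hvw'
        positivity
  refine (LipschitzWith.of_dist_le_mul (K := K) fun v w => ?_).continuous
  rw [Real.dist_eq, NNReal.dist_eq, hK]
  rcases le_total v w with hvw | hvw
  · have h1 := hg.cumRate_mono lam (T := T) h hvw
    have hvw' : (v : ℝ) ≤ w := by exact_mod_cast hvw
    rw [abs_of_nonpos (sub_nonpos.2 h1), abs_of_nonpos (sub_nonpos.2 hvw')]
    have := key v w hvw
    linarith
  · have h1 := hg.cumRate_mono lam (T := T) h hvw
    have hvw' : (w : ℝ) ≤ v := by exact_mod_cast hvw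
    rw [abs_of_nonneg (sub_nonneg.2 h1), abs_of_nonneg (sub_nonneg.2 hvw')]
    exact key w v hvw

variable (hlam : lam ≠ 0)

omit hg in
include hlam in
theorem measureReal_univ_pos : 0 < lam.real univ := by
  rw [Measure.real, ENNReal.toReal_pos_iff]
  exact ⟨Measure.measure_univ_pos.2 hlam, measure_lt_top _ _⟩

include hlam in
/-- The least element of the set that defines `timeStep`. -/
theorem isLeast_timeStep (h : H) (x : ℝ) :
    IsLeast {v : ℝ≥0 | T h ≤ v ∧ x ≤ (lam.real univ)⁻¹ * cumRate lam g T h v}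
      (timeStep lam g T h x) := by
  have hL := measureReal_univ_pos lam hlam
  have hcl : IsClosed {v : ℝ≥0 | T h ≤ v ∧ x ≤ (lam.real univ)⁻¹ * cumRate lam g T h v} :=
    isClosed_Ici.inter (isClosed_le continuous_const
      (continuous_const.mul (hg.continuous_cumRate lam h)))
  have hne : {v : ℝ≥0 | T h ≤ v ∧ x ≤ (lam.real univ)⁻¹ * cumRate lam g T h v}.Nonempty := by
    -- The cumulated rate grows at least at speed `c * lam.real univ`, so level `x` is reached
    -- within time `x / c`.
    refine ⟨T h + (x / c).toNNReal, le_self_add, ?_⟩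
    have h1 : c * lam.real univ * ((T h + (x / c).toNNReal : ℝ≥0) - T h)
        ≤ cumRate lam g T h (T h + (x / c).toNNReal) :=
      hg.le_setIntegral_rate lam h le_self_add
    rw [inv_mul_eq_div, le_div_iff₀ hL]
    refine le_trans ?_ h1
    have h2 : x / c ≤ (x / c).toNNReal := Real.le_coe_toNNReal _
    rw [div_le_iff₀ hg.pos] at h2
    push_cast
    nlinarith
  exact ⟨hcl.csInf_mem hne (OrderBot.bddBelow _), fun v hv => csInf_le (OrderBot.bddBelow _) hv⟩

include hlam in
-- This equivalence turns events about the next time into inequalities for the cumulated rate;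
-- measurability and laws of `timeStep` are read off from it.
theorem timeStep_le_iff (h : H) (x : ℝ) (v : ℝ≥0) :
    timeStep lam g T h x ≤ v ↔ T h ≤ v ∧ x ≤ (lam.real univ)⁻¹ * cumRate lam g T h v := by
  have hl := hg.isLeast_timeStep lam hlam (T := T) h x
  refine ⟨fun hv => ⟨hl.1.1.trans hv, hl.1.2.trans ?_⟩, fun hv => hl.2 hv⟩
  have := measureReal_univ_pos lam hlam
  have := hg.cumRate_mono lam (T := T) h hv
  gcongr

include hlam in
theorem le_timeStep (h : H) (x : ℝ) : T h ≤ timeStep lam g T h x :=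
  (hg.isLeast_timeStep lam hlam h x).1.1

include hlam in
theorem lt_timeStep (h : H) {x : ℝ} (hx : 0 < x) : T h < timeStep lam g T h x := by
  refine (hg.le_timeStep lam hlam h x).lt_of_ne fun h1 => ?_
  have h2 := (hg.isLeast_timeStep lam hlam (T := T) h x).1.2
  rw [cumRate_of_le lam h1.ge, mul_zero] at h2
  linarith

include hlam in
-- By minimality the level is not yet reached just before the time step; continuity then excludes
-- overshooting.
theorem cumRate_timeStep (h : H) {x : ℝ} (hx : 0 < x) :
    cumRate lam g T h (timeStep lam g T h x) = lam.real univ * x := by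
  have hL := measureReal_univ_pos lam hlam
  refine le_antisymm (le_of_forall_pos_le_add fun ε hε => ?_) ?_
  · have hlt := hg.lt_timeStep lam hlam (T := T) h hx
    have hcont := (hg.continuous_cumRate lam (T := T) h).continuousAt
      (x := timeStep lam g T h x)
    have h1 : ∀ᶠ v in 𝓝[<] (timeStep lam g T h x),
        cumRate lam g T h (timeStep lam g T h x) - ε < cumRate lam g T h v :=
      (hcont.eventually (lt_mem_nhds (by linarith))).filter_mono nhdsWithin_le_nhds
    have h2 : ∀ᶠ v in 𝓝[<] (timeStep lam g T h x), v ∈ Ioo (T h) (timeStep lam g T h x) :=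
      Ioo_mem_nhdsLT hlt
    -- Here `0 < x` is essential: it puts `T h` strictly to the left, so there are times just before
    -- the step.
    have : (𝓝[<] (timeStep lam g T h x)).NeBot := nhdsLT_neBot_of_exists_lt ⟨_, hlt⟩
    obtain ⟨v, hv1, hv2⟩ := (h1.and h2).exists
    have h3 : ¬ timeStep lam g T h x ≤ v := not_le.2 hv2.2
    rw [hg.timeStep_le_iff lam hlam] at h3
    have h4 : (lam.real univ)⁻¹ * cumRate lam g T h v < x := by
      by_contra! h5
      exact h3 ⟨hv2.1.le, h5⟩
    rw [inv_mul_lt_iff₀ hL] at h4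
    linarith
  · have := (hg.isLeast_timeStep lam hlam (T := T) h x).1.2
    rwa [le_inv_mul_iff₀ hL] at this

include hlam in
theorem measurable_timeStep_section (h : H) : Measurable (timeStep lam g T h) := by
  refine Monotone.measurable fun x y hxy => ?_
  have hy := (hg.isLeast_timeStep lam hlam (T := T) h y).1
  exact (hg.timeStep_le_iff lam hlam h x _).2 ⟨hy.1, hxy.trans hy.2⟩

include hT hlam in
theorem measurable_timeStep : Measurable fun p : H × ℝ => timeStep lam g T p.1 p.2 := by
  refine measurable_of_Iic fun v => ?_
  have : (fun p : H × ℝ => timeStep lam g T p.1 p.2) ⁻¹' Iic v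
      = {p | T p.1 ≤ v} ∩ {p | p.2 ≤ (lam.real univ)⁻¹ * cumRate lam g T p.1 v} := by
    ext p
    simp only [mem_preimage, mem_Iic, hg.timeStep_le_iff lam hlam]
    rfl
  rw [this]
  refine (measurableSet_le (hT.comp measurable_fst) measurable_const).inter
    (measurableSet_le measurable_snd (measurable_const.mul ?_))
  exact (hg.measurable_cumRate lam hT).comp (measurable_fst.prodMk measurable_const)

omit [MeasurableSpace A] hg in
omit [MeasurableSpace H] in
-- The measures to be compared in `map_timeStep` have infinite total mass, so uniqueness is obtained
-- from the exhausting sequence of initial segments with integer endpoints.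
theorem ext_of_Iic_of_natCast {μ ν : Measure ℝ≥0} (hμ : ∀ v : ℝ≥0, μ (Iic v) ≠ ∞)
    (h : ∀ v, μ (Iic v) = ν (Iic v)) : μ = ν := by
  refine Measure.ext_of_generateFrom_of_iUnion (range Iic) (fun n : ℕ => Iic (n : ℝ≥0))
    ?_ isPiSystem_Iic ?_ (fun n => ⟨_, rfl⟩) (fun n => hμ _) ?_
  · rw [← borel_eq_generateFrom_Iic]; exact BorelSpace.measurable_eq
  · refine eq_univ_of_forall fun x => ?_
    obtain ⟨n, hn⟩ := exists_nat_ge x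
    exact mem_iUnion.2 ⟨n, hn⟩
  · rintro _ ⟨v, rfl⟩
    exact h v

include hlam in
/-- The time step carries Lebesgue measure to the measure with the mean rate as density. -/
theorem map_timeStep (h : H) :
    (volume.restrict (Ioi (0 : ℝ))).map (timeStep lam g T h)
      = (timeMeasure.restrict (Ioi (T h))).withDensity
          fun s => ENNReal.ofReal ((lam.real univ)⁻¹ * rate lam g h s) := by
  have hL := measureReal_univ_pos lam hlam
  have hm := hg.measurable_timeStep_section lam hlam (T := T) h
  have hval : ∀ v, (volume.restrict (Ioi (0 : ℝ))).map (timeStep lam g T h) (Iic v)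
      = ENNReal.ofReal ((lam.real univ)⁻¹ * cumRate lam g T h v) := by
    intro v
    rw [Measure.map_apply hm measurableSet_Iic, Measure.restrict_apply (hm measurableSet_Iic)]
    have : timeStep lam g T h ⁻¹' Iic v ∩ Ioi 0
        = Ioc 0 ((lam.real univ)⁻¹ * cumRate lam g T h v) := by
      ext x
      simp only [mem_inter_iff, mem_preimage, mem_Iic, mem_Ioi, mem_Ioc,
        hg.timeStep_le_iff lam hlam]
      constructor
      · rintro ⟨⟨_, h2⟩, h3⟩; exact ⟨h3, h2⟩
      · rintro ⟨h3, h2⟩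
        refine ⟨⟨?_, h2⟩, h3⟩
        -- Before `T h` the cumulated rate vanishes, which is incompatible with `0 < x`.
        by_contra! hv
        rw [cumRate_of_le lam hv.le] at h2
        linarith
    rw [this, Real.volume_Ioc, sub_zero]
  refine ext_of_Iic_of_natCast (fun v => by rw [hval]; exact ENNReal.ofReal_ne_top) fun v => ?_
  rw [hval, withDensity_apply _ measurableSet_Iic, Measure.restrict_restrict measurableSet_Iic,
    inter_comm, Ioi_inter_Iic]
  simp_rw [ENNReal.ofReal_mul (inv_nonneg.2 hL.le)]
  rw [lintegral_const_mul _ (hg.measurable_rate_section lam h).ennreal_ofReal,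
    hg.ofReal_cumRate lam]

omit hg [MeasurableSpace A] [MeasurableSpace H] in
-- The endpoint `0` is dropped as a null set because `cumRate_timeStep` holds for strictly positive
-- arguments only.
theorem lintegral_expMeasure {r : ℝ} (f : ℝ → ℝ≥0∞) (hf : Measurable f) :
    ∫⁻ x, f x ∂expMeasure r
      = ∫⁻ x in Ioi (0 : ℝ), ENNReal.ofReal (r * Real.exp (-(r * x))) * f x := by
  have h0 : expMeasure r = volume.withDensity (exponentialPDF r) := rfl
  have hm : Measurable (exponentialPDF r) := (measurable_exponentialPDFReal r).ennreal_ofReal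
  rw [h0, lintegral_withDensity_eq_lintegral_mul _ hm hf, setLIntegral_congr Ioi_ae_eq_Ici,
    ← lintegral_indicator measurableSet_Ici]
  refine lintegral_congr fun x => ?_
  rw [Pi.mul_apply, exponentialPDF_eq]
  by_cases hx : 0 ≤ x
  · rw [indicator_of_mem (mem_Ici.2 hx), if_pos hx]
  · rw [indicator_of_notMem (by simpa using hx), if_neg hx]; simp

include hlam in
/-- The law of the next time. -/
theorem lintegral_timeStep (h : H) (f : ℝ≥0 → ℝ≥0∞) (hf : Measurable f) :
    ∫⁻ x, f (timeStep lam g T h x) ∂expMeasure (lam.real univ)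
      = ∫⁻ s in Ioi (T h), ENNReal.ofReal (rate lam g h s * Real.exp (-cumRate lam g T h s))
          * f s ∂timeMeasure := by
  have hL := measureReal_univ_pos lam hlam
  have hm := hg.measurable_timeStep_section lam hlam (T := T) h
  have hr : Measurable (cumRate lam g T h) := (hg.continuous_cumRate lam h).measurable
  have hrate := hg.measurable_rate_section lam h
  rw [lintegral_expMeasure (fun x => f (timeStep lam g T h x)) (hf.comp hm)]
  -- The exponent `lam.real univ * x` is the cumulated rate at the image point, so the whole
  -- integrand is a function of `timeStep` and the substitution `map_timeStep` applies.
  have h1 : ∫⁻ x in Ioi (0 : ℝ), ENNReal.ofReal (lam.real univ *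
        Real.exp (-(lam.real univ * x))) * f (timeStep lam g T h x)
      = ∫⁻ x in Ioi (0 : ℝ), (fun s => ENNReal.ofReal (lam.real univ *
        Real.exp (-cumRate lam g T h s)) * f s) (timeStep lam g T h x) := by
    refine setLIntegral_congr_fun measurableSet_Ioi fun x hx => ?_
    simp only [hg.cumRate_timeStep lam hlam h (mem_Ioi.1 hx)]
  have hF : Measurable fun s => ENNReal.ofReal (lam.real univ *
        Real.exp (-cumRate lam g T h s)) * f s :=
    (hr.neg.exp.const_mul _).ennreal_ofReal.mul hf
  rw [h1, ← lintegral_map hF hm, hg.map_timeStep lam hlam h,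
    lintegral_withDensity_eq_lintegral_mul _ (hrate.const_mul _).ennreal_ofReal hF]
  refine lintegral_congr fun s => ?_
  rw [Pi.mul_apply, ← mul_assoc, ← ENNReal.ofReal_mul
    (mul_nonneg (inv_nonneg.2 hL.le) (hg.rate_nonneg lam h s))]
  congr 2
  field_simp

include hlam in
/-- The probability that the next time is later than `v`. -/
theorem lintegral_Ioi_rate (h : H) {v : ℝ≥0} (hv : T h ≤ v) :
    ∫⁻ s in Ioi v, ENNReal.ofReal (rate lam g h s * Real.exp (-cumRate lam g T h s)) ∂timeMeasure
      = ENNReal.ofReal (Real.exp (-cumRate lam g T h v)) := by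
  have hL := measureReal_univ_pos lam hlam
  -- For the indicator of `(v, ∞)` the left side of the law of the next time becomes the tail of an
  -- exponential law.
  have h1 := hg.lintegral_timeStep lam hlam (T := T) h ((Ioi v).indicator 1)
    (measurable_one.indicator measurableSet_Ioi)
  have h2 : ∫⁻ s in Ioi (T h), ENNReal.ofReal (rate lam g h s * Real.exp (-cumRate lam g T h s))
          * (Ioi v).indicator 1 s ∂timeMeasure
      = ∫⁻ s in Ioi v, ENNReal.ofReal (rate lam g h s * Real.exp (-cumRate lam g T h s))
          ∂timeMeasure := by
    rw [← lintegral_indicator measurableSet_Ioi, ← lintegral_indicator measurableSet_Ioi]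
    refine lintegral_congr fun s => ?_
    by_cases hs : v < s
    · simp [indicator, hs, hv.trans_lt hs]
    · simp [indicator, hs]
  have h3 : ∀ x, (Ioi v).indicator (1 : ℝ≥0 → ℝ≥0∞) (timeStep lam g T h x)
      = (Ioi ((lam.real univ)⁻¹ * cumRate lam g T h v)).indicator 1 x := by
    intro x
    have : v < timeStep lam g T h x ↔ (lam.real univ)⁻¹ * cumRate lam g T h v < x := by
      rw [← not_le, hg.timeStep_le_iff lam hlam, ← not_le]
      simp [hv]
    by_cases hx : v < timeStep lam g T h x
    · simp [indicator, hx, this.1 hx]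
    · simp [indicator, hx, mt this.2 hx]
  rw [h2] at h1
  rw [← h1]
  simp_rw [h3]
  rw [lintegral_indicator_one measurableSet_Ioi]
  have := isProbabilityMeasure_expMeasure hL
  have h4 := cdf_expMeasure_eq hL ((lam.real univ)⁻¹ * cumRate lam g T h v)
  rw [if_pos (mul_nonneg (inv_nonneg.2 hL.le) (hg.cumRate_nonneg lam h v)), cdf_eq_real,
    mul_inv_cancel_left₀ hL.ne'] at h4
  rw [← compl_Iic, ← ENNReal.ofReal_toReal (measure_ne_top _ _)]
  congr 1
  change (expMeasure (lam.real univ)).real _ = _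
  rw [probReal_compl_eq_one_sub measurableSet_Iic, h4]
  ring

end IsBoundedField

/-! ### Quantile transforms -/

/-- The distribution function of a law without atoms is uniformly distributed under that law. -/
theorem measure_cdf_le (q : Measure ℝ) [IsProbabilityMeasure q] (hq : ∀ r, q {r} = 0) {x : ℝ}
    (hx0 : 0 ≤ x) (hx1 : x ≤ 1) : q {r | cdf q r ≤ x} = ENNReal.ofReal x := by
  -- A jump of the distribution function would be an atom.
  have hcont : Continuous (cdf q) := by
    refine continuous_iff_continuousAt.2 fun r => ?_
    refine (monotone_cdf q).continuousAt_iff_leftLim_eq_rightLim.2 ?_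
    rw [StieltjesFunction.rightLim_eq]
    have h1 := (cdf q).measure_singleton r
    rw [measure_cdf, hq, eq_comm, ENNReal.ofReal_eq_zero] at h1
    exact le_antisymm ((monotone_cdf q).leftLim_le le_rfl) (by linarith)
  have hval : ∀ y ∈ Ioo (0 : ℝ) 1, ∃ r, cdf q r = y := fun y hy =>
    mem_range_of_exists_le_of_exists_ge hcont
      (((tendsto_cdf_atBot q).eventually (gt_mem_nhds hy.1)).exists.imp fun _ h => h.le)
      (((tendsto_cdf_atTop q).eventually (lt_mem_nhds hy.2)).exists.imp fun _ h => h.le)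
  have hup : ∀ y ∈ Ioo (0 : ℝ) 1, x < y → q {r | cdf q r ≤ x} ≤ ENNReal.ofReal y := by
    intro y hy hxy
    obtain ⟨r, rfl⟩ := hval y hy
    rw [ofReal_cdf]
    refine measure_mono fun s hs => ?_
    by_contra hsr
    have := monotone_cdf q (not_le.1 hsr).le
    exact absurd (lt_of_lt_of_le hxy this) (not_lt.2 hs)
  rcases hx1.eq_or_lt with rfl | hx1
  · have : {r | cdf q r ≤ 1} = univ := eq_univ_of_forall fun r => cdf_le_one q r
    rw [this, measure_univ, ENNReal.ofReal_one]
  · refine le_antisymm ?_ ?_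
    · have h1 : Tendsto (fun y => ENNReal.ofReal y) (𝓝[>] x) (𝓝 (ENNReal.ofReal x)) :=
        (ENNReal.continuous_ofReal.tendsto x).mono_left nhdsWithin_le_nhds
      refine ge_of_tendsto h1 ?_
      filter_upwards [Ioo_mem_nhdsGT hx1] with y hy
      exact hup y ⟨hx0.trans_lt hy.1, hy.2⟩ hy.1
    · rcases hx0.eq_or_lt with rfl | hx0
      · simp
      · obtain ⟨r, rfl⟩ := hval x ⟨hx0, hx1⟩
        rw [ofReal_cdf]
        exact measure_mono fun s hs => monotone_cdf q hs

/-- By uniformity the level `0` is null, and the level `1` lies in the complement of `{cdf ≤ 1 -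
ε}`, which has mass `ε`. -/
theorem ae_cdf_mem_Ioo (q : Measure ℝ) [IsProbabilityMeasure q] (hq : ∀ r, q {r} = 0) :
    ∀ᵐ r ∂q, cdf q r ∈ Ioo (0 : ℝ) 1 := by
  have h0 : q {r | cdf q r ≤ 0} = 0 := by simpa using measure_cdf_le q hq le_rfl zero_le_one
  have hm : Measurable (cdf q) := (monotone_cdf q).measurable
  have h1 : ∀ᵐ r ∂q, cdf q r ≠ 1 := by
    rw [ae_iff]
    refine le_antisymm (ENNReal.le_of_forall_pos_le_add fun ε hε _ => ?_) zero_le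
    rcases le_or_gt 1 ε with h | h
    · refine prob_le_one.trans ?_
      rw [zero_add]; exact_mod_cast h
    · have h2 := measure_cdf_le q hq (x := 1 - ε) (sub_nonneg.2 (by exact_mod_cast h.le))
        (by simp)
      have h3 : q {r | cdf q r ≤ 1 - ε}ᶜ = ε := by
        rw [prob_compl_eq_one_sub (measurableSet_le hm measurable_const), h2,
          ENNReal.ofReal_sub _ (NNReal.coe_nonneg ε), ENNReal.ofReal_one, ENNReal.ofReal_coe_nnreal]
        exact ENNReal.sub_sub_cancel ENNReal.one_ne_top (by exact_mod_cast h.le)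
      rw [zero_add, ← h3]
      refine measure_mono fun r hr => ?_
      simp only [mem_ofPred_eq, ne_eq, not_not] at hr
      have : (0 : ℝ) < ε := by exact_mod_cast hε
      simp only [mem_compl_iff, mem_ofPred_eq, hr]
      linarith
  have h0' : ∀ᵐ r ∂q, ¬ cdf q r ≤ 0 := by rw [ae_iff]; simpa using h0
  filter_upwards [h0', h1] with r hr0 hr1
  exact ⟨not_le.1 hr0, (cdf_le_one q r).lt_of_ne hr1⟩

/-- The limits of the distribution function at `±∞` make the set nonempty and bounded below,
precisely because `0 < x < 1`; right continuity puts the infimum into the set. -/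
theorem isLeast_quantile (p : Measure ℝ) {x : ℝ} (hx : x ∈ Ioo (0 : ℝ) 1) :
    IsLeast {b | x ≤ cdf p b} (sInf {b | x ≤ cdf p b}) := by
  have hne : {b | x ≤ cdf p b}.Nonempty :=
    ((tendsto_cdf_atTop p).eventually (lt_mem_nhds hx.2)).exists.imp fun _ h => h.le
  have hbd : BddBelow {b | x ≤ cdf p b} := by
    obtain ⟨a, ha⟩ := ((tendsto_cdf_atBot p).eventually (gt_mem_nhds hx.1)).exists
    refine ⟨a, fun b hb => ?_⟩
    by_contra hab
    exact absurd (lt_of_lt_of_le ha hb) (not_lt.2 (monotone_cdf p (not_le.1 hab).le))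
  refine ⟨?_, fun b hb => csInf_le hbd hb⟩
  have h1 : Tendsto (cdf p) (𝓝[>] (sInf {b | x ≤ cdf p b})) (𝓝 (cdf p (sInf {b | x ≤ cdf p b}))) :=
    ((cdf p).right_continuous _).tendsto.mono_left (nhdsWithin_mono _ Ioi_subset_Ici_self)
  refine ge_of_tendsto h1 ?_
  filter_upwards [self_mem_nhdsWithin] with y hy
  obtain ⟨b, hb, hby⟩ := exists_lt_of_csInf_lt hne hy
  exact le_trans hb (monotone_cdf p hby.le)

theorem quantile_le_iff (p : Measure ℝ) {x : ℝ} (hx : x ∈ Ioo (0 : ℝ) 1) (b : ℝ) :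
    sInf {b | x ≤ cdf p b} ≤ b ↔ x ≤ cdf p b :=
  ⟨fun h => (isLeast_quantile p hx).1.trans (monotone_cdf p h),
    fun h => (isLeast_quantile p hx).2 h⟩

/-- The transform that carries a law `q` without atoms to the law `p`. -/
noncomputable def quantileTransform (q p : Measure ℝ) (r : ℝ) : ℝ :=
  -- The default `0` is used on a `q`-null set only when `q` has no atoms; it keeps the transform
  -- measurable without exception.
  if cdf q r ∈ Ioo (0 : ℝ) 1 then sInf {b | cdf q r ≤ cdf p b} else 0

theorem quantileTransform_preimage_Iic (q p : Measure ℝ) (b r : ℝ) :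
    quantileTransform q p r ≤ b ↔
      (cdf q r ∈ Ioo (0 : ℝ) 1 ∧ cdf q r ≤ cdf p b) ∨ (cdf q r ∉ Ioo (0 : ℝ) 1 ∧ 0 ≤ b) := by
  unfold quantileTransform
  split_ifs with h
  · simp [quantile_le_iff p h b, h.1, h.2]
  · simp only [h, false_and, not_false_eq_true, true_and, false_or]

theorem measurable_quantileTransform {H : Type*} [MeasurableSpace H] (q : Measure ℝ)
    (p : H → Measure ℝ) (hp : ∀ b, Measurable fun h => cdf (p h) b) :
    Measurable fun x : H × ℝ => quantileTransform q (p x.1) x.2 := by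
  refine measurable_of_Iic fun b => ?_
  have hm : Measurable fun x : H × ℝ => cdf q x.2 :=
    (monotone_cdf q).measurable.comp measurable_snd
  have h1 : MeasurableSet {x : H × ℝ | cdf q x.2 ∈ Ioo (0 : ℝ) 1} := hm measurableSet_Ioo
  have : (fun x : H × ℝ => quantileTransform q (p x.1) x.2) ⁻¹' Iic b
      = ({x | cdf q x.2 ∈ Ioo (0 : ℝ) 1} ∩ {x | cdf q x.2 ≤ cdf (p x.1) b})
        ∪ ({x | cdf q x.2 ∈ Ioo (0 : ℝ) 1}ᶜ ∩ {_x | 0 ≤ b}) := by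
    ext x
    exact quantileTransform_preimage_Iic q (p x.1) b x.2
  rw [this]
  exact (h1.inter (measurableSet_le hm ((hp b).comp measurable_fst))).union
    (h1.compl.inter (MeasurableSet.const _))

/-- Up to a null set the transform is at most `b` exactly when `cdf q r ≤ cdf p b`, and `cdf q` is
uniform under `q`. -/
theorem map_quantileTransform (q p : Measure ℝ) [IsProbabilityMeasure q] [IsProbabilityMeasure p]
    (hq : ∀ r, q {r} = 0) : q.map (quantileTransform q p) = p := by
  have hm : Measurable (quantileTransform q p) :=
    (measurable_quantileTransform (H := Unit) q (fun _ => p) fun _ => measurable_const).comp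
      (measurable_const (a := ()) |>.prodMk measurable_id)
  have := Measure.isProbabilityMeasure_map (μ := q) hm.aemeasurable
  refine Measure.ext_of_Iic _ _ fun b => ?_
  rw [Measure.map_apply hm measurableSet_Iic, ← ofReal_cdf p b,
    ← measure_cdf_le q hq (cdf_nonneg p b) (cdf_le_one p b)]
  refine measure_congr ?_
  filter_upwards [ae_cdf_mem_Ioo q hq] with r hr
  refine propext ?_
  change quantileTransform q p r ≤ b ↔ cdf q r ≤ cdf p b
  rw [quantileTransform_preimage_Iic]
  tauto

/-! ### The next mark -/

section Mark

variable {H A : Type*} [MeasurableSpace H] [MeasurableSpace A]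

/-- The law of the next real mark at time `u`. -/
noncomputable def markLaw (lam' : Measure ℝ) (π : ℝ → A) (g : H → ℝ≥0 → A → ℝ) (x : H × ℝ≥0) :
    Measure ℝ :=
  (ENNReal.ofReal (∫ r, g x.1 x.2 (π r) ∂lam'))⁻¹ •
    lam'.withDensity fun r => ENNReal.ofReal (g x.1 x.2 (π r))

/-- The next real mark at time `u`, as a function of a mark with law `lam' / lam'(ℝ)`. -/
noncomputable def markStep (lam' : Measure ℝ) (π : ℝ → A) (g : H → ℝ≥0 → A → ℝ) (x : H × ℝ≥0)
    (r : ℝ) : ℝ :=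
  quantileTransform ((lam' univ)⁻¹ • lam') (markLaw lam' π g x) r

variable {lam : Measure A} [IsFiniteMeasure lam] {lam' : Measure ℝ} {π : ℝ → A}

namespace IsNonatomicLift

variable (hl : IsNonatomicLift lam lam' π)
include hl

theorem measure_univ_eq : lam' univ = lam univ := by
  rw [← hl.map_eq, Measure.map_apply hl.measurable MeasurableSet.univ, preimage_univ]

theorem real_univ_eq : lam'.real univ = lam.real univ := by
  rw [Measure.real, Measure.real, hl.measure_univ_eq]

theorem isProbabilityMeasure (hlam : lam ≠ 0) : IsProbabilityMeasure ((lam' univ)⁻¹ • lam') := by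
  have := hl.finite
  have : NeZero lam' := ⟨fun h => hlam (by rw [← hl.map_eq, h, Measure.map_zero])⟩
  infer_instance

theorem lintegral_comp {f : A → ℝ≥0∞} (hf : Measurable f) :
    ∫⁻ r, f (π r) ∂lam' = ∫⁻ a, f a ∂lam := by
  rw [← hl.map_eq, lintegral_map hf hl.measurable]

end IsNonatomicLift

namespace IsBoundedField

variable {g : H → ℝ≥0 → A → ℝ} {c C : ℝ} (hg : IsBoundedField g c C)
  (hl : IsNonatomicLift lam lam' π) (hlam : lam ≠ 0)
include hg hl

theorem integral_lift (h : H) (u : ℝ≥0) : ∫ r, g h u (π r) ∂lam' = rate lam g h u := by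
  rw [rate, ← hl.map_eq, integral_map hl.measurable.aemeasurable
    (hg.measurable_section h u).aestronglyMeasurable]

theorem integrable_lift (h : H) (u : ℝ≥0) : Integrable (fun r => g h u (π r)) lam' := by
  have := hl.finite
  exact .of_bound ((hg.measurable_section h u).comp hl.measurable).aestronglyMeasurable C
    (.of_forall fun r => hg.abs_le h u (π r))

include hlam in
theorem rate_pos (h : H) (u : ℝ≥0) : 0 < rate lam g h u :=
  (mul_pos hg.pos (measureReal_univ_pos lam hlam)).trans_le (hg.le_rate lam h u)

include hlam in
theorem isProbabilityMeasure_markLaw (x : H × ℝ≥0) :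
    IsProbabilityMeasure (markLaw lam' π g x) := by
  constructor
  have h1 := hg.integrable_lift hl x.1 x.2
  have h2 := hg.rate_pos hl hlam x.1 x.2
  rw [← hg.integral_lift hl] at h2
  rw [markLaw, Measure.smul_apply, withDensity_apply _ MeasurableSet.univ, Measure.restrict_univ,
    ← ofReal_integral_eq_lintegral_ofReal h1 (.of_forall fun r => hg.nonneg _ _ _), smul_eq_mul]
  exact ENNReal.inv_mul_cancel (ENNReal.ofReal_pos.2 h2).ne' ENNReal.ofReal_ne_top

include hlam in
theorem cdf_markLaw (x : H × ℝ≥0) (b : ℝ) :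
    cdf (markLaw lam' π g x) b
      = (∫ r in Iic b, g x.1 x.2 (π r) ∂lam') / ∫ r, g x.1 x.2 (π r) ∂lam' := by
  have := hg.isProbabilityMeasure_markLaw hl hlam x
  have h1 := hg.integrable_lift hl x.1 x.2
  have h0 : 0 ≤ ∫ r in Iic b, g x.1 x.2 (π r) ∂lam' := integral_nonneg fun r => hg.nonneg _ _ _
  have h2 : 0 ≤ ∫ r, g x.1 x.2 (π r) ∂lam' := integral_nonneg fun r => hg.nonneg _ _ _
  rw [cdf_eq_real, Measure.real, markLaw, Measure.smul_apply, withDensity_apply _ measurableSet_Iic,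
    ← ofReal_integral_eq_lintegral_ofReal h1.integrableOn (.of_forall fun r => hg.nonneg _ _ _),
    smul_eq_mul, ENNReal.toReal_mul, ENNReal.toReal_inv, ENNReal.toReal_ofReal h2,
    ENNReal.toReal_ofReal h0, inv_mul_eq_div]

include hlam in
theorem measurable_markStep :
    Measurable fun y : (H × ℝ≥0) × ℝ => markStep lam' π g y.1 y.2 := by
  have := hl.finite
  have h1 : StronglyMeasurable fun y : (H × ℝ≥0) × ℝ => g y.1.1 y.1.2 (π y.2) :=
    (hg.measurable.comp (measurable_fst.fst.prodMk
      (measurable_fst.snd.prodMk (hl.measurable.comp measurable_snd)))).stronglyMeasurable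
  have h2 : ∀ b, Measurable fun x => cdf (markLaw lam' π g x) b := by
    intro b
    simp_rw [hg.cdf_markLaw hl hlam]
    exact (h1.integral_prod_right (ν := lam'.restrict (Iic b))).measurable.div
      h1.integral_prod_right.measurable
  exact measurable_quantileTransform ((lam' univ)⁻¹ • lam') _ h2

include hlam in
/-- The law of the next mark. -/
theorem lintegral_markStep (x : H × ℝ≥0) {f : ℝ → ℝ≥0∞} (hf : Measurable f) :
    ∫⁻ r, f (markStep lam' π g x r) ∂((lam' univ)⁻¹ • lam')
      = (ENNReal.ofReal (rate lam g x.1 x.2))⁻¹ *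
        ∫⁻ r, ENNReal.ofReal (g x.1 x.2 (π r)) * f r ∂lam' := by
  have := hl.isProbabilityMeasure hlam
  have := hg.isProbabilityMeasure_markLaw hl hlam x
  have hm : Measurable fun r => markStep lam' π g x r :=
    Measurable.of_uncurry_left (f := markStep lam' π g) (hg.measurable_markStep hl hlam)
  have hw : Measurable fun r => ENNReal.ofReal (g x.1 x.2 (π r)) :=
    ((hg.measurable_section x.1 x.2).comp hl.measurable).ennreal_ofReal
  have h1 : ((lam' univ)⁻¹ • lam').map (fun r => markStep lam' π g x r) = markLaw lam' π g x :=
    map_quantileTransform ((lam' univ)⁻¹ • lam') (markLaw lam' π g x)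
      fun r => by rw [Measure.smul_apply, hl.nonatomic, smul_zero]
  rw [← lintegral_map hf hm, h1, markLaw, lintegral_smul_measure, hg.integral_lift hl,
    lintegral_withDensity_eq_lintegral_mul _ hw hf]
  simp only [Pi.mul_apply, smul_eq_mul]

omit hg in
include hlam in
theorem cdf_normalized (r : ℝ) :
    cdf ((lam' univ)⁻¹ • lam') r = lam'.real (Iic r) / lam'.real univ := by
  have := hl.isProbabilityMeasure hlam
  rw [cdf_eq_real, Measure.real, Measure.smul_apply, smul_eq_mul, ENNReal.toReal_mul,
    ENNReal.toReal_inv, inv_mul_eq_div, Measure.real, Measure.real]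

include hlam in
-- The hypothesis on `r` fails on a null set only, by `ae_cdf_mem_Ioo`; this is why the formula for
-- the marks is asserted almost surely.
theorem isLeast_markStep (x : H × ℝ≥0) {r : ℝ}
    (hr : cdf ((lam' univ)⁻¹ • lam') r ∈ Ioo (0 : ℝ) 1) :
    IsLeast {b : ℝ | lam'.real (Iic r) / lam'.real univ ≤
      (∫ r in Iic b, g x.1 x.2 (π r) ∂lam') / (∫ r, g x.1 x.2 (π r) ∂lam')}
      (markStep lam' π g x r) := by
  rw [markStep, quantileTransform, if_pos hr]
  have := isLeast_quantile (markLaw lam' π g x) hr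
  simp_rw [hg.cdf_markLaw hl hlam] at this ⊢
  rwa [cdf_normalized hl hlam] at this ⊢

variable {T : H → ℝ≥0} (hT : Measurable T)

include hlam hT in
/-- The law of the next point. -/
theorem lintegral_step (h : H) {f : ℝ≥0 × A → ℝ≥0∞} (hf : Measurable f) :
    ∫⁻ x, ∫⁻ r, f (timeStep lam g T h x, π (markStep lam' π g (h, timeStep lam g T h x) r))
        ∂((lam' univ)⁻¹ • lam') ∂expMeasure (lam.real univ)
      = ∫⁻ p, stepDensity lam g T h p * f p ∂timeMeasure.prod lam := by
  have hgh : Measurable fun q : ℝ≥0 × A => g h q.1 q.2 :=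
    hg.measurable.comp (measurable_const.prodMk measurable_id)
  have hcum := (hg.continuous_cumRate lam (T := T) h).measurable
  have hmf : Measurable fun s => (ENNReal.ofReal (rate lam g h s))⁻¹ *
      ∫⁻ a, ENNReal.ofReal (g h s a) * f (s, a) ∂lam :=
    (hg.measurable_rate_section lam h).ennreal_ofReal.inv.mul
      (hgh.ennreal_ofReal.mul hf).lintegral_prod_right'
  have hm : ∀ s, Measurable fun a => ENNReal.ofReal (g h s a) * f (s, a) := fun s =>
    (hg.measurable_section h s).ennreal_ofReal.mul (hf.comp measurable_prodMk_left)
  have h1 : ∀ s : ℝ≥0, ∫⁻ r, f (s, π (markStep lam' π g (h, s) r)) ∂((lam' univ)⁻¹ • lam')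
      = (ENNReal.ofReal (rate lam g h s))⁻¹ *
        ∫⁻ a, ENNReal.ofReal (g h s a) * f (s, a) ∂lam := by
    intro s
    have hfs : Measurable fun a => f (s, a) := hf.comp measurable_prodMk_left
    rw [← hl.lintegral_comp (hm s)]
    exact hg.lintegral_markStep hl hlam (h, s) (hfs.comp hl.measurable)
  have hD : Measurable (stepDensity lam g T h) :=
    Measurable.ite (measurableSet_lt measurable_const measurable_fst)
      ((hgh.mul (hcum.comp measurable_fst).neg.exp).ennreal_ofReal) measurable_const
  simp_rw [h1]
  rw [hg.lintegral_timeStep lam hlam h _ hmf, lintegral_prod (fun p => stepDensity lam g T h p * f p)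
      (hD.mul hf).aemeasurable,
    ← lintegral_indicator measurableSet_Ioi]
  refine lintegral_congr fun s => ?_
  by_cases hs : T h < s
  · have hr := hg.rate_pos hl hlam h s
    simp only [indicator, mem_Ioi, hs, if_true, stepDensity]
    -- The total rate in the density of the time cancels against the normalisation of the mark law.
    rw [ENNReal.ofReal_mul hr.le, mul_assoc, mul_left_comm, ← mul_assoc _ _⁻¹,
      ENNReal.mul_inv_cancel (ENNReal.ofReal_pos.2 hr).ne' ENNReal.ofReal_ne_top, one_mul,
      ← lintegral_const_mul _ (hm s)]
    refine lintegral_congr fun a => ?_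
    rw [ENNReal.ofReal_mul (hg.nonneg h s a)]
    ring
  · simp [indicator, hs, stepDensity]

end IsBoundedField

end Mark

/-! ### The natural filtration of a marked point process -/

/-- The first `n` points. -/
abbrev history {Ω E : Type*} (X : ℕ → Ω → E) (n : ℕ) (ω : Ω) : Fin n → E := fun i => X i ω

theorem exists_denseSeq_between {a b : ℝ≥0} (h : a < b) :
    ∃ n, a < TopologicalSpace.denseSeq ℝ≥0 n ∧ TopologicalSpace.denseSeq ℝ≥0 n < b := by
  obtain ⟨n, hn⟩ := (TopologicalSpace.denseRange_denseSeq ℝ≥0).exists_mem_open isOpen_Ioo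
    (nonempty_Ioo.2 h)
  exact ⟨n, hn⟩

open Classical in
/-- A point that is observed only on an event is measurable as soon as the events "observed, with
time at most `s` and mark in `B`" are. -/
theorem measurable_ite_of_Iic_prod {Ω A : Type*} [MeasurableSpace Ω] [MeasurableSpace A]
    {D : Set Ω} {Y : Ω → ℝ≥0 × A} (x₀ : ℝ≥0 × A)
    (h : ∀ (s : ℝ≥0) (B : Set A), MeasurableSet B →
      MeasurableSet {ω | ω ∈ D ∧ (Y ω).1 ≤ s ∧ (Y ω).2 ∈ B}) :
    Measurable fun ω => if ω ∈ D then Y ω else x₀ := by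
  have hDB : ∀ B : Set A, MeasurableSet B → MeasurableSet {ω | ω ∈ D ∧ (Y ω).2 ∈ B} := by
    intro B hB
    have : {ω | ω ∈ D ∧ (Y ω).2 ∈ B} = ⋃ n : ℕ, {ω | ω ∈ D ∧ (Y ω).1 ≤ n ∧ (Y ω).2 ∈ B} := by
      ext ω
      simp only [mem_ofPred_eq, mem_iUnion]
      refine ⟨fun hω => ?_, fun ⟨n, hω⟩ => ⟨hω.1, hω.2.2⟩⟩
      obtain ⟨n, hn⟩ := exists_nat_ge (Y ω).1
      exact ⟨n, hω.1, hn, hω.2⟩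
    rw [this]
    exact .iUnion fun n => h n B hB
  have hD : MeasurableSet D := by simpa using hDB univ MeasurableSet.univ
  refine Measurable.prodMk (f := fun ω => (if ω ∈ D then Y ω else x₀).1)
    (g := fun ω => (if ω ∈ D then Y ω else x₀).2) ?_ ?_
  · refine measurable_of_Iic fun s => ?_
    have : (fun ω => (if ω ∈ D then Y ω else x₀).1) ⁻¹' Iic s
        = {ω | ω ∈ D ∧ (Y ω).1 ≤ s ∧ (Y ω).2 ∈ univ} ∪ (Dᶜ ∩ {_ω | x₀.1 ≤ s}) := by
      ext ω
      by_cases hω : ω ∈ D <;> simp [hω]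
    rw [this]
    exact (h s univ MeasurableSet.univ).union (hD.compl.inter (MeasurableSet.const _))
  · intro B hB
    have : (fun ω => (if ω ∈ D then Y ω else x₀).2) ⁻¹' B
        = {ω | ω ∈ D ∧ (Y ω).2 ∈ B} ∪ (Dᶜ ∩ {_ω | x₀.2 ∈ B}) := by
      ext ω
      by_cases hω : ω ∈ D <;> simp [hω]
    rw [this]
    exact (hDB B hB).union (hD.compl.inter (MeasurableSet.const _))

section Natural

variable {Ω A : Type*} [MeasurableSpace A] {X : ℕ → Ω → ℝ≥0 × A}

theorem IsMarkedPath.strictMono {E : Type*} {x : ℕ → ℝ≥0 × E} (hx : IsMarkedPath x) :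
    StrictMono fun n => (x n).1 :=
  strictMono_nat_of_lt_succ hx.2.1

theorem IsMarkedPath.exists_lt {E : Type*} {x : ℕ → ℝ≥0 × E} (hx : IsMarkedPath x) (t : ℝ≥0) :
    ∃ n, t < (x n).1 :=
  (hx.2.2.eventually_gt_atTop t).exists

/-- All times are positive, so the left endpoint of the interval plays no role. -/
theorem pointMeasure_Ioc_prod (hX : ∀ ω, IsMarkedPath fun n => X n ω) (ω : Ω) (s : ℝ≥0)
    {B : Set A} (hB : MeasurableSet B) :
    pointMeasure X ω (Ioc 0 s ×ˢ B) = ∑' n, (Iic s ×ˢ B).indicator 1 (X n ω) := by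
  rw [pointMeasure, Measure.sum_apply _ (measurableSet_Ioc.prod hB)]
  refine tsum_congr fun n => ?_
  rw [Measure.dirac_apply' _ (measurableSet_Ioc.prod hB)]
  have h0 : 0 < (X n ω).1 := (hX ω).1 n
  have h1 : X n ω ∈ Ioc 0 s ×ˢ B ↔ X n ω ∈ Iic s ×ˢ B := by
    simp only [mem_prod, mem_Ioc, mem_Iic, h0, true_and]
  by_cases h : X n ω ∈ Iic s ×ˢ B
  · rw [indicator_of_mem h, indicator_of_mem (h1.2 h)]
  · rw [indicator_of_notMem h, indicator_of_notMem (mt h1.1 h)]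

theorem pointMeasure_eq_sum (hX : ∀ ω, IsMarkedPath fun n => X n ω) {ω : Ω} {s : ℝ≥0} {n : ℕ}
    (h : s < (X n ω).1) {B : Set A} (hB : MeasurableSet B) :
    pointMeasure X ω (Ioc 0 s ×ˢ B)
      = ∑ k ∈ Finset.range n, (Iic s ×ˢ B).indicator 1 (X k ω) := by
  rw [pointMeasure_Ioc_prod hX ω s hB, tsum_eq_sum]
  intro k hk
  have : (X n ω).1 ≤ (X k ω).1 := (hX ω).strictMono.monotone (by simpa using hk)
  refine indicator_of_notMem (fun hm => ?_) _
  exact absurd (h.trans_le this) (not_lt.2 hm.1)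

theorem measurable_pointMeasure {s t : ℝ≥0} (hst : s ≤ t) {B : Set A} (hB : MeasurableSet B) :
    Measurable[naturalSigma X t] fun ω => pointMeasure X ω (Ioc 0 s ×ˢ B) := by
  refine Measurable.mono (comap_measurable _) ?_ le_rfl
  exact le_iSup_of_le s (le_iSup_of_le hst (le_iSup_of_le B (le_iSup_of_le hB le_rfl)))

theorem measurableSet_time_le (hX : ∀ ω, IsMarkedPath fun n => X n ω) (n : ℕ) {s t : ℝ≥0}
    (hst : s ≤ t) : MeasurableSet[naturalSigma X t] {ω | (X n ω).1 ≤ s} := by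
  -- The index starts at `0`: the point `X n` has come once there are strictly more than `n` points.
  have : {ω | (X n ω).1 ≤ s} = {ω | (n : ℝ≥0∞) < pointMeasure X ω (Ioc 0 s ×ˢ univ)} := by
    ext ω
    simp only [mem_ofPred_eq]
    constructor
    · intro h
      rw [pointMeasure_Ioc_prod hX ω s MeasurableSet.univ]
      refine lt_of_lt_of_le ?_ (ENNReal.sum_le_tsum (Finset.range (n + 1)))
      have : ∀ k ∈ Finset.range (n + 1),
          (Iic s ×ˢ (univ : Set A)).indicator (1 : ℝ≥0 × A → ℝ≥0∞) (X k ω) = 1 := by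
        intro k hk
        refine indicator_of_mem ?_ _
        exact ⟨((hX ω).strictMono.monotone (by simpa [Nat.lt_succ_iff] using hk)).trans h, trivial⟩
      rw [Finset.sum_congr rfl this]
      simp only [Finset.sum_const, Finset.card_range, nsmul_eq_mul, mul_one]
      exact_mod_cast Nat.lt_succ_self n
    · intro h
      by_contra! hlt
      rw [pointMeasure_eq_sum hX hlt MeasurableSet.univ] at h
      refine absurd h (not_lt.2 ?_)
      refine (Finset.sum_le_card_nsmul _ _ 1 fun k _ => ?_).trans ?_
      · exact indicator_le_self' (by simp) _
      · simp
  rw [this]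
  exact measurableSet_lt measurable_const (measurable_pointMeasure hst MeasurableSet.univ)

/-- The mark of a point can be read at any time between its arrival and the next one: it lies in `B`
if the count of marks in `B` exceeds the contribution of the earlier points, which is measurable by
induction. Countably many reading times suffice. -/
theorem measurableSet_mem_Iic_prod (hX : ∀ ω, IsMarkedPath fun n => X n ω) {B : Set A}
    (hB : MeasurableSet B) (n : ℕ) :
    ∀ s : ℝ≥0, MeasurableSet[naturalSigma X s] {ω | X n ω ∈ Iic s ×ˢ B} := by
  induction n using Nat.strong_induction_on with
  | _ n ih =>
  intro s
  -- Cutting the reading times off at `s` keeps all events in the past of `s` and still leaves one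
  -- between the two arrivals whenever the earlier arrival is at most `s`.
  set q : ℕ → ℝ≥0 := fun j => min (TopologicalSpace.denseSeq ℝ≥0 j) s
  have hq : ∀ j, q j ≤ s := fun j => min_le_right _ _
  have hsum : ∀ (j : ℕ), Measurable[naturalSigma X s] fun ω =>
      ∑ k ∈ Finset.range n, (Iic (q j) ×ˢ B).indicator (1 : ℝ≥0 × A → ℝ≥0∞) (X k ω) := by
    intro j
    refine Finset.measurable_fun_sum _ fun k hk => ?_
    have h1 := naturalSigma_mono X (hq j) _ (ih k (Finset.mem_range.1 hk) (q j))
    exact Measurable.indicator (m := naturalSigma X s)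
      (f := fun _ : Ω => (1 : ℝ≥0∞)) measurable_const h1
  have hkey : ∀ ω j, (X n ω).1 ≤ q j → q j < (X (n + 1) ω).1 →
      ((X n ω).2 ∈ B ↔ ∑ k ∈ Finset.range n, (Iic (q j) ×ˢ B).indicator (1 : ℝ≥0 × A → ℝ≥0∞) (X k ω)
        < pointMeasure X ω (Ioc 0 (q j) ×ˢ B)) := by
    intro ω j h1 h2
    rw [pointMeasure_eq_sum hX h2 hB, Finset.sum_range_succ]
    have hfin : ∑ k ∈ Finset.range n, (Iic (q j) ×ˢ B).indicator (1 : ℝ≥0 × A → ℝ≥0∞) (X k ω) ≠ ∞ := by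
      refine (ENNReal.sum_lt_top.2 fun k _ => ?_).ne
      exact (indicator_le_self' (by simp) _).trans_lt (by simp)
    by_cases hB' : (X n ω).2 ∈ B
    · rw [indicator_of_mem (show X n ω ∈ Iic (q j) ×ˢ B from ⟨h1, hB'⟩)]
      simpa [hB'] using ENNReal.lt_add_right hfin one_ne_zero
    · rw [indicator_of_notMem (fun h => hB' h.2)]
      simp [hB']
  have : {ω | X n ω ∈ Iic s ×ˢ B} = ⋃ j, (({ω | (X n ω).1 ≤ q j} ∩ {ω | (X (n + 1) ω).1 ≤ q j}ᶜ)
      ∩ {ω | ∑ k ∈ Finset.range n, (Iic (q j) ×ˢ B).indicator (1 : ℝ≥0 × A → ℝ≥0∞) (X k ω)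
        < pointMeasure X ω (Ioc 0 (q j) ×ˢ B)}) := by
    ext ω
    simp only [mem_iUnion, mem_inter_iff, mem_compl_iff, mem_ofPred_eq, not_le, mem_prod, mem_Iic]
    constructor
    · rintro ⟨h1, h2⟩
      obtain ⟨j, hj1, hj2⟩ := exists_denseSeq_between ((hX ω).2.1 n)
      have h3 : (X n ω).1 ≤ q j := le_min hj1.le h1
      have h4 : q j < (X (n + 1) ω).1 := (min_le_left _ _).trans_lt hj2
      exact ⟨j, ⟨h3, h4⟩, (hkey ω j h3 h4).1 h2⟩
    · rintro ⟨j, ⟨h3, h4⟩, h5⟩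
      exact ⟨h3.trans (hq j), (hkey ω j h3 h4).2 h5⟩
  rw [this]
  refine MeasurableSet.iUnion fun j => ?_
  exact ((measurableSet_time_le hX n (hq j)).inter (measurableSet_time_le hX (n + 1) (hq j)).compl
    ).inter (measurableSet_lt (hsum j) (measurable_pointMeasure (hq j) hB))

open Classical in
/-- The points up to time `t`; later ones are replaced by `x₀`. -/
noncomputable def stoppedPoint (X : ℕ → Ω → ℝ≥0 × A) (x₀ : ℝ≥0 × A) (t : ℝ≥0) (n : ℕ) (ω : Ω) :
    ℝ≥0 × A :=
  if ω ∈ {ω | (X n ω).1 ≤ t} then X n ω else x₀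

theorem stoppedPoint_of_le {x₀ : ℝ≥0 × A} {t : ℝ≥0} {n : ℕ} {ω : Ω} (h : (X n ω).1 ≤ t) :
    stoppedPoint X x₀ t n ω = X n ω := if_pos h

theorem measurable_stoppedPoint (hX : ∀ ω, IsMarkedPath fun n => X n ω) (x₀ : ℝ≥0 × A) (t : ℝ≥0)
    (n : ℕ) : Measurable[naturalSigma X t] (stoppedPoint X x₀ t n) := by
  refine @measurable_ite_of_Iic_prod Ω A (naturalSigma X t) _ _ _ x₀ fun s B hB => ?_
  have : {ω | ω ∈ {ω | (X n ω).1 ≤ t} ∧ (X n ω).1 ≤ s ∧ (X n ω).2 ∈ B}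
      = {ω | X n ω ∈ Iic (min s t) ×ˢ B} := by
    ext ω
    simp only [mem_ofPred_eq, mem_prod, mem_Iic, le_min_iff]
    tauto
  rw [this]
  exact naturalSigma_mono X (min_le_right s t) _ (measurableSet_mem_Iic_prod hX hB n _)

theorem measurable_natural_top (hX : ∀ ω, IsMarkedPath fun n => X n ω) (n : ℕ) :
    Measurable[naturalSigmaTop X] (X n) := by
  by_cases hΩ : Nonempty Ω
  · have h := @measurable_ite_of_Iic_prod Ω A (naturalSigmaTop X) _ univ (X n)
      (X 0 hΩ.some) fun s B hB => ?_
    · simpa using h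
    · simp only [mem_univ, true_and]
      exact le_iSup (naturalSigma X) s _ (measurableSet_mem_Iic_prod hX hB n s)
  · intro B _
    convert @MeasurableSet.empty Ω (naturalSigmaTop X)
    exact eq_empty_of_forall_notMem fun ω => (hΩ ⟨ω⟩).elim

/-- Before the time with index `n`, events of the past depend on the first `n` points only. -/
theorem exists_history_set (hX : ∀ ω, IsMarkedPath fun n => X n ω) {s : ℝ≥0} {F : Set Ω}
    (hF : MeasurableSet[naturalSigma X s] F) (n : ℕ) :
    ∃ B : Set (Fin n → ℝ≥0 × A), MeasurableSet B ∧
      ∀ ω, s < (X n ω).1 → (ω ∈ F ↔ history X n ω ∈ B) := by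
  set D := {ω | s < (X n ω).1}
  -- The sets whose trace on `D` is determined by the history form a σ-algebra, so only generators
  -- matter; on `D` the counts up to `s` are finite sums over the first `n` points.
  have key : naturalSigma X s ≤ MeasurableSpace.map (Subtype.val : D → Ω)
      (MeasurableSpace.comap (fun ω : D => history X n ω.1) inferInstance) := by
    refine iSup_le fun r => iSup_le fun hr => iSup_le fun B => iSup_le fun hB => ?_
    rintro _ ⟨S, hS, rfl⟩
    have hm : Measurable fun h : Fin n → ℝ≥0 × A =>
        ∑ k : Fin n, (Iic r ×ˢ B).indicator (1 : ℝ≥0 × A → ℝ≥0∞) (h k) :=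
      Finset.measurable_fun_sum _ fun k _ =>
        (measurable_one.indicator (measurableSet_Iic.prod hB)).comp (measurable_pi_apply k)
    refine ⟨_, hm hS, ?_⟩
    ext ω
    simp only [mem_preimage]
    rw [pointMeasure_eq_sum hX (lt_of_le_of_lt hr ω.2) hB,
      Finset.sum_range fun k => (Iic r ×ˢ B).indicator (1 : ℝ≥0 × A → ℝ≥0∞) (X k ω.1)]
  obtain ⟨B, hB, h⟩ := key F hF
  refine ⟨B, hB, fun ω hω => ?_⟩
  have := congrArg (fun S => (⟨ω, hω⟩ : D) ∈ S) h
  exact (iff_of_eq this).symm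

variable {m : MeasurableSpace Ω} (hm : naturalSigmaTop X ≤ m)

/-- A predictable field is, between successive points, a function of the points so far, of time
and of the mark. -/
theorem exists_fieldRepresentation (hX : ∀ ω, IsMarkedPath fun n => X n ω)
    {ν : Ω → ℝ≥0 → A → ℝ} {c C : ℝ} (hc : 0 < c) (hcC : c ≤ C)
    (hν : ∀ ω t a, c ≤ ν ω t a ∧ ν ω t a ≤ C)
    (hpred : IsPredictableField (naturalFiltration X hm) ν) :
    ∃ g : (n : ℕ) → (Fin n → ℝ≥0 × A) → ℝ≥0 → A → ℝ,
      IsFieldRepresentation X ν g ∧ ∀ n, IsBoundedField (g n) c C := by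
  have main : ∀ n, ∃ g : (Fin n → ℝ≥0 × A) → ℝ≥0 → A → ℝ, IsBoundedField g c C ∧
      ∀ ω t a, (n = 0 ∨ prevTime X n ω < t) → t ≤ (X n ω).1 →
        ν ω t a = g (history X n ω) t a := by
    intro n
    let D := {q : (ℝ≥0 × Ω) × A // (n = 0 ∨ prevTime X n q.1.2 < q.1.1) ∧ q.1.1 ≤ (X n q.1.2).1}
    let Φ : D → (Fin n → ℝ≥0 × A) × ℝ≥0 × A := fun q => (history X n q.1.1.2, q.1.1.1, q.1.2)
    -- The same trace argument as in `exists_history_set`, now on the part of the product space that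
    -- lies between two successive points; predictable rectangles are the generators.
    have key : (naturalFiltration X hm).predictable.prod inferInstance
        ≤ MeasurableSpace.map (Subtype.val : D → _) (MeasurableSpace.comap Φ inferInstance) := by
      refine sup_le ?_ ?_
      · rw [MeasurableSpace.comap_le_iff_le_map]
        refine measurableSpace_le_predictable_of_measurableSet (fun F hF => ?_) fun i F hF => ?_
        -- Time `0` precedes every arrival, so the history determines these events on every path.
        · obtain ⟨B, hB, h⟩ := exists_history_set hX (s := ⊥) hF n
          refine ⟨{p | p.2.1 = 0 ∧ p.1 ∈ B}, ?_, ?_⟩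
          · exact ((measurableSet_singleton (0 : ℝ≥0)).preimage measurable_snd.fst).inter
              (hB.preimage measurable_fst)
          · ext q
            have := h q.1.1.2 ((hX _).1 n)
            change q.1.1.1 = 0 ∧ _ ↔ q.1.1.1 = ⊥ ∧ q.1.1.2 ∈ F
            rw [this]; rfl
        · obtain ⟨B, hB, h⟩ := exists_history_set hX (s := i) hF n
          refine ⟨{p | i < p.2.1 ∧ p.1 ∈ B}, ?_, ?_⟩
          · exact ((measurableSet_Ioi (a := i)).preimage measurable_snd.fst).inter
              (hB.preimage measurable_fst)
          · ext q
            change i < q.1.1.1 ∧ history X n q.1.1.2 ∈ B ↔ i < q.1.1.1 ∧ q.1.1.2 ∈ F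
            refine and_congr_right fun hi => ?_
            exact (h q.1.1.2 (hi.trans_le q.2.2)).symm
      · rintro _ ⟨B, hB, rfl⟩
        exact ⟨{p | p.2.2 ∈ B}, hB.preimage measurable_snd.snd, rfl⟩
    have hνm : Measurable[MeasurableSpace.comap Φ inferInstance]
        fun q : D => ν q.1.1.2 q.1.1.1 q.1.2 := by
      intro S hS
      exact key _ (hpred hS)
    -- The factorisation gives a Borel function with no control off the range of `Φ`. Truncating it
    -- to `[c, C]` restores the bounds and changes nothing where it represents `ν`.
    obtain ⟨f, hf, hfν⟩ := hνm.exists_eq_measurable_comp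
    refine ⟨fun h t a => max c (min C (f (h, t, a))), ⟨?_, hc, fun h t a => ?_⟩, ?_⟩
    · exact measurable_const.max (measurable_const.min hf)
    · exact ⟨le_max_left _ _, max_le hcC (min_le_left _ _)⟩
    · intro ω t a h1 h2
      have := congrFun hfν ⟨((t, ω), a), h1, h2⟩
      change ν ω t a = f (history X n ω, t, a) at this
      beta_reduce
      rw [← this, min_eq_right (hν ω t a).2, max_eq_right (hν ω t a).1]
  choose g hg h using main
  exact ⟨g, ⟨fun n => (hg n).measurable, h⟩, hg⟩

open Classical in
/-- The points before time `t`; later ones are replaced by `x₀`. -/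
noncomputable def leftStoppedPoint (X : ℕ → Ω → ℝ≥0 × A) (x₀ : ℝ≥0 × A) (n : ℕ)
    (p : ℝ≥0 × Ω) : ℝ≥0 × A :=
  if p ∈ {p : ℝ≥0 × Ω | (X n p.2).1 < p.1} then X n p.2 else x₀

/-- A countable dense set of times strictly separates the arrival from the current time, which
writes the set as a countable union of predictable rectangles. -/
theorem measurableSet_predictable_lt (hX : ∀ ω, IsMarkedPath fun n => X n ω) (n : ℕ) (s : ℝ≥0)
    {B : Set A} (hB : MeasurableSet B) :
    MeasurableSet[(naturalFiltration X hm).predictable]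
      {p : ℝ≥0 × Ω | (X n p.2).1 < p.1 ∧ (X n p.2).1 ≤ s ∧ (X n p.2).2 ∈ B} := by
  set q := TopologicalSpace.denseSeq ℝ≥0
  have : {p : ℝ≥0 × Ω | (X n p.2).1 < p.1 ∧ (X n p.2).1 ≤ s ∧ (X n p.2).2 ∈ B}
      = ⋃ j, Ioi (q j) ×ˢ {ω | X n ω ∈ Iic (min s (q j)) ×ˢ B} := by
    ext p
    simp only [mem_ofPred_eq, mem_iUnion, mem_prod, mem_Ioi, mem_Iic, le_min_iff]
    constructor
    · rintro ⟨h1, h2, h3⟩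
      obtain ⟨j, hj1, hj2⟩ := exists_denseSeq_between h1
      exact ⟨j, hj2, ⟨h2, hj1.le⟩, h3⟩
    · rintro ⟨j, h1, ⟨h2, h3⟩, h4⟩
      exact ⟨h3.trans_lt h1, h2, h4⟩
  rw [this]
  refine MeasurableSet.iUnion fun j => measurableSet_predictable_Ioi_prod ?_
  exact naturalSigma_mono X (min_le_right s (q j)) _ (measurableSet_mem_Iic_prod hX hB n _)

theorem measurable_leftStoppedPoint (hX : ∀ ω, IsMarkedPath fun n => X n ω) (x₀ : ℝ≥0 × A)
    (n : ℕ) :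
    Measurable[(naturalFiltration X hm).predictable] (leftStoppedPoint X x₀ n) :=
  @measurable_ite_of_Iic_prod _ A (naturalFiltration X hm).predictable _ _ _ x₀
    fun s _ hB => measurableSet_predictable_lt hm hX n s hB

theorem measurable_predictable_time :
    Measurable[(naturalFiltration X hm).predictable] (Prod.fst : ℝ≥0 × Ω → ℝ≥0) := by
  refine measurable_of_Ioi fun i => ?_
  have : (Prod.fst : ℝ≥0 × Ω → ℝ≥0) ⁻¹' Ioi i = Ioi i ×ˢ univ := by ext; simp
  rw [this]
  exact measurableSet_predictable_Ioi_prod MeasurableSet.univ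

end Natural

/-! ### Processes built from independent innovations -/

/-- The last time of a finite sequence of points, `0` for the empty sequence. -/
def lastTime {E : Type*} : (n : ℕ) → (Fin n → ℝ≥0 × E) → ℝ≥0
  | 0, _ => 0
  | n + 1, h => (h (Fin.last n)).1

theorem lastTime_history {Ω E : Type*} (X : ℕ → Ω → ℝ≥0 × E) (n : ℕ) (ω : Ω) :
    lastTime n (history X n ω) = prevTime X n ω := by
  cases n <;> rfl

theorem measurable_lastTime {E : Type*} [MeasurableSpace E] (n : ℕ) :
    Measurable (lastTime n : (Fin n → ℝ≥0 × E) → ℝ≥0) := by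
  cases n with
  | zero => exact measurable_const
  | succ n => exact (measurable_pi_apply _).fst

/-- The conditional law of each point given the points before it has the density `stepDensity`
with respect to `dt lam(da)`. -/
def HasIntensity {Ω A : Type*} [MeasurableSpace A] {m : MeasurableSpace Ω} (P : Measure Ω)
    (X : ℕ → Ω → ℝ≥0 × A) (lam : Measure A) (g : (n : ℕ) → (Fin n → ℝ≥0 × A) → ℝ≥0 → A → ℝ) :
    Prop :=
  ∀ (n : ℕ) (f : (Fin n → ℝ≥0 × A) × (ℝ≥0 × A) → ℝ≥0∞), Measurable f →
    ∫⁻ ω, f (history X n ω, X n ω) ∂P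
      = ∫⁻ ω, ∫⁻ p, stepDensity lam (g n) (lastTime n) (history X n ω) p
          * f (history X n ω, p) ∂timeMeasure.prod lam ∂P

section Innovations

variable {Ω E V : Type*} [MeasurableSpace E] [MeasurableSpace V] {m : MeasurableSpace Ω}
  {P : Measure Ω} {W : ℕ → Ω → V} {X : ℕ → Ω → E} {F : (n : ℕ) → (Fin n → E) → V → E}

/-- The σ-algebra `m'` is arbitrary so that it can be the one generated by the first `N`
innovations; this is what makes the history independent of the next innovation. -/
theorem measurable_of_innovations {m' : MeasurableSpace Ω}
    (hF : ∀ n, Measurable fun p : (Fin n → E) × V => F n p.1 p.2)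
    (hX : ∀ n ω, X n ω = F n (history X n ω) (W n ω)) (N : ℕ)
    (hW : ∀ k < N, Measurable[m'] (W k)) (k : ℕ) : k < N → Measurable[m'] (X k) := by
  induction k using Nat.strong_induction_on with
  | _ k ih =>
    intro hk
    have h1 : Measurable[m'] (history X k) :=
      measurable_pi_lambda _ fun i => ih i i.2 (i.2.trans hk)
    have h2 : X k = fun ω => F k (history X k ω) (W k ω) := funext (hX k)
    rw [h2]
    exact (hF k).comp (h1.prodMk (hW k hk))

theorem measurable_history_of_innovations {m' : MeasurableSpace Ω}
    (hF : ∀ n, Measurable fun p : (Fin n → E) × V => F n p.1 p.2)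
    (hX : ∀ n ω, X n ω = F n (history X n ω) (W n ω)) (N : ℕ)
    (hW : ∀ k < N, Measurable[m'] (W k)) : Measurable[m'] (history X N) :=
  @measurable_pi_lambda _ _ _ m' _ _ fun i => measurable_of_innovations hF hX N hW i i.2

/-- The history is a function of earlier innovations, hence independent of the current one, and
Fubini allows it to be frozen. -/
theorem lintegral_innovations [IsProbabilityMeasure P] (hW : ∀ n, Measurable (W n))
    (hind : iIndepFun W P) (hF : ∀ n, Measurable fun p : (Fin n → E) × V => F n p.1 p.2)
    (hX : ∀ n ω, X n ω = F n (history X n ω) (W n ω)) (n : ℕ) {f : (Fin n → E) × E → ℝ≥0∞}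
    (hf : Measurable f) :
    ∫⁻ ω, f (history X n ω, X n ω) ∂P
      = ∫⁻ ω, ∫⁻ v, f (history X n ω, F n (history X n ω) v) ∂(P.map (W n)) ∂P := by
  have hh : Measurable (history X n) := measurable_history_of_innovations hF hX n fun k _ => hW k
  have h1 := hind.indepFun_finset (Finset.range n) {n} (by simp) hW
  have h2 : IndepFun (history X n) (W n) P := by
    refine indep_of_indep_of_le_left (indep_of_indep_of_le_right h1 ?_) ?_
    · have : W n = (fun v : ({n} : Finset ℕ) → V => v ⟨n, by simp⟩) ∘
          fun ω (i : ({n} : Finset ℕ)) => W i ω := rfl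
      rw [this, ← MeasurableSpace.comap_comp]
      exact MeasurableSpace.comap_mono (measurable_pi_apply _).comap_le
    · refine (measurable_history_of_innovations hF hX n fun k hk => ?_).comap_le
      have : W k = (fun v : Finset.range n → V => v ⟨k, by simpa using hk⟩) ∘
          fun ω (i : Finset.range n) => W i ω := rfl
      rw [this]
      exact Measurable.comp (measurable_pi_apply _) (comap_measurable _)
  have h3 := (indepFun_iff_map_prod_eq_prod_map_map hh.aemeasurable (hW n).aemeasurable).1 h2
  have hG : Measurable fun p : (Fin n → E) × V => f (p.1, F n p.1 p.2) :=
    hf.comp (measurable_fst.prodMk (hF n))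
  have : IsProbabilityMeasure (P.map (W n)) :=
    Measure.isProbabilityMeasure_map (hW n).aemeasurable
  have : IsProbabilityMeasure (P.map (history X n)) :=
    Measure.isProbabilityMeasure_map hh.aemeasurable
  calc ∫⁻ ω, f (history X n ω, X n ω) ∂P
      = ∫⁻ ω, (fun p : (Fin n → E) × V => f (p.1, F n p.1 p.2)) (history X n ω, W n ω) ∂P := by
        simp_rw [← hX]
    _ = ∫⁻ p, f (p.1, F n p.1 p.2) ∂((P.map (history X n)).prod (P.map (W n))) := by
        rw [← h3, lintegral_map hG (hh.prodMk (hW n))]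
    _ = ∫⁻ h, ∫⁻ v, f (h, F n h v) ∂(P.map (W n)) ∂(P.map (history X n)) :=
        lintegral_prod _ hG.aemeasurable
    _ = _ := lintegral_map hG.lintegral_prod_right' hh

variable (F) in
/-- The first `n` points of the sequence driven by the innovations `w`. -/
def drivenHistory (w : ℕ → V) : (n : ℕ) → Fin n → E
  | 0 => Fin.elim0
  | n + 1 => Fin.snoc (drivenHistory w n) (F n (drivenHistory w n) (w n))

variable (F) in
/-- The sequence driven by the innovations `w`. -/
def drivenSequence (w : ℕ → V) (n : ℕ) : E := F n (drivenHistory F w n) (w n)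

theorem drivenHistory_eq (w : ℕ → V) (n : ℕ) :
    drivenHistory F w n = fun i : Fin n => drivenSequence F w i := by
  induction n with
  | zero => funext i; exact i.elim0
  | succ n ih =>
    funext i
    refine Fin.lastCases ?_ (fun i => ?_) i
    · simp only [drivenHistory, Fin.snoc_last, Fin.val_last, drivenSequence]
    · simp only [drivenHistory, Fin.snoc_castSucc, Fin.val_castSucc]
      rw [ih]

end Innovations

/-! ### The Poisson process and its time change -/

section Poisson

variable {Ω A : Type*} [MeasurableSpace A] {m : MeasurableSpace Ω} {P : Measure Ω}
  {lam : Measure A} [IsFiniteMeasure lam] {lam' : Measure ℝ} {π : ℝ → A} {Y : ℕ → Ω → ℝ≥0 × ℝ}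

/-- The interarrival times together with the marks. -/
noncomputable def innovation (Y : ℕ → Ω → ℝ≥0 × ℝ) (n : ℕ) (ω : Ω) : ℝ × ℝ :=
  (interarrival Y n ω, (Y n ω).2)

theorem measurable_prevTime {E : Type*} [MeasurableSpace E] {Y : ℕ → Ω → ℝ≥0 × E}
    (hY : ∀ n, Measurable (Y n)) (n : ℕ) : Measurable (prevTime Y n) := by
  cases n with
  | zero => exact measurable_const
  | succ n => exact (hY n).fst

theorem measurable_innovation (hY : ∀ n, Measurable (Y n)) (n : ℕ) :
    Measurable (innovation Y n) :=
  ((hY n).fst.coe_nnreal_real.sub (measurable_prevTime hY n).coe_nnreal_real).prodMk (hY n).snd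

namespace IsPoissonProcess

variable (hP : IsPoissonProcess Y lam' P)
include hP

theorem indepFun_interarrival_mark :
    IndepFun (fun ω n => interarrival Y n ω) (fun ω n => (Y n ω).2) P := by
  let φ : (ℕ → ℝ≥0) → ℕ → ℝ := fun t n =>
    (t n : ℝ) - ((match n with | 0 => 0 | n + 1 => t n : ℝ≥0) : ℝ)
  have hφ : Measurable φ := by
    refine measurable_pi_lambda _ fun n => ?_
    cases n with
    | zero => exact (measurable_pi_apply 0).coe_nnreal_real.sub measurable_const
    | succ n =>
      exact (measurable_pi_apply (n + 1)).coe_nnreal_real.sub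
        (measurable_pi_apply n).coe_nnreal_real
  have h := hP.indepFun_times_marks.comp hφ measurable_id
  have h1 : (fun ω n => interarrival Y n ω) = φ ∘ fun ω n => (Y n ω).1 := by
    funext ω n
    cases n <;> rfl
  rw [h1]
  exact h

/-- On rectangles the probability factors first into times and marks, then along each sequence;
rectangles form a generating π-system. -/
theorem iIndepFun_innovation (hY : ∀ n, Measurable (Y n)) : iIndepFun (innovation Y) P := by
  have hi : ∀ n, Measurable (interarrival Y n) := fun n => (measurable_innovation hY n).fst
  have hr : ∀ n, Measurable fun ω => (Y n ω).2 := fun n => (hY n).snd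
  let S : ℕ → Set (Set Ω) := fun n =>
    {s | ∃ B C : Set ℝ, MeasurableSet B ∧ MeasurableSet C ∧
      s = interarrival Y n ⁻¹' B ∩ (fun ω => (Y n ω).2) ⁻¹' C}
  have hfac : ∀ (s : Finset ℕ) (B C : ℕ → Set ℝ), (∀ n, MeasurableSet (B n)) →
      (∀ n, MeasurableSet (C n)) →
      P (⋂ n ∈ s, interarrival Y n ⁻¹' B n ∩ (fun ω => (Y n ω).2) ⁻¹' C n)
        = ∏ n ∈ s, (P (interarrival Y n ⁻¹' B n) * P ((fun ω => (Y n ω).2) ⁻¹' C n)) := by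
    intro s B C hB hC
    have h1 := hP.indepFun_interarrival_mark.measure_inter_preimage_eq_mul
      {x : ℕ → ℝ | ∀ n ∈ s, x n ∈ B n} {x : ℕ → ℝ | ∀ n ∈ s, x n ∈ C n}
      (MeasurableSet.pi s.countable_toSet fun n _ => hB n)
      (MeasurableSet.pi s.countable_toSet fun n _ => hC n)
    have h2 := hP.iIndepFun_interarrival.measure_inter_preimage_eq_mul s (sets := B)
      fun n _ => hB n
    have h3 := hP.iIndepFun_mark.measure_inter_preimage_eq_mul s (sets := C) fun n _ => hC n
    rw [Finset.prod_mul_distrib, ← h2, ← h3]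
    convert h1 using 2
    · ext ω
      simp only [mem_iInter, mem_inter_iff, mem_preimage, mem_ofPred_eq]
      exact ⟨fun h => ⟨fun n hn => (h n hn).1, fun n hn => (h n hn).2⟩,
        fun h n hn => ⟨h.1 n hn, h.2 n hn⟩⟩
    · congr 1; ext ω; simp
    · congr 1; ext ω; simp
  have : IsProbabilityMeasure P := hP.iIndepFun_mark.isProbabilityMeasure
  have hS : iIndepSets S P := by
    rw [iIndepSets_iff]
    intro s f hf
    choose! B C hB hC hfe using hf
    -- The chosen sets are arbitrary outside `s`; replacing them by `univ` makes them measurable for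
    -- every index.
    let B' : ℕ → Set ℝ := fun n => if n ∈ s then B n else univ
    let C' : ℕ → Set ℝ := fun n => if n ∈ s then C n else univ
    have hB' : ∀ n, MeasurableSet (B' n) := fun n => by
      by_cases hn : n ∈ s <;> simp [B', hn, hB]
    have hC' : ∀ n, MeasurableSet (C' n) := fun n => by
      by_cases hn : n ∈ s <;> simp [C', hn, hC]
    have hfe' : ∀ n ∈ s, f n = interarrival Y n ⁻¹' B' n ∩ (fun ω => (Y n ω).2) ⁻¹' C' n := by
      intro n hn
      simp only [B', C', hn, if_true]
      exact hfe n hn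
    rw [iInter₂_congr hfe', hfac s B' C' hB' hC', Finset.prod_congr rfl fun n hn => ?_]
    rw [hfe' n hn]
    have := hfac {n} B' C' hB' hC'
    simpa using this.symm
  rw [iIndepFun_iff_iIndep]
  refine iIndepSets.iIndep (fun n => (measurable_innovation hY n).comap_le) S (fun n => ?_)
    (fun n => ?_) hS
  · rintro _ ⟨B, C, hB, hC, rfl⟩ _ ⟨B', C', hB', hC', rfl⟩ _
    exact ⟨B ∩ B', C ∩ C', hB.inter hB', hC.inter hC', by
      rw [preimage_inter, preimage_inter]; exact inter_inter_inter_comm _ _ _ _⟩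
  · rw [← generateFrom_prod, MeasurableSpace.comap_generateFrom]
    congr 1
    ext s
    simp only [mem_image, mem_image2, S, mem_ofPred_eq]
    constructor
    · rintro ⟨_, ⟨B, hB, C, hC, rfl⟩, rfl⟩
      exact ⟨B, C, hB, hC, rfl⟩
    · rintro ⟨B, C, hB, hC, rfl⟩
      exact ⟨_, ⟨B, hB, C, hC, rfl⟩, rfl⟩

theorem map_innovation (hY : ∀ n, Measurable (Y n)) (n : ℕ) :
    P.map (innovation Y n) = (expMeasure (lam'.real univ)).prod ((lam' univ)⁻¹ • lam') := by
  have : IsProbabilityMeasure P := hP.iIndepFun_mark.isProbabilityMeasure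
  have h1 : IndepFun (interarrival Y n) (fun ω => (Y n ω).2) P :=
    hP.indepFun_interarrival_mark.comp (measurable_pi_apply n) (measurable_pi_apply n)
  have hm := measurable_innovation hY n
  have h2 := (indepFun_iff_map_prod_eq_prod_map_map hm.fst.aemeasurable hm.snd.aemeasurable).1 h1
  rw [← (hP.hasLaw_interarrival n).map_eq, ← (hP.hasLaw_mark n).map_eq]
  exact h2

end IsPoissonProcess

/-- The next point of the time-changed process, with real mark, as a function of the points so far
and of the innovation. -/
noncomputable def realStep (lam : Measure A) (lam' : Measure ℝ) (π : ℝ → A)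
    (g : (n : ℕ) → (Fin n → ℝ≥0 × A) → ℝ≥0 → A → ℝ) (n : ℕ) (h : Fin n → ℝ≥0 × A) (w : ℝ × ℝ) :
    ℝ≥0 × ℝ :=
  (timeStep lam (g n) (lastTime n) h w.1,
    markStep lam' π (g n) (h, timeStep lam (g n) (lastTime n) h w.1) w.2)

/-- The next point of the time-changed process. -/
noncomputable def pointStep (lam : Measure A) (lam' : Measure ℝ) (π : ℝ → A)
    (g : (n : ℕ) → (Fin n → ℝ≥0 × A) → ℝ≥0 → A → ℝ) (n : ℕ) (h : Fin n → ℝ≥0 × A) (w : ℝ × ℝ) :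
    ℝ≥0 × A :=
  ((realStep lam lam' π g n h w).1, π (realStep lam lam' π g n h w).2)

variable {g : (n : ℕ) → (Fin n → ℝ≥0 × A) → ℝ≥0 → A → ℝ} {c C : ℝ}

theorem measurable_realStep (hl : IsNonatomicLift lam lam' π) (hlam : lam ≠ 0)
    (hg : ∀ n, IsBoundedField (g n) c C) (n : ℕ) :
    Measurable fun p : (Fin n → ℝ≥0 × A) × (ℝ × ℝ) => realStep lam lam' π g n p.1 p.2 := by
  have h1 : Measurable fun p : (Fin n → ℝ≥0 × A) × (ℝ × ℝ) =>
      timeStep lam (g n) (lastTime n) p.1 p.2.1 :=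
    ((hg n).measurable_timeStep lam (measurable_lastTime n) hlam).comp
      (measurable_fst.prodMk measurable_snd.fst)
  have h2 : Measurable fun p : (Fin n → ℝ≥0 × A) × (ℝ × ℝ) =>
      (((p.1, timeStep lam (g n) (lastTime n) p.1 p.2.1), p.2.2) :
        ((Fin n → ℝ≥0 × A) × ℝ≥0) × ℝ) :=
    (measurable_fst.prodMk h1).prodMk measurable_snd.snd
  have h3 := ((hg n).measurable_markStep hl hlam).comp h2
  exact h1.prodMk h3

theorem measurable_pointStep (hl : IsNonatomicLift lam lam' π) (hlam : lam ≠ 0)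
    (hg : ∀ n, IsBoundedField (g n) c C) (n : ℕ) :
    Measurable fun p : (Fin n → ℝ≥0 × A) × (ℝ × ℝ) => pointStep lam lam' π g n p.1 p.2 := by
  have h := measurable_realStep hl hlam hg n
  exact h.fst.prodMk (hl.measurable.comp h.snd)

/-- A process driven by the innovations of a Poisson process has the intensity of its steps. -/
theorem IsPoissonProcess.hasIntensity_of_pointStep (hP : IsPoissonProcess Y lam' P)
    (hY : ∀ n, Measurable (Y n)) (hl : IsNonatomicLift lam lam' π) (hlam : lam ≠ 0)
    (hg : ∀ n, IsBoundedField (g n) c C) {X : ℕ → Ω → ℝ≥0 × A}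
    (hX : ∀ n ω, X n ω = pointStep lam lam' π g n (history X n ω) (innovation Y n ω)) :
    HasIntensity P X lam g := by
  have : IsProbabilityMeasure P := hP.iIndepFun_mark.isProbabilityMeasure
  have := hl.isProbabilityMeasure hlam
  intro n f hf
  rw [lintegral_innovations (measurable_innovation hY) (hP.iIndepFun_innovation hY)
    (measurable_pointStep hl hlam hg) hX n hf]
  refine lintegral_congr fun ω => ?_
  have hfs : Measurable fun p => f (history X n ω, p) := hf.comp measurable_prodMk_left
  have hs : Measurable fun w => pointStep lam lam' π g n (history X n ω) w :=
    (measurable_pointStep hl hlam hg n).comp measurable_prodMk_left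
  rw [hP.map_innovation hY, ← (hg n).lintegral_step hl hlam (measurable_lastTime n) _ hfs,
    lintegral_prod (fun w => f (history X n ω, pointStep lam lam' π g n (history X n ω) w))
      (hfs.comp hs).aemeasurable, hl.real_univ_eq]
  rfl

theorem isBoundedField_one {H : Type*} [MeasurableSpace H] :
    IsBoundedField (fun (_ : H) (_ : ℝ≥0) (_ : A) => (1 : ℝ)) 1 1 :=
  ⟨measurable_const, one_pos, fun _ _ _ => ⟨le_rfl, le_rfl⟩⟩

theorem cumRate_one {H : Type*} (T : H → ℝ≥0) (h : H) {v : ℝ≥0} (hv : T h ≤ v) :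
    cumRate lam (fun (_ : H) (_ : ℝ≥0) (_ : A) => (1 : ℝ)) T h v
      = lam.real univ * (v - T h) := by
  have : (0 : ℝ) ≤ v - T h := sub_nonneg.2 (by exact_mod_cast hv)
  simp [cumRate, rate, Measure.real, timeMeasure_Ioc, ENNReal.toReal_ofReal this, mul_comm]

/-- A marked Poisson process has the constant intensity `1`. -/
theorem IsPoissonProcess.hasIntensity_one (hP : IsPoissonProcess Y lam' P)
    (hY : ∀ n, Measurable (Y n)) (hpath : ∀ ω, IsMarkedPath fun n => Y n ω)
    (hl : IsNonatomicLift lam lam' π) (hlam : lam ≠ 0) :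
    HasIntensity P (mapMarks π Y) lam fun _ _ _ _ => 1 := by
  have : IsProbabilityMeasure P := hP.iIndepFun_mark.isProbabilityMeasure
  have := hl.isProbabilityMeasure hlam
  have hL := IsBoundedField.measureReal_univ_pos lam hlam
  -- The mark is kept as it is. The quantile transform for the constant field preserves the law but
  -- need not be the identity pointwise, so `pointStep` would not reproduce the process everywhere.
  let F : (n : ℕ) → (Fin n → ℝ≥0 × A) → ℝ × ℝ → ℝ≥0 × A := fun n h w =>
    (timeStep lam (fun _ _ _ => 1) (lastTime n) h w.1, π w.2)
  have hF : ∀ n, Measurable fun p : (Fin n → ℝ≥0 × A) × (ℝ × ℝ) => F n p.1 p.2 := by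
    intro n
    exact ((isBoundedField_one.measurable_timeStep lam (measurable_lastTime n) hlam).comp
      (measurable_fst.prodMk measurable_snd.fst)).prodMk (hl.measurable.comp measurable_snd.snd)
  have hprev : ∀ n ω, lastTime n (history (mapMarks π Y) n ω) = prevTime Y n ω := by
    intro n ω
    cases n <;> rfl
  have hX : ∀ n ω, mapMarks π Y n ω = F n (history (mapMarks π Y) n ω) (innovation Y n ω) := by
    intro n ω
    refine Prod.ext ?_ rfl
    refine IsLeast.unique ?_ (isBoundedField_one.isLeast_timeStep lam hlam _ _)
    have hle : prevTime Y n ω ≤ (Y n ω).1 := by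
      cases n with
      | zero => exact zero_le
      | succ n => exact ((hpath ω).2.1 n).le
    constructor
    · refine ⟨(hprev n ω).trans_le hle, ?_⟩
      change interarrival Y n ω ≤ _ * cumRate lam _ _ _ (Y n ω).1
      rw [cumRate_one _ _ ((hprev n ω).trans_le hle), inv_mul_cancel_left₀ hL.ne', hprev]
      exact le_rfl
    · rintro v ⟨hv1, hv2⟩
      rw [cumRate_one _ _ hv1, inv_mul_cancel_left₀ hL.ne', hprev] at hv2
      have h3 : ((Y n ω).1 : ℝ) - prevTime Y n ω ≤ v - prevTime Y n ω := hv2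
      have h4 : ((Y n ω).1 : ℝ) ≤ v := by linarith
      exact_mod_cast h4
  intro n f hf
  rw [lintegral_innovations (measurable_innovation hY) (hP.iIndepFun_innovation hY) hF hX n hf]
  refine lintegral_congr fun ω => ?_
  set h := history (mapMarks π Y) n ω
  have hfs : Measurable fun p => f (h, p) := hf.comp measurable_prodMk_left
  have hs : Measurable fun w => F n h w := (hF n).comp measurable_prodMk_left
  rw [hP.map_innovation hY, ← isBoundedField_one.lintegral_step hl hlam (measurable_lastTime n) h
    hfs, lintegral_prod (fun w => f (h, F n h w)) (hfs.comp hs).aemeasurable, hl.real_univ_eq]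
  refine lintegral_congr fun x => ?_
  have hfx : Measurable fun r => f (h, (timeStep lam (fun _ _ _ => 1) (lastTime n) h x, π r)) :=
    hfs.comp (measurable_const.prodMk hl.measurable)
  -- For the constant field the transformed mark has the same law as the original one, so the inner
  -- integrals agree although the marks may differ.
  rw [isBoundedField_one.lintegral_markStep hl hlam
    (h, timeStep lam (fun _ _ _ => 1) (lastTime n) h x) hfx, lintegral_smul_measure]
  simp only [ENNReal.ofReal_one, one_mul, smul_eq_mul, rate, integral_const, mul_one, F]
  rw [Measure.real, ENNReal.ofReal_toReal (measure_ne_top _ _), hl.measure_univ_eq]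

end Poisson

/-! ### Likelihood ratios -/

section StepDensity

variable {H A : Type*} [MeasurableSpace H] [MeasurableSpace A]
variable {g : H → ℝ≥0 → A → ℝ} {c C : ℝ} (hg : IsBoundedField g c C) (lam : Measure A)
  [IsFiniteMeasure lam] {T : H → ℝ≥0} (hT : Measurable T) (hlam : lam ≠ 0)
include hg

namespace IsBoundedField

include hT in
theorem measurable_stepDensity : Measurable fun q : H × (ℝ≥0 × A) => stepDensity lam g T q.1 q.2 :=
  Measurable.ite (measurableSet_lt (hT.comp measurable_fst) measurable_snd.fst)
    ((hg.measurable.mul ((hg.measurable_cumRate lam hT).comp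
      (measurable_fst.prodMk measurable_snd.fst)).neg.exp).ennreal_ofReal) measurable_const

theorem lintegral_stepDensity_mul (h : H) {v : ℝ≥0} (hv : T h ≤ v) {w : ℝ≥0 → ℝ≥0∞}
    (hw : Measurable w) {B : Set A} (hB : MeasurableSet B) :
    ∫⁻ p, stepDensity lam g T h p * (Ioi v ×ˢ B).indicator (fun p => w p.1) p
        ∂timeMeasure.prod lam
      = ∫⁻ s in Ioi v, (∫⁻ a in B, ENNReal.ofReal (g h s a) ∂lam)
          * ENNReal.ofReal (Real.exp (-cumRate lam g T h s)) * w s ∂timeMeasure := by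
  -- Freezing the history in a one-point space gives measurability in the next point without any
  -- assumption on `T`.
  have hT' : Measurable fun _ : Unit => T h := measurable_const
  have hg' : IsBoundedField (fun _ : Unit => g h) c C :=
    ⟨hg.measurable.comp (measurable_const.prodMk measurable_snd), hg.pos, fun _ => hg.bounds h⟩
  have hm : Measurable fun p => stepDensity lam g T h p * (Ioi v ×ˢ B).indicator
      (fun p => w p.1) p :=
    ((hg'.measurable_stepDensity lam hT').comp (measurable_prodMk_left (x := ()))).mul
      ((hw.comp measurable_fst).indicator (measurableSet_Ioi.prod hB))
  rw [lintegral_prod (fun p => stepDensity lam g T h p * (Ioi v ×ˢ B).indicator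
    (fun p => w p.1) p) hm.aemeasurable, ← lintegral_indicator measurableSet_Ioi]
  refine lintegral_congr fun s => ?_
  by_cases hs : v < s
  · have h1 : ∀ a, stepDensity lam g T h (s, a) * (Ioi v ×ˢ B).indicator (fun p => w p.1) (s, a)
        = B.indicator (fun a => ENNReal.ofReal (g h s a)) a
          * (ENNReal.ofReal (Real.exp (-cumRate lam g T h s)) * w s) := by
      intro a
      by_cases ha : a ∈ B
      · rw [indicator_of_mem (show (s, a) ∈ Ioi v ×ˢ B from ⟨hs, ha⟩), indicator_of_mem ha,
          stepDensity, if_pos (hv.trans_lt hs), ENNReal.ofReal_mul (hg.nonneg h s a), mul_assoc]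
      · rw [indicator_of_notMem (fun h => ha h.2), indicator_of_notMem ha, mul_zero, zero_mul]
    simp_rw [h1]
    rw [lintegral_mul_const _ ((hg.measurable_section h s).ennreal_ofReal.indicator hB),
      lintegral_indicator hB, indicator_of_mem (mem_Ioi.2 hs), mul_assoc]
  · have h1 : ∀ a, stepDensity lam g T h (s, a) * (Ioi v ×ˢ B).indicator (fun p => w p.1) (s, a)
        = 0 := by
      intro a
      rw [indicator_of_notMem (fun h => hs h.1), mul_zero]
    simp_rw [h1]
    rw [lintegral_zero, indicator_of_notMem (by simpa using hs)]

include hlam in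
/-- The conditional probability that the next point comes after `v`. -/
theorem lintegral_stepDensity_Ioi (h : H) {v : ℝ≥0} (hv : T h ≤ v) :
    ∫⁻ p, stepDensity lam g T h p * (Ioi v ×ˢ univ).indicator 1 p ∂timeMeasure.prod lam
      = ENNReal.ofReal (Real.exp (-cumRate lam g T h v)) := by
  have h1 := hg.lintegral_stepDensity_mul lam (T := T) h hv (w := 1) measurable_one
    MeasurableSet.univ
  rw [← hg.lintegral_Ioi_rate lam hlam h hv]
  refine h1.trans (setLIntegral_congr_fun measurableSet_Ioi fun s _ => ?_)
  simp only [Measure.restrict_univ, Pi.one_apply, mul_one, ← hg.ofReal_rate lam]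
  rw [ENNReal.ofReal_mul (hg.rate_nonneg lam h s)]

end IsBoundedField

end StepDensity

section Likelihood

variable {A : Type*} [MeasurableSpace A]

/-- The likelihood ratio of one step with respect to the Poisson process. -/
noncomputable def stepRatio (lam : Measure A) (g : (n : ℕ) → (Fin n → ℝ≥0 × A) → ℝ≥0 → A → ℝ)
    (n : ℕ) (h : Fin n → ℝ≥0 × A) (p : ℝ≥0 × A) : ℝ :=
  g n h p.1 p.2 * Real.exp (lam.real univ * (p.1 - lastTime n h)
    - cumRate lam (g n) (lastTime n) h p.1)

/-- The likelihood ratio of the first `n` points with respect to the Poisson process. -/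
noncomputable def likelihood (lam : Measure A) (g : (n : ℕ) → (Fin n → ℝ≥0 × A) → ℝ≥0 → A → ℝ) :
    (n : ℕ) → (Fin n → ℝ≥0 × A) → ℝ≥0∞
  | 0, _ => 1
  | n + 1, h => likelihood lam g n (Fin.init h)
      * ENNReal.ofReal (stepRatio lam g n (Fin.init h) (h (Fin.last n)))

variable {lam : Measure A} [IsFiniteMeasure lam]
  {g : (n : ℕ) → (Fin n → ℝ≥0 × A) → ℝ≥0 → A → ℝ} {c C : ℝ}

/-- The Poisson step density is the exponential of minus `lam.real univ` times the elapsed time;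
`stepRatio` is the quotient by it. -/
theorem stepDensity_eq_mul (n : ℕ) (h : Fin n → ℝ≥0 × A) (p : ℝ≥0 × A) :
    stepDensity lam (g n) (lastTime n) h p
      = stepDensity lam (fun _ _ _ => 1) (lastTime n) h p
        * ENNReal.ofReal (stepRatio lam g n h p) := by
  unfold stepDensity
  split_ifs with hp
  · rw [← ENNReal.ofReal_mul (by positivity), cumRate_one _ _ hp.le, stepRatio, one_mul,
      mul_left_comm, ← Real.exp_add]
    congr 4
    ring
  · rw [zero_mul]

variable (hg : ∀ n, IsBoundedField (g n) c C)
include hg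

theorem measurable_stepRatio (n : ℕ) :
    Measurable fun q : (Fin n → ℝ≥0 × A) × (ℝ≥0 × A) => stepRatio lam g n q.1 q.2 := by
  have h1 : Measurable fun q : (Fin n → ℝ≥0 × A) × (ℝ≥0 × A) => ((q.2.1 : ℝ≥0) : ℝ) :=
    measurable_snd.fst.coe_nnreal_real
  have h2 : Measurable fun q : (Fin n → ℝ≥0 × A) × (ℝ≥0 × A) => ((lastTime n q.1 : ℝ≥0) : ℝ) :=
    ((measurable_lastTime n).comp measurable_fst).coe_nnreal_real
  exact (hg n).measurable.mul (((h1.sub h2).const_mul _).sub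
    (((hg n).measurable_cumRate lam (measurable_lastTime n)).comp
      (measurable_fst.prodMk measurable_snd.fst))).exp

theorem measurable_likelihood (n : ℕ) : Measurable (likelihood lam g n) := by
  induction n with
  | zero => exact measurable_const
  | succ n ih =>
    have h1 : Measurable fun h : Fin (n + 1) → ℝ≥0 × A => (Fin.init h : Fin n → ℝ≥0 × A) :=
      measurable_pi_lambda _ fun i => measurable_pi_apply i.castSucc
    exact (ih.comp h1).mul ((measurable_stepRatio hg n).comp
      (h1.prodMk (measurable_pi_apply (Fin.last n)))).ennreal_ofReal

omit hg in
theorem measurable_snoc (n : ℕ) : Measurable fun q : (Fin n → ℝ≥0 × A) × (ℝ≥0 × A) =>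
    (Fin.snoc q.1 q.2 : Fin (n + 1) → ℝ≥0 × A) := by
  refine measurable_pi_lambda _ fun i => ?_
  refine Fin.lastCases ?_ (fun i => ?_) i
  · simpa using measurable_snd
  · simpa using measurable_fst.eval

omit [MeasurableSpace A] hg in
theorem history_succ {Ω E : Type*} (X : ℕ → Ω → E) (n : ℕ) (ω : Ω) :
    history X (n + 1) ω = Fin.snoc (history X n ω) (X n ω) := by
  funext i
  refine Fin.lastCases ?_ (fun i => ?_) i <;> simp [history]

variable {Ω Ω' : Type*} {m : MeasurableSpace Ω} {m' : MeasurableSpace Ω'}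
  {P : Measure Ω} {P' : Measure Ω'} {X : ℕ → Ω → ℝ≥0 × A} {X' : ℕ → Ω' → ℝ≥0 × A}

/-- The law of the first points of a process with intensity `g` has the density `likelihood` with
respect to the Poisson process. -/
theorem lintegral_history_eq [IsProbabilityMeasure P] [IsProbabilityMeasure P']
    (hX : HasIntensity P X lam fun _ _ _ _ => 1) (hX' : HasIntensity P' X' lam g)
    (n : ℕ) : ∀ {f : (Fin n → ℝ≥0 × A) → ℝ≥0∞}, Measurable f →
    ∫⁻ ω, f (history X' n ω) ∂P' = ∫⁻ ω, likelihood lam g n (history X n ω) * f (history X n ω) ∂P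
    := by
  induction n with
  | zero =>
    intro f _
    have h1 : ∀ ω, f (history X' 0 ω) = f Fin.elim0 := fun ω => congrArg f (Subsingleton.elim _ _)
    have h2 : ∀ ω, f (history X 0 ω) = f Fin.elim0 := fun ω => congrArg f (Subsingleton.elim _ _)
    simp [h1, h2, likelihood]
  | succ n ih =>
    intro f hf
    have hfs : Measurable fun q : (Fin n → ℝ≥0 × A) × (ℝ≥0 × A) =>
        f (Fin.snoc q.1 q.2) := hf.comp (measurable_snoc n)
    have hsd := (hg n).measurable_stepDensity lam (measurable_lastTime n)
    have hr := (measurable_stepRatio (lam := lam) hg n).ennreal_ofReal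
    have hL := measurable_likelihood (lam := lam) hg n
    have h1 := hX' n _ hfs
    have h2 := hX n (fun q => likelihood lam g n q.1 * (ENNReal.ofReal (stepRatio lam g n q.1 q.2)
      * f (Fin.snoc q.1 q.2))) ((hL.comp measurable_fst).mul (hr.mul hfs))
    -- The induction hypothesis is applied after integrating out the last point, whose conditional
    -- density is a function of the earlier ones.
    have h3 := ih (f := fun h => ∫⁻ p, stepDensity lam (g n) (lastTime n) h p
      * f (Fin.snoc h p) ∂timeMeasure.prod lam) (hsd.mul hfs).lintegral_prod_right'
    simp only [← history_succ] at h1 h2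
    have h4 : ∀ ω, likelihood lam g (n + 1) (history X (n + 1) ω)
        = likelihood lam g n (history X n ω)
          * ENNReal.ofReal (stepRatio lam g n (history X n ω) (X n ω)) := fun ω => rfl
    simp_rw [h4, mul_assoc]
    rw [h1, h2, h3]
    refine lintegral_congr fun ω => ?_
    have h5 : Measurable fun p => stepDensity lam (g n) (lastTime n) (history X n ω) p
        * f (Fin.snoc (history X n ω) p) := (hsd.mul hfs).comp measurable_prodMk_left
    rw [← lintegral_const_mul _ h5]
    refine lintegral_congr fun p => ?_
    rw [stepDensity_eq_mul]
    ring

/-- Integrals over the event that exactly the first `n` points have come up to time `t`. -/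
theorem HasIntensity.lintegral_between (hX : HasIntensity P X lam g) (hlam : lam ≠ 0)
    (n : ℕ) (t : ℝ≥0) {φ : (Fin n → ℝ≥0 × A) → ℝ≥0∞} (hφ : Measurable φ) :
    ∫⁻ ω, {ω | prevTime X n ω ≤ t ∧ t < (X n ω).1}.indicator (fun ω => φ (history X n ω)) ω ∂P
      = ∫⁻ ω, {h | lastTime n h ≤ t}.indicator (fun h => φ h *
          ENNReal.ofReal (Real.exp (-cumRate lam (g n) (lastTime n) h t))) (history X n ω) ∂P := by
  have hS : MeasurableSet {h : Fin n → ℝ≥0 × A | lastTime n h ≤ t} :=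
    measurableSet_le (measurable_lastTime n) measurable_const
  -- The next point enters only through the event that it is later than `t`, so its conditional
  -- integral is the survival probability at `t`.
  have h1 := hX n (fun q => {h | lastTime n h ≤ t}.indicator φ q.1
    * (Ioi t ×ˢ univ).indicator 1 q.2)
    (((hφ.indicator hS).comp measurable_fst).mul
      ((measurable_one.indicator (measurableSet_Ioi.prod MeasurableSet.univ)).comp measurable_snd))
  refine (lintegral_congr fun ω => ?_).trans (h1.trans (lintegral_congr fun ω => ?_))
  · simp only [indicator, mem_ofPred_eq, lastTime_history, mem_prod, mem_Ioi, mem_univ, and_true,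
      Pi.one_apply]
    by_cases ha : prevTime X n ω ≤ t <;> by_cases hb : t < (X n ω).1 <;> simp [ha, hb]
  · dsimp only
    by_cases ha : lastTime n (history X n ω) ≤ t
    · rw [indicator_of_mem (show history X n ω ∈ {h | lastTime n h ≤ t} from ha),
        indicator_of_mem (show history X n ω ∈ {h | lastTime n h ≤ t} from ha),
        ← (hg n).lintegral_stepDensity_Ioi lam hlam _ ha, ← lintegral_const_mul]
      · refine lintegral_congr fun p => by ring
      · exact (((hg n).measurable_stepDensity lam (measurable_lastTime n)).comp
          measurable_prodMk_left).mul
            (measurable_one.indicator (measurableSet_Ioi.prod MeasurableSet.univ))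
    · rw [indicator_of_notMem (show history X n ω ∉ {h | lastTime n h ≤ t} from ha),
        indicator_of_notMem (show history X n ω ∉ {h | lastTime n h ≤ t} from ha)]
      simp

end Likelihood

/-! ### Change of measure -/

theorem measurable_tsum_of_measurable {Ω : Type*} {m₀ : MeasurableSpace Ω} {f : ℕ → Ω → ℝ≥0∞}
    (hf : ∀ n, Measurable[m₀] (f n)) : Measurable[m₀] fun ω => ∑' n, f n ω :=
  Measurable.tsum hf

section Girsanov

variable {Ω A : Type*} [MeasurableSpace A] {m : MeasurableSpace Ω} {X : ℕ → Ω → ℝ≥0 × A}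

theorem predictable_le_prod (ℱ : Filtration ℝ≥0 m) :
    ℱ.predictable ≤ (inferInstance : MeasurableSpace ℝ≥0).prod m := by
  refine measurableSpace_le_predictable_of_measurableSet (fun F hF => ?_) fun i F hF => ?_
  · exact (measurableSet_singleton (⊥ : ℝ≥0)).prod (ℱ.le _ _ hF)
  · exact measurableSet_Ioi.prod (ℱ.le _ _ hF)

theorem IsPredictableField.isBoundedField {ℱ : Filtration ℝ≥0 m} {ν : Ω → ℝ≥0 → A → ℝ}
    (hν : IsPredictableField ℱ ν) {c C : ℝ} (hc : 0 < c)
    (hb : ∀ ω t a, c ≤ ν ω t a ∧ ν ω t a ≤ C) : IsBoundedField ν c C := by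
  refine ⟨?_, hc, hb⟩
  have h1 : Measurable fun p : (ℝ≥0 × Ω) × A => ν p.1.2 p.1.1 p.2 :=
    hν.mono (sup_le_sup (MeasurableSpace.comap_mono (predictable_le_prod ℱ)) le_rfl) le_rfl
  exact h1.comp ((measurable_snd.fst.prodMk measurable_fst).prodMk measurable_snd.snd)

variable {lam : Measure A} [IsFiniteMeasure lam] {ν : Ω → ℝ≥0 → A → ℝ}
  {g : (n : ℕ) → (Fin n → ℝ≥0 × A) → ℝ≥0 → A → ℝ} {c C : ℝ}

theorem prevTime_le {x : ℕ → Ω → ℝ≥0 × A} (hX : ∀ ω, IsMarkedPath fun n => x n ω) (n : ℕ)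
    (ω : Ω) : prevTime x n ω < (x n ω).1 := by
  cases n with
  | zero => exact (hX ω).1 0
  | succ n => exact (hX ω).2.1 n

/-- The event that exactly the first `n` points have come up to time `t`. -/
def countEvent (X : ℕ → Ω → ℝ≥0 × A) (t : ℝ≥0) (n : ℕ) : Set Ω :=
  {ω | prevTime X n ω ≤ t ∧ t < (X n ω).1}

theorem exists_mem_countEvent (hX : ∀ ω, IsMarkedPath fun n => X n ω) (t : ℝ≥0) (ω : Ω) :
    ∃ n, ω ∈ countEvent X t n := by
  classical
  have h := (hX ω).exists_lt t
  refine ⟨Nat.find h, ?_, Nat.find_spec h⟩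
  cases hn : Nat.find h with
  | zero => exact zero_le
  | succ k => exact not_lt.1 (Nat.find_min h (by omega))

theorem time_le_iff_of_mem_countEvent (hX : ∀ ω, IsMarkedPath fun n => X n ω) {t : ℝ≥0} {n : ℕ}
    {ω : Ω} (h : ω ∈ countEvent X t n) (k : ℕ) : (X k ω).1 ≤ t ↔ k < n := by
  refine ⟨fun hk => (hX ω).strictMono.lt_iff_lt.1 (hk.trans_lt h.2), fun hk => ?_⟩
  cases n with
  | zero => omega
  | succ n => exact ((hX ω).strictMono.monotone (Nat.lt_succ_iff.1 hk)).trans h.1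

theorem iUnion_countEvent (hX : ∀ ω, IsMarkedPath fun n => X n ω) (t : ℝ≥0) :
    ⋃ n, countEvent X t n = univ :=
  eq_univ_of_forall fun ω => mem_iUnion.2 (exists_mem_countEvent hX t ω)

theorem pairwise_disjoint_countEvent (hX : ∀ ω, IsMarkedPath fun n => X n ω) (t : ℝ≥0) :
    Pairwise (Function.onFun Disjoint (countEvent X t)) := by
  intro j k hjk
  refine disjoint_left.2 fun ω hj hk => hjk ?_
  have h1 := time_le_iff_of_mem_countEvent hX hj
  have h2 := time_le_iff_of_mem_countEvent hX hk
  refine le_antisymm (not_lt.1 fun h => ?_) (not_lt.1 fun h => ?_)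
  · exact lt_irrefl _ ((h2 k).1 ((h1 k).2 h))
  · exact lt_irrefl _ ((h1 j).1 ((h2 j).2 h))

theorem measurableSet_countEvent (hX : ∀ ω, IsMarkedPath fun n => X n ω) (t : ℝ≥0) (n : ℕ) :
    MeasurableSet[naturalSigma X t] (countEvent X t n) := by
  have h1 : MeasurableSet[naturalSigma X t] {ω | t < (X n ω).1} := by
    have := (measurableSet_time_le hX n le_rfl (s := t)).compl
    convert this using 1
    ext ω; simp
  refine MeasurableSet.inter (s₁ := {ω | prevTime X n ω ≤ t}) ?_ h1
  cases n with
  | zero => simp [prevTime]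
  | succ n => exact measurableSet_time_le hX n le_rfl

theorem cumRate_field_eq (hν : IsBoundedField ν c C)
    (hrep : IsFieldRepresentation X ν g) (n : ℕ) (ω : Ω) {t : ℝ≥0} (h1 : prevTime X n ω ≤ t)
    (h2 : t ≤ (X n ω).1) :
    cumRate lam ν (fun _ => 0) ω t = cumRate lam ν (fun _ => 0) ω (prevTime X n ω)
      + cumRate lam (g n) (lastTime n) (history X n ω) t := by
  rw [← sub_eq_iff_eq_add', hν.cumRate_sub lam ω zero_le h1, cumRate, lastTime_history]
  refine setIntegral_congr_fun measurableSet_Ioc fun s hs => ?_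
  refine integral_congr_ae (.of_forall fun a => ?_)
  exact hrep.eq n ω s a (.inr hs.1) (hs.2.trans h2)

theorem integral_one_sub_eq (hν : IsBoundedField ν c C) (ω : Ω) (t : ℝ≥0) :
    ∫ s in Iic t, ∫ a, (1 - ν ω s a) ∂lam ∂timeMeasure
      = lam.real univ * t - cumRate lam ν (fun _ => 0) ω t := by
  have h0 : (Iic t : Set ℝ≥0) =ᵐ[timeMeasure] Ioc 0 t := by
    have : (Iic t : Set ℝ≥0) = Icc 0 t := by ext x; simp
    rw [this]
    exact Ioc_ae_eq_Icc.symm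
  have h1 : ∀ s, ∫ a, (1 - ν ω s a) ∂lam = lam.real univ - rate lam ν ω s := by
    intro s
    rw [integral_sub (integrable_const _) (hν.integrable_section lam ω s), integral_const]
    simp [rate]
  simp_rw [h1]
  rw [setIntegral_congr_set h0, integral_sub _ (hν.integrableOn_rate lam ω 0 t),
    setIntegral_const, Measure.real, timeMeasure_Ioc]
  · simp [cumRate, mul_comm]
  · refine integrableOn_const ?_
    rw [timeMeasure_Ioc]; exact ENNReal.ofReal_ne_top

/-- The exponents of the successive ratios telescope to the integral from `0` to the last time. -/
theorem likelihood_history_eq (hX : ∀ ω, IsMarkedPath fun n => X n ω) (hν : IsBoundedField ν c C)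
    (hrep : IsFieldRepresentation X ν g) (n : ℕ) (ω : Ω) :
    likelihood lam g n (history X n ω)
      = ENNReal.ofReal (Real.exp (lam.real univ * prevTime X n ω
          - cumRate lam ν (fun _ => 0) ω (prevTime X n ω))
        * ∏ k ∈ Finset.range n, ν ω (X k ω).1 (X k ω).2) := by
  induction n with
  | zero => simp [likelihood, prevTime, cumRate]
  | succ n ih =>
    have h1 : likelihood lam g (n + 1) (history X (n + 1) ω)
        = likelihood lam g n (history X n ω)
          * ENNReal.ofReal (stepRatio lam g n (history X n ω) (X n ω)) := rfl
    have hlt := prevTime_le hX n ω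
    have hprod : 0 ≤ ∏ k ∈ Finset.range n, ν ω (X k ω).1 (X k ω).2 :=
      Finset.prod_nonneg fun k _ => hν.nonneg _ _ _
    rw [h1, ih, ← ENNReal.ofReal_mul (mul_nonneg (Real.exp_pos _).le hprod),
      Finset.prod_range_succ, stepRatio, lastTime_history,
      ← hrep.eq n ω _ _ (.inr hlt) le_rfl]
    have h2 := cumRate_field_eq (lam := lam) hν hrep n ω hlt.le le_rfl
    have h3 : lam.real univ * (prevTime X (n + 1) ω : ℝ)
          - cumRate lam ν (fun _ => 0) ω (prevTime X (n + 1) ω)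
        = (lam.real univ * prevTime X n ω - cumRate lam ν (fun _ => 0) ω (prevTime X n ω))
          + (lam.real univ * ((X n ω).1 - prevTime X n ω)
            - cumRate lam (g n) (lastTime n) (history X n ω) (X n ω).1) := by
      change lam.real univ * ((X n ω).1 : ℝ) - cumRate lam ν (fun _ => 0) ω (X n ω).1 = _
      rw [h2]; ring
    rw [h3, Real.exp_add]
    congr 1
    ring

theorem finprod_times_eq_prod (hX : ∀ ω, IsMarkedPath fun n => X n ω) {t : ℝ≥0} {n : ℕ} {ω : Ω}
    (h : ω ∈ countEvent X t n) (f : ℕ → ℝ) :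
    ∏ᶠ (k : ℕ) (_ : (X k ω).1 ≤ t), f k = ∏ k ∈ Finset.range n, f k := by
  rw [← finprod_mem_coe_finset]
  refine finprod_congr fun k => ?_
  refine finprod_congr_Prop ?_ fun _ => rfl
  rw [time_le_iff_of_mem_countEvent hX h]
  simp

theorem expProcess_nonneg (hν : IsBoundedField ν c C) (t : ℝ≥0) (ω : Ω) :
    0 ≤ expProcess X lam ν t ω :=
  mul_nonneg (Real.exp_pos _).le (finprod_nonneg fun _ => finprod_nonneg fun _ => hν.nonneg _ _ _)

/-- The exponential process on the event that `n` points have come up to time `t`. -/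
theorem ofReal_expProcess_eq (hX : ∀ ω, IsMarkedPath fun n => X n ω) (hν : IsBoundedField ν c C)
    (hrep : IsFieldRepresentation X ν g) {t : ℝ≥0} {n : ℕ} {ω : Ω} (h : ω ∈ countEvent X t n) :
    ENNReal.ofReal (expProcess X lam ν t ω) = likelihood lam g n (history X n ω)
      * ENNReal.ofReal (Real.exp (lam.real univ * (t - lastTime n (history X n ω))
        - cumRate lam (g n) (lastTime n) (history X n ω) t)) := by
  have hprod : 0 ≤ ∏ k ∈ Finset.range n, ν ω (X k ω).1 (X k ω).2 :=
    Finset.prod_nonneg fun k _ => hν.nonneg _ _ _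
  rw [likelihood_history_eq hX hν hrep, ← ENNReal.ofReal_mul (mul_nonneg (Real.exp_pos _).le hprod),
    expProcess, integral_one_sub_eq hν, finprod_times_eq_prod hX h,
    cumRate_field_eq hν hrep n ω h.1 h.2.le, lastTime_history, mul_right_comm, ← Real.exp_add]
  congr 3
  ring

theorem measurable_ofReal_expProcess (hX : ∀ ω, IsMarkedPath fun n => X n ω)
    (hν : IsBoundedField ν c C) (hg : ∀ n, IsBoundedField (g n) c C)
    (hrep : IsFieldRepresentation X ν g) (t : ℝ≥0) :
    Measurable[naturalSigma X t] fun ω => ENNReal.ofReal (expProcess X lam ν t ω) := by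
  rcases isEmpty_or_nonempty Ω with hΩ | hΩ
  · intro B _
    convert @MeasurableSet.empty Ω (naturalSigma X t)
    exact eq_empty_of_forall_notMem fun ω => (hΩ.false ω).elim
  let x₀ := X 0 (Classical.arbitrary Ω)
  let ψ : (n : ℕ) → (Fin n → ℝ≥0 × A) → ℝ≥0∞ := fun n h => likelihood lam g n h
      * ENNReal.ofReal (Real.exp (lam.real univ * (t - lastTime n h)
        - cumRate lam (g n) (lastTime n) h t))
  have hψ : ∀ n, Measurable (ψ n) := fun n =>
    (measurable_likelihood hg n).mul (((measurable_const.sub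
      (measurable_lastTime n).coe_nnreal_real).const_mul _).sub
      (((hg n).measurable_cumRate lam (measurable_lastTime n)).comp
        (measurable_id.prodMk measurable_const))).exp.ennreal_ofReal
  have hst : ∀ n, Measurable[naturalSigma X t] fun ω (i : Fin n) => stoppedPoint X x₀ t i ω :=
    fun n => @measurable_pi_lambda _ _ _ (naturalSigma X t) _ _
      fun i => measurable_stoppedPoint hX x₀ t i
  -- On each of these disjoint events the first `n` points have already come, so they agree with the
  -- stopped points, which are measurable for the past of `t`.
  have key : (fun ω => ENNReal.ofReal (expProcess X lam ν t ω)) = fun ω =>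
      ∑' n, (countEvent X t n).indicator (fun ω => ψ n fun i => stoppedPoint X x₀ t i ω) ω := by
    funext ω
    obtain ⟨n, hn⟩ := exists_mem_countEvent hX t ω
    rw [tsum_eq_single n, indicator_of_mem hn, ofReal_expProcess_eq hX hν hrep hn]
    · have : (fun i : Fin n => stoppedPoint X x₀ t i ω) = history X n ω := by
        funext i
        exact stoppedPoint_of_le ((time_le_iff_of_mem_countEvent hX hn i).2 i.2)
      rw [this]
    · intro k hk
      exact indicator_of_notMem (fun h => (pairwise_disjoint_countEvent hX t hk).le_bot ⟨h, hn⟩) _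
  rw [key]
  have hn : ∀ n, Measurable[naturalSigma X t] ((countEvent X t n).indicator
      fun ω => ψ n fun i => stoppedPoint X x₀ t i ω) := fun n =>
    Measurable.indicator (m := naturalSigma X t) ((hψ n).comp (hst n))
      (measurableSet_countEvent hX t n)
  exact measurable_tsum_of_measurable hn

theorem measurable_expProcess (hX : ∀ ω, IsMarkedPath fun n => X n ω)
    (hν : IsBoundedField ν c C) (hg : ∀ n, IsBoundedField (g n) c C)
    (hrep : IsFieldRepresentation X ν g) (t : ℝ≥0) :
    Measurable[naturalSigma X t] (expProcess X lam ν t) := by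
  have h := (measurable_ofReal_expProcess (lam := lam) hX hν hg hrep t).ennreal_toReal
  have h1 : (fun ω => (ENNReal.ofReal (expProcess X lam ν t ω)).toReal) = expProcess X lam ν t :=
    funext fun ω => ENNReal.toReal_ofReal (expProcess_nonneg hν t ω)
  rwa [h1] at h

variable {Ω' : Type*} {m' : MeasurableSpace Ω'} {P : Measure Ω} {P' : Measure Ω'}

/-- If `X` has intensity `1` under `P` and `X ∘ Z` has intensity `g` under `P'`, then the law of
`Z` under `P'` has on each σ-algebra of the natural filtration of `X` the density `expProcess`. -/
theorem measure_preimage_eq_lintegral_expProcess [IsProbabilityMeasure P] [IsProbabilityMeasure P']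
    (hlam : lam ≠ 0) (hX : ∀ ω, IsMarkedPath fun n => X n ω) (hXm : ∀ n, Measurable (X n))
    (hν : IsBoundedField ν c C) (hg : ∀ n, IsBoundedField (g n) c C)
    (hrep : IsFieldRepresentation X ν g) (hI : HasIntensity P X lam fun _ _ _ _ => 1)
    {Z : Ω' → Ω} (hZ : Measurable Z) (hI' : HasIntensity P' (fun n ω => X n (Z ω)) lam g)
    (t : ℝ≥0) {F : Set Ω} (hF : MeasurableSet[naturalSigma X t] F) :
    P' (Z ⁻¹' F) = ∫⁻ ω in F, ENNReal.ofReal (expProcess X lam ν t ω) ∂P := by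
  have hle : naturalSigma X t ≤ m :=
    (le_iSup (naturalSigma X) t).trans (naturalSigmaTop_le hXm)
  have hFn : ∀ n, MeasurableSet (F ∩ countEvent X t n) := fun n =>
    hle _ (hF.inter (measurableSet_countEvent hX t n))
  have hdis : Pairwise (Function.onFun Disjoint fun n => F ∩ countEvent X t n) := fun j k hjk =>
    (pairwise_disjoint_countEvent hX t hjk).mono inter_subset_right inter_subset_right
  -- The event is split by the number of points up to `t`; on each piece it is determined by the
  -- history.
  have hU : F = ⋃ n, F ∩ countEvent X t n := by
    rw [← inter_iUnion, iUnion_countEvent hX t, inter_univ]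
  rw [hU, preimage_iUnion, measure_iUnion (fun j k hjk => (hdis hjk).preimage Z)
    fun n => hZ (hFn n), lintegral_iUnion hFn hdis]
  refine tsum_congr fun n => ?_
  obtain ⟨B, hB, hFB⟩ := exists_history_set hX hF n
  have hT := measurable_lastTime (E := A) n
  have hm1 : Measurable (B.indicator (1 : (Fin n → ℝ≥0 × A) → ℝ≥0∞)) := measurable_one.indicator hB
  have hm2 : Measurable fun h : Fin n → ℝ≥0 × A => ENNReal.ofReal
      (Real.exp (-cumRate lam (g n) (lastTime n) h t)) :=
    (((hg n).measurable_cumRate lam hT).comp (measurable_id.prodMk measurable_const)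
      ).neg.exp.ennreal_ofReal
  have hm3 : Measurable fun h : Fin n → ℝ≥0 × A => likelihood lam g n h
      * ENNReal.ofReal (Real.exp (lam.real univ * (t - lastTime n h)
        - cumRate lam (g n) (lastTime n) h t)) :=
    (measurable_likelihood hg n).mul (((measurable_const.sub hT.coe_nnreal_real).const_mul _).sub
      (((hg n).measurable_cumRate lam hT).comp
        (measurable_id.prodMk measurable_const))).exp.ennreal_ofReal
  have hS : MeasurableSet {h : Fin n → ℝ≥0 × A | lastTime n h ≤ t} :=
    measurableSet_le hT measurable_const
  -- `e1` introduces the survival probability under `g`, `e2` transports the history from `P'` to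
  -- `P`, and `e3` removes the Poisson survival probability. The latter is compensated by the factor
  -- `exp (lam.real univ * (t - lastTime))` of the exponential process.
  have e1 := hI'.lintegral_between hg hlam n t hm1
  have e2 := lintegral_history_eq hg hI hI' n
    (f := {h | lastTime n h ≤ t}.indicator fun h => B.indicator 1 h
      * ENNReal.ofReal (Real.exp (-cumRate lam (g n) (lastTime n) h t)))
    ((hm1.mul hm2).indicator hS)
  have e3 := hI.lintegral_between (fun _ => isBoundedField_one) hlam n t (hm1.mul hm3)
  have l1 : P' (Z ⁻¹' (F ∩ countEvent X t n)) = ∫⁻ ω,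
      {ω | prevTime (fun n ω => X n (Z ω)) n ω ≤ t ∧ t < (X n (Z ω)).1}.indicator
        (fun ω => B.indicator 1 (history (fun n ω => X n (Z ω)) n ω)) ω ∂P' := by
    rw [← lintegral_indicator_one (hZ (hFn n))]
    refine lintegral_congr fun ω => ?_
    have hp : prevTime (fun n ω => X n (Z ω)) n ω = prevTime X n (Z ω) := by cases n <;> rfl
    by_cases h : Z ω ∈ countEvent X t n
    · have hmem : ω ∈ {ω | prevTime (fun n ω => X n (Z ω)) n ω ≤ t ∧ t < (X n (Z ω)).1} := by
        rw [mem_ofPred_eq, hp]; exact h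
      rw [indicator_of_mem hmem]
      have := hFB (Z ω) h.2
      by_cases h' : Z ω ∈ F
      · rw [indicator_of_mem (show ω ∈ Z ⁻¹' (F ∩ countEvent X t n) from ⟨h', h⟩)]
        exact (indicator_of_mem (this.1 h') (1 : (Fin n → ℝ≥0 × A) → ℝ≥0∞)).symm
      · rw [indicator_of_notMem (show ω ∉ Z ⁻¹' (F ∩ countEvent X t n) from fun hx => h' hx.1)]
        exact (indicator_of_notMem (mt this.2 h') (1 : (Fin n → ℝ≥0 × A) → ℝ≥0∞)).symm
    · have hmem : ω ∉ {ω | prevTime (fun n ω => X n (Z ω)) n ω ≤ t ∧ t < (X n (Z ω)).1} := by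
        rw [mem_ofPred_eq, hp]; exact h
      rw [indicator_of_notMem hmem,
        indicator_of_notMem (show ω ∉ Z ⁻¹' (F ∩ countEvent X t n) from fun hx => h hx.2)]
  have l2 : ∫⁻ ω in F ∩ countEvent X t n, ENNReal.ofReal (expProcess X lam ν t ω) ∂P = ∫⁻ ω,
      {ω | prevTime X n ω ≤ t ∧ t < (X n ω).1}.indicator
        (fun ω => B.indicator 1 (history X n ω) * (likelihood lam g n (history X n ω)
          * ENNReal.ofReal (Real.exp (lam.real univ * (t - lastTime n (history X n ω))
            - cumRate lam (g n) (lastTime n) (history X n ω) t)))) ω ∂P := by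
    rw [← lintegral_indicator (hFn n)]
    refine lintegral_congr fun ω => ?_
    by_cases h : ω ∈ countEvent X t n
    · rw [indicator_of_mem (show ω ∈ {ω | prevTime X n ω ≤ t ∧ t < (X n ω).1} from h)]
      have := hFB ω h.2
      by_cases h' : ω ∈ F
      · rw [indicator_of_mem (show ω ∈ F ∩ _ from ⟨h', h⟩), indicator_of_mem (this.1 h'),
          ofReal_expProcess_eq hX hν hrep h, Pi.one_apply, one_mul]
      · rw [indicator_of_notMem (show ω ∉ F ∩ _ from fun hx => h' hx.1),
          indicator_of_notMem (mt this.2 h'), zero_mul]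
    · rw [indicator_of_notMem (show ω ∉ {ω | prevTime X n ω ≤ t ∧ t < (X n ω).1} from h),
        indicator_of_notMem (show ω ∉ F ∩ _ from fun hx => h hx.2)]
  rw [l1, l2]
  refine e1.trans (e2.trans (Eq.trans (lintegral_congr fun ω => ?_) e3.symm))
  by_cases h : history X n ω ∈ {h | lastTime n h ≤ t}
  · rw [indicator_of_mem h, indicator_of_mem h, cumRate_one _ _ h, Pi.mul_apply, Real.exp_sub, Real.exp_neg,
      Real.exp_neg, ENNReal.ofReal_div_of_pos (Real.exp_pos _), ENNReal.ofReal_inv_of_pos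
      (Real.exp_pos _), ENNReal.ofReal_inv_of_pos (Real.exp_pos _), div_eq_mul_inv]
    set x := Real.exp (lam.real univ * (t - lastTime n (history X n ω))) with hx
    have h0 : ENNReal.ofReal x ≠ 0 := (ENNReal.ofReal_pos.2 (Real.exp_pos _)).ne'
    have h1 : ENNReal.ofReal x * (ENNReal.ofReal x)⁻¹ = 1 :=
      ENNReal.mul_inv_cancel h0 ENNReal.ofReal_ne_top
    calc _ = B.indicator 1 (history X n ω) * (likelihood lam g n (history X n ω)
          * (ENNReal.ofReal (Real.exp (cumRate lam (g n) (lastTime n) (history X n ω) t)))⁻¹)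
            * 1 := by ring
      _ = _ := by rw [← h1]; ring
  · rw [indicator_of_notMem h, indicator_of_notMem h, mul_zero]

end Girsanov

/-! ### The compensator -/

section MarkRate

variable {H A : Type*} [MeasurableSpace H] [MeasurableSpace A]

/-- The rate at time `s` of points with marks in `B`. -/
noncomputable def markRate (lam : Measure A) (g : H → ℝ≥0 → A → ℝ) (B : Set A) (h : H) (s : ℝ≥0) :
    ℝ≥0∞ :=
  ∫⁻ a in B, ENNReal.ofReal (g h s a) ∂lam

namespace IsBoundedField

variable {g : H → ℝ≥0 → A → ℝ} {c C : ℝ} (hg : IsBoundedField g c C) (lam : Measure A)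
  [IsFiniteMeasure lam] {T : H → ℝ≥0} (hT : Measurable T) (hlam : lam ≠ 0)
include hg

theorem measurable_markRate (B : Set A) : Measurable fun p : H × ℝ≥0 => markRate lam g B p.1 p.2 :=
  Measurable.lintegral_prod_right' (ν := lam.restrict B)
    (f := fun q : (H × ℝ≥0) × A => ENNReal.ofReal (g q.1.1 q.1.2 q.2))
    (hg.measurable.comp (measurable_fst.fst.prodMk
      (measurable_fst.snd.prodMk measurable_snd))).ennreal_ofReal

theorem measurable_markRate_section (B : Set A) (h : H) : Measurable (markRate lam g B h) :=
  (hg.measurable_markRate lam B).comp measurable_prodMk_left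

include hT in
theorem measurable_lintegral_markRate (B : Set A) : Measurable fun p : H × ℝ≥0 =>
    ∫⁻ s in Ioc (T p.1) p.2, markRate lam g B p.1 s ∂timeMeasure := by
  have h0 : MeasurableSet {q : (H × ℝ≥0) × ℝ≥0 | T q.1.1 < q.2 ∧ q.2 ≤ q.1.2} := by
    have h2 : Measurable fun q : (H × ℝ≥0) × ℝ≥0 => T q.1.1 := hT.comp measurable_fst.fst
    have h3 : Measurable fun q : (H × ℝ≥0) × ℝ≥0 => q.1.2 := measurable_fst.snd
    have h4 : MeasurableSet {q : (H × ℝ≥0) × ℝ≥0 | q.2 ≤ q.1.2} :=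
      measurableSet_le measurable_snd h3
    exact (measurableSet_lt h2 measurable_snd).inter h4
  have h1 : Measurable fun q : (H × ℝ≥0) × ℝ≥0 => markRate lam g B q.1.1 q.2 :=
    (hg.measurable_markRate lam B).comp (measurable_fst.fst.prodMk measurable_snd)
  have h2 := Measurable.lintegral_prod_right' (ν := timeMeasure) (h1.indicator h0)
  convert h2 using 2 with p
  rw [← lintegral_indicator measurableSet_Ioc]
  rfl

theorem intensityMeasure_Ioc_prod (h : H) (a b : ℝ≥0) {B : Set A} (hB : MeasurableSet B) :
    intensityMeasure lam g h (Ioc a b ×ˢ B)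
      = ∫⁻ s in Ioc a b, markRate lam g B h s ∂timeMeasure := by
  have hm : Measurable fun p : ℝ≥0 × A => ENNReal.ofReal (g h p.1 p.2) :=
    (hg.measurable.comp measurable_prodMk_left).ennreal_ofReal
  rw [intensityMeasure, withDensity_apply _ (measurableSet_Ioc.prod hB),
    setLIntegral_prod _ hm.aemeasurable]
  rfl

theorem intensityMeasure_Ioc_le (h : H) (a b : ℝ≥0) (B : Set A) :
    intensityMeasure lam g h (Ioc a b ×ˢ B) ≤ ENNReal.ofReal (cumRate lam g (fun _ => 0) h b) := by
  rw [hg.ofReal_cumRate lam]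
  refine (measure_mono (Set.prod_mono (Ioc_subset_Ioc_left (zero_le (a := a)))
    (subset_univ B))).trans ?_
  rw [hg.intensityMeasure_Ioc_prod lam h _ _ MeasurableSet.univ]
  refine lintegral_mono fun s => ?_
  rw [hg.ofReal_rate lam, markRate, Measure.restrict_univ]

theorem measurable_intensityMeasure : Measurable (intensityMeasure lam g) := by
  refine Measure.measurable_of_measurable_coe _ fun S hS => ?_
  have h1 : Measurable fun q : H × (ℝ≥0 × A) => ENNReal.ofReal (g q.1 q.2.1 q.2.2) :=
    hg.measurable.ennreal_ofReal
  simp_rw [intensityMeasure, withDensity_apply _ hS]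
  exact Measurable.lintegral_prod_right' (ν := (timeMeasure.prod lam).restrict S) h1

omit hg in
theorem intensityMeasure_singleton_prod (h : H) (t : ℝ≥0) :
    intensityMeasure lam g h ({t} ×ˢ univ) = 0 := by
  refine withDensity_absolutelyContinuous _ _ ?_
  rw [Measure.prod_prod, timeMeasure_singleton, zero_mul]

include hT hlam in
theorem lintegral_stepDensity_Ici (h : H) {v : ℝ≥0} (hv : T h ≤ v) :
    ∫⁻ p, stepDensity lam g T h p * (Ici v ×ˢ univ).indicator 1 p ∂timeMeasure.prod lam
      = ENNReal.ofReal (Real.exp (-cumRate lam g T h v)) := by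
  rw [← hg.lintegral_stepDensity_Ioi lam hlam h hv]
  have h0 : (timeMeasure.prod lam) ({v} ×ˢ univ) = 0 := by
    rw [Measure.prod_prod, timeMeasure_singleton, zero_mul]
  refine lintegral_congr_ae ?_
  filter_upwards [measure_eq_zero_iff_ae_notMem.1 h0] with p hp
  have h1 : p.1 ≠ v := fun h => hp ⟨h, trivial⟩
  by_cases h2 : v < p.1
  · rw [indicator_of_mem (show p ∈ Ici v ×ˢ univ from ⟨h2.le, trivial⟩),
      indicator_of_mem (show p ∈ Ioi v ×ˢ univ from ⟨h2, trivial⟩)]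
  · rw [indicator_of_notMem (show p ∉ Ici v ×ˢ univ from fun h => h2 (lt_of_le_of_ne h.1 h1.symm)),
      indicator_of_notMem (show p ∉ Ioi v ×ˢ univ from fun h => h2 h.1)]

include hT in
/-- The conditional probability that the next point comes in `(s, t]` with a mark in `B`. -/
theorem lintegral_stepDensity_Ioc (h : H) (s t : ℝ≥0) {B : Set A} (hB : MeasurableSet B) :
    ∫⁻ p, stepDensity lam g T h p * (Ioc s t ×ˢ B).indicator 1 p ∂timeMeasure.prod lam
      = ∫⁻ u in Ioc (max s (T h)) t, markRate lam g B h u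
          * ENNReal.ofReal (Real.exp (-cumRate lam g T h u)) ∂timeMeasure := by
  -- The lower limit is the maximum because the density vanishes up to `T h`.
  have h1 := hg.lintegral_stepDensity_mul lam (T := T) h (le_max_right s (T h))
    (w := (Iic t).indicator 1) (measurable_one.indicator measurableSet_Iic) hB
  refine Eq.trans (lintegral_congr fun p => ?_) (h1.trans ?_)
  · by_cases hp : T h < p.1
    · congr 1
      by_cases h2 : p ∈ Ioc s t ×ˢ B
      · rw [indicator_of_mem h2, indicator_of_mem (show p ∈ Ioi (max s (T h)) ×ˢ B from
          ⟨max_lt h2.1.1 hp, h2.2⟩), indicator_of_mem (mem_Iic.2 h2.1.2)]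
        rfl
      · rw [indicator_of_notMem h2]
        by_cases h3 : p ∈ Ioi (max s (T h)) ×ˢ B
        · rw [indicator_of_mem h3, indicator_of_notMem]
          exact fun h4 => h2 ⟨⟨(le_max_left _ _).trans_lt h3.1, h4⟩, h3.2⟩
        · rw [indicator_of_notMem h3]
    · simp [stepDensity, hp]
  · rw [← lintegral_indicator measurableSet_Ioi, ← lintegral_indicator measurableSet_Ioc]
    refine lintegral_congr fun u => ?_
    by_cases h2 : max s (T h) < u <;> by_cases h3 : u ≤ t <;>
      simp [indicator, h2, h3, markRate]

include hT hlam in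
/-- The conditional expectation of the rate cumulated from `s` to `t` before the next point. -/
theorem lintegral_stepDensity_markRate (h : H) (s t : ℝ≥0) (B : Set A) :
    ∫⁻ p, stepDensity lam g T h p
        * ∫⁻ u in Ioc (max s (T h)) t, (Iic p.1).indicator (markRate lam g B h) u ∂timeMeasure
        ∂timeMeasure.prod lam
      = ∫⁻ u in Ioc (max s (T h)) t, markRate lam g B h u
          * ENNReal.ofReal (Real.exp (-cumRate lam g T h u)) ∂timeMeasure := by
  have hsd : Measurable (stepDensity lam g T h) :=
    (hg.measurable_stepDensity lam hT).comp measurable_prodMk_left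
  have hr := hg.measurable_markRate_section lam B h
  have hle : MeasurableSet {q : (ℝ≥0 × A) × ℝ≥0 | q.2 ≤ q.1.1} := by
    have h3 : Measurable fun q : (ℝ≥0 × A) × ℝ≥0 => q.1.1 := measurable_fst.fst
    exact measurableSet_le measurable_snd h3
  have hm : Measurable fun q : (ℝ≥0 × A) × ℝ≥0 => (Iic q.1.1).indicator (markRate lam g B h) q.2 :=
    (hr.comp measurable_snd).indicator hle
  have h1 : ∀ p : ℝ≥0 × A, stepDensity lam g T h p
        * ∫⁻ u in Ioc (max s (T h)) t, (Iic p.1).indicator (markRate lam g B h) u ∂timeMeasure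
      = ∫⁻ u in Ioc (max s (T h)) t,
          stepDensity lam g T h p * (Iic p.1).indicator (markRate lam g B h) u ∂timeMeasure :=
    fun p => (lintegral_const_mul _ (hr.indicator measurableSet_Iic)).symm
  simp_rw [h1]
  -- After the exchange, the integral over the next point at fixed `u` is the probability that this
  -- point is not earlier than `u`.
  rw [lintegral_lintegral_swap ((hsd.comp measurable_fst).mul hm).aemeasurable]
  refine setLIntegral_congr_fun measurableSet_Ioc fun u hu => ?_
  have h2 : ∀ p : ℝ≥0 × A, stepDensity lam g T h p * (Iic p.1).indicator (markRate lam g B h) u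
      = markRate lam g B h u * (stepDensity lam g T h p * (Ici u ×ˢ univ).indicator 1 p) := by
    intro p
    by_cases h3 : u ≤ p.1
    · rw [indicator_of_mem (mem_Iic.2 h3),
        indicator_of_mem (show p ∈ Ici u ×ˢ univ from ⟨h3, trivial⟩), Pi.one_apply]
      ring
    · rw [indicator_of_notMem (show u ∉ Iic p.1 from h3),
        indicator_of_notMem (show p ∉ Ici u ×ˢ univ from fun h4 => h3 h4.1)]
      simp
  have h3 : Measurable fun p : ℝ≥0 × A =>
      stepDensity lam g T h p * (Ici u ×ˢ univ).indicator 1 p :=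
    hsd.mul (measurable_one.indicator (measurableSet_Ici.prod MeasurableSet.univ))
  simp_rw [h2]
  rw [lintegral_const_mul _ h3,
    hg.lintegral_stepDensity_Ici lam hT hlam h ((le_max_right _ _).trans hu.1.le)]

end IsBoundedField

end MarkRate

section Compensator

variable {Ω A : Type*} [MeasurableSpace A] {m : MeasurableSpace Ω} {X : ℕ → Ω → ℝ≥0 × A}
  {lam : Measure A} [IsFiniteMeasure lam] {ν : Ω → ℝ≥0 → A → ℝ}
  {g : (n : ℕ) → (Fin n → ℝ≥0 × A) → ℝ≥0 → A → ℝ} {c C : ℝ}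

/-- The intensity measure of the part of `(0, t] × B` after the previous and up to the next point
with index `k`. -/
noncomputable def partialIntensity (X : ℕ → Ω → ℝ≥0 × A) (lam : Measure A) (ν : Ω → ℝ≥0 → A → ℝ)
    (B : Set A) (k : ℕ) (t : ℝ≥0) (ω : Ω) : ℝ≥0∞ :=
  intensityMeasure lam ν ω (Ioc (prevTime X k ω) (min t (X k ω).1) ×ˢ B)

theorem intensityMeasure_eq_history (hν : IsBoundedField ν c C)
    (hrep : IsFieldRepresentation X ν g) (k : ℕ) (ω : Ω) {a b : ℝ≥0} (ha : prevTime X k ω ≤ a)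
    (hb : b ≤ (X k ω).1) {B : Set A} (hB : MeasurableSet B) :
    intensityMeasure lam ν ω (Ioc a b ×ˢ B)
      = ∫⁻ s in Ioc a b, markRate lam (g k) B (history X k ω) s ∂timeMeasure := by
  rw [hν.intensityMeasure_Ioc_prod lam ω _ _ hB]
  refine setLIntegral_congr_fun measurableSet_Ioc fun s hs => ?_
  refine lintegral_congr fun a => ?_
  rw [hrep.eq k ω s a (.inr (ha.trans_lt hs.1)) (hs.2.trans hb)]

open Classical in
/-- Measurability of `partialIntensity` for any σ-algebra that knows the time and the points that
have come. -/
theorem measurable_partialIntensity (hX : ∀ ω, IsMarkedPath fun n => X n ω)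
    (hν : IsBoundedField ν c C) (hg : ∀ n, IsBoundedField (g n) c C)
    (hrep : IsFieldRepresentation X ν g) {B : Set A} (hB : MeasurableSet B)
    {Ω₁ : Type*} [MeasurableSpace Ω₁] {τ : Ω₁ → ℝ≥0} (hτ : Measurable τ) (b : Ω₁ → Ω)
    {D : ℕ → Set Ω₁} (hD : ∀ n, MeasurableSet (D n)) (x₀ : ℝ≥0 × A)
    (hDm : ∀ n, Measurable fun p => if p ∈ D n then X n (b p) else x₀)
    (h1 : ∀ n p, (X n (b p)).1 < τ p → p ∈ D n) (h2 : ∀ n p, p ∈ D n → (X n (b p)).1 ≤ τ p)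
    (k : ℕ) : Measurable fun p => partialIntensity X lam ν B k (τ p) (b p) := by
  let E : Set Ω₁ := match k with
    | 0 => univ
    | k + 1 => D k
  have hE : MeasurableSet E := by
    cases k with
    | zero => exact MeasurableSet.univ
    | succ k => exact hD k
  let hist : Ω₁ → Fin k → ℝ≥0 × A := fun p i => if p ∈ D i then X i (b p) else x₀
  -- This is the minimum of `τ` and the next arrival, written with observed data only: an unobserved
  -- arrival is not earlier than `τ`.
  let nt : Ω₁ → ℝ≥0 := fun p => if p ∈ D k then (if p ∈ D k then X k (b p) else x₀).1 else τ p
  have hhist : Measurable hist := measurable_pi_lambda _ fun i => hDm i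
  have hnt : Measurable nt := Measurable.ite (hD k) (hDm k).fst hτ
  have hΦ := (hg k).measurable_lintegral_markRate lam (measurable_lastTime k) B
  have key : (fun p => partialIntensity X lam ν B k (τ p) (b p)) = E.indicator fun p =>
      ∫⁻ s in Ioc (lastTime k (hist p)) (nt p), markRate lam (g k) B (hist p) s ∂timeMeasure := by
    funext p
    have hntp : nt p = min (τ p) (X k (b p)).1 := by
      by_cases hp : p ∈ D k
      · simp only [nt, hp, if_true]
        rw [min_eq_right (h2 k p hp)]
      · simp only [nt, hp, if_false]
        rw [min_eq_left (not_lt.1 (mt (h1 k p) hp))]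
    by_cases hp : p ∈ E
    · have hhp : hist p = history X k (b p) := by
        funext i
        refine if_pos ?_
        cases k with
        | zero => exact i.elim0
        | succ k =>
          rcases (Nat.lt_succ_iff.1 i.2).eq_or_lt with h | h
          · rw [h]; exact hp
          · exact h1 i p (((hX (b p)).strictMono h).trans_le (h2 k p hp))
      rw [indicator_of_mem hp, hhp, hntp, lastTime_history, partialIntensity,
        intensityMeasure_eq_history hν hrep k _ le_rfl (min_le_right _ _) hB]
    · have hle : τ p ≤ prevTime X k (b p) := by
        cases k with
        | zero => exact (hp trivial).elim
        | succ k => exact not_lt.1 (mt (h1 k p) hp)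
      rw [indicator_of_notMem hp, partialIntensity,
        Ioc_eq_empty (not_lt.2 ((min_le_left _ _).trans hle)), empty_prod, measure_empty]
  rw [key]
  exact (hΦ.comp (hhist.prodMk hnt)).indicator hE

theorem measurable_partialIntensity_natural (hX : ∀ ω, IsMarkedPath fun n => X n ω)
    (hν : IsBoundedField ν c C) (hg : ∀ n, IsBoundedField (g n) c C)
    (hrep : IsFieldRepresentation X ν g) {B : Set A} (hB : MeasurableSet B) (t : ℝ≥0) (k : ℕ) :
    Measurable[naturalSigma X t] (partialIntensity X lam ν B k t) := by
  rcases isEmpty_or_nonempty Ω with hΩ | hΩ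
  · intro S _
    convert @MeasurableSet.empty Ω (naturalSigma X t)
    exact eq_empty_of_forall_notMem fun ω => (hΩ.false ω).elim
  exact @measurable_partialIntensity Ω A _ m X lam _ ν g c C hX hν hg hrep B hB Ω
    (naturalSigma X t) (fun _ => t) measurable_const id (fun n => {ω | (X n ω).1 ≤ t})
    (fun n => measurableSet_time_le hX n le_rfl) (X 0 (Classical.arbitrary Ω))
    (fun n => measurable_stoppedPoint hX _ t n) (fun _ _ h => le_of_lt h) (fun _ _ h => h) k

theorem measurableSet_predictable_time_lt (hm : naturalSigmaTop X ≤ m)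
    (hX : ∀ ω, IsMarkedPath fun n => X n ω) (n : ℕ) :
    MeasurableSet[(naturalFiltration X hm).predictable]
      {p : ℝ≥0 × Ω | (X n p.2).1 < p.1} := by
  have : {p : ℝ≥0 × Ω | (X n p.2).1 < p.1} = ⋃ N : ℕ,
      {p : ℝ≥0 × Ω | (X n p.2).1 < p.1 ∧ (X n p.2).1 ≤ (N : ℝ≥0) ∧ (X n p.2).2 ∈ univ} := by
    ext p
    simp only [mem_ofPred_eq, mem_iUnion, mem_univ, and_true]
    exact ⟨fun h => (exists_nat_ge (X n p.2).1).imp fun _ h' => ⟨h, h'⟩, fun ⟨_, h⟩ => h.1⟩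
  rw [this]
  exact .iUnion fun N => measurableSet_predictable_lt hm hX n N MeasurableSet.univ

theorem measurable_partialIntensity_predictable (hm : naturalSigmaTop X ≤ m)
    (hX : ∀ ω, IsMarkedPath fun n => X n ω)
    (hν : IsBoundedField ν c C) (hg : ∀ n, IsBoundedField (g n) c C)
    (hrep : IsFieldRepresentation X ν g) {B : Set A} (hB : MeasurableSet B) (k : ℕ) :
    Measurable[(naturalFiltration X hm).predictable]
      fun p : ℝ≥0 × Ω => partialIntensity X lam ν B k p.1 p.2 := by
  rcases isEmpty_or_nonempty Ω with hΩ | hΩ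
  · intro S _
    convert @MeasurableSet.empty (ℝ≥0 × Ω) (naturalFiltration X hm).predictable
    exact eq_empty_of_forall_notMem fun ω => (hΩ.false ω.2).elim
  exact @measurable_partialIntensity Ω A _ m X lam _ ν g c C hX hν hg hrep B hB (ℝ≥0 × Ω)
    (naturalFiltration X hm).predictable Prod.fst (measurable_predictable_time hm) Prod.snd
    (fun n => {p | (X n p.2).1 < p.1}) (fun n => measurableSet_predictable_time_lt hm hX n)
    (X 0 (Classical.arbitrary Ω)) (fun n => measurable_leftStoppedPoint hm hX _ n)
    (fun _ _ h => h) (fun _ _ h => le_of_lt h) k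

/-- Since the times tend to infinity, the intervals between successive points exhaust `(0, t]`. -/
theorem intensityMeasure_eq_tsum (hX : ∀ ω, IsMarkedPath fun n => X n ω) {B : Set A}
    (hB : MeasurableSet B) (t : ℝ≥0) (ω : Ω) :
    intensityMeasure lam ν ω (Ioc 0 t ×ˢ B) = ∑' k, partialIntensity X lam ν B k t ω := by
  have hmono := (hX ω).strictMono
  have hU : Ioc 0 t ×ˢ B = ⋃ k, Ioc (prevTime X k ω) (min t (X k ω).1) ×ˢ B := by
    rw [← iUnion_prod_const]
    congr 1
    ext s
    simp only [mem_iUnion, mem_Ioc, le_min_iff]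
    constructor
    · rintro ⟨h0, h1⟩
      classical
      have h : ∃ k, s ≤ (X k ω).1 := ((hX ω).exists_lt s).imp fun _ h => h.le
      refine ⟨Nat.find h, ?_, h1, Nat.find_spec h⟩
      cases hn : Nat.find h with
      | zero => exact h0
      | succ k => exact not_le.1 (Nat.find_min h (by omega))
    · rintro ⟨k, h0, h1, _⟩
      exact ⟨(zero_le).trans_lt h0, h1⟩
  have hlt : ∀ j k, j < k → (X j ω).1 ≤ prevTime X k ω := by
    intro j k hjk
    cases k with
    | zero => omega
    | succ k => exact hmono.monotone (Nat.lt_succ_iff.1 hjk)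
  have hdis : Pairwise (Function.onFun Disjoint
      fun k => Ioc (prevTime X k ω) (min t (X k ω).1) ×ˢ B) := by
    intro j k hjk
    refine disjoint_left.2 fun p hj hk => ?_
    rcases hjk.lt_or_gt with h | h
    · exact absurd (hj.1.2.trans ((min_le_right _ _).trans (hlt j k h))) (not_le.2 hk.1.1)
    · exact absurd (hk.1.2.trans ((min_le_right _ _).trans (hlt k j h))) (not_le.2 hj.1.1)
  rw [hU, measure_iUnion hdis fun k => measurableSet_Ioc.prod hB]
  rfl

theorem intensityMeasure_stopped_eq_sum (hX : ∀ ω, IsMarkedPath fun n => X n ω) {B : Set A}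
    (hB : MeasurableSet B) (n : ℕ) (t : ℝ≥0) (ω : Ω) :
    intensityMeasure lam ν ω (Ioc 0 (min t (X n ω).1) ×ˢ B)
      = ∑ k ∈ Finset.range (n + 1), partialIntensity X lam ν B k t ω := by
  rw [intensityMeasure_eq_tsum hX hB, tsum_eq_sum]
  · refine Finset.sum_congr rfl fun k hk => ?_
    have : (X k ω).1 ≤ (X n ω).1 :=
      (hX ω).strictMono.monotone (Nat.lt_succ_iff.1 (Finset.mem_range.1 hk))
    rw [partialIntensity, partialIntensity, min_assoc, min_eq_right this]
  · intro k hk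
    cases k with
    | zero => simp at hk
    | succ k =>
      have : (X n ω).1 ≤ (X k ω).1 := (hX ω).strictMono.monotone (by simpa using hk)
      rw [partialIntensity, Ioc_eq_empty, empty_prod, measure_empty]
      exact not_lt.2 ((min_le_left _ _).trans ((min_le_right _ _).trans this))

theorem pointMeasure_stopped_eq_sum (hX : ∀ ω, IsMarkedPath fun n => X n ω) {B : Set A}
    (hB : MeasurableSet B) (n : ℕ) (t : ℝ≥0) (ω : Ω) :
    pointMeasure X ω (Ioc 0 (min t (X n ω).1) ×ˢ B)
      = ∑ k ∈ Finset.range (n + 1), (Iic t ×ˢ B).indicator 1 (X k ω) := by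
  rw [pointMeasure_eq_sum hX (n := n + 1) ((min_le_right _ _).trans_lt ((hX ω).2.1 n)) hB]
  refine Finset.sum_congr rfl fun k hk => ?_
  have h1 : (X k ω).1 ≤ (X n ω).1 :=
    (hX ω).strictMono.monotone (Nat.lt_succ_iff.1 (Finset.mem_range.1 hk))
  have h2 : X k ω ∈ Iic (min t (X n ω).1) ×ˢ B ↔ X k ω ∈ Iic t ×ˢ B := by
    simp [h1]
  by_cases h : X k ω ∈ Iic t ×ˢ B
  · rw [indicator_of_mem h, indicator_of_mem (h2.2 h)]
  · rw [indicator_of_notMem h, indicator_of_notMem (mt h2.1 h)]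

variable {Q : Measure Ω}

/-- The increment over `(s, t]` of the number of points with index `k` and mark in `B` and that of
its intensity have the same integral over events of the past of `s`. -/
theorem setLIntegral_increment (hlam : lam ≠ 0) (hX : ∀ ω, IsMarkedPath fun n => X n ω)
    (hXm : ∀ n, Measurable (X n))
    (hν : IsBoundedField ν c C) (hg : ∀ n, IsBoundedField (g n) c C)
    (hrep : IsFieldRepresentation X ν g) (hI : HasIntensity Q X lam g) {B : Set A}
    (hB : MeasurableSet B) (k : ℕ) (s t : ℝ≥0) {F : Set Ω}
    (hF : MeasurableSet[naturalSigma X s] F) :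
    ∫⁻ ω in F, (Ioc s t ×ˢ B).indicator 1 (X k ω) ∂Q
      = ∫⁻ ω in F, intensityMeasure lam ν ω
          (Ioc (max s (prevTime X k ω)) (min t (X k ω).1) ×ˢ B) ∂Q := by
  have hFm : MeasurableSet F :=
    ((le_iSup (naturalSigma X) s).trans (naturalSigmaTop_le hXm)) _ hF
  obtain ⟨S, hS, hFS⟩ := exists_history_set hX hF k
  have hT := measurable_lastTime (E := A) k
  have hr := (hg k).measurable_markRate lam B
  have m1 : Measurable fun q : (Fin k → ℝ≥0 × A) × (ℝ≥0 × A) =>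
      S.indicator 1 q.1 * (Ioc s t ×ˢ B).indicator (1 : ℝ≥0 × A → ℝ≥0∞) q.2 :=
    ((measurable_one.indicator hS).comp measurable_fst).mul
      ((measurable_one.indicator (measurableSet_Ioc.prod hB)).comp measurable_snd)
  have m2 : Measurable fun q : (Fin k → ℝ≥0 × A) × (ℝ≥0 × A) =>
      ∫⁻ u in Ioc (max s (lastTime k q.1)) t,
        (Iic q.2.1).indicator (markRate lam (g k) B q.1) u ∂timeMeasure := by
    have a1 : Measurable fun q : ((Fin k → ℝ≥0 × A) × (ℝ≥0 × A)) × ℝ≥0 =>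
        max s (lastTime k q.1.1) := measurable_const.max (hT.comp measurable_fst.fst)
    have a2 : Measurable fun q : ((Fin k → ℝ≥0 × A) × (ℝ≥0 × A)) × ℝ≥0 => q.1.2.1 :=
      measurable_fst.snd.fst
    have a3 : MeasurableSet {q : ((Fin k → ℝ≥0 × A) × (ℝ≥0 × A)) × ℝ≥0 |
        max s (lastTime k q.1.1) < q.2 ∧ q.2 ≤ t} := by
      have : MeasurableSet {q : ((Fin k → ℝ≥0 × A) × (ℝ≥0 × A)) × ℝ≥0 | q.2 ≤ t} :=
        measurableSet_le measurable_snd measurable_const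
      exact (measurableSet_lt a1 measurable_snd).inter this
    have a4 : MeasurableSet {q : ((Fin k → ℝ≥0 × A) × (ℝ≥0 × A)) × ℝ≥0 | q.2 ≤ q.1.2.1} :=
      measurableSet_le measurable_snd a2
    have a5 : Measurable fun q : ((Fin k → ℝ≥0 × A) × (ℝ≥0 × A)) × ℝ≥0 =>
        markRate lam (g k) B q.1.1 q.2 := hr.comp (measurable_fst.fst.prodMk measurable_snd)
    have a6 := Measurable.lintegral_prod_right' (ν := timeMeasure)
      ((a5.indicator a4).indicator a3)
    convert a6 using 2 with q
    rw [← lintegral_indicator measurableSet_Ioc]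
    rfl
  -- The intensity is tested against the indicator of the point and against the rate cumulated up to
  -- it; the two conditional integrals coincide. The event `F` may be replaced by the history event
  -- `S`, since both increments vanish if the point comes by time `s`.
  have e1 := hI k _ m1
  have e2 := hI k _ (((measurable_one.indicator hS).comp measurable_fst).mul m2)
  rw [← lintegral_indicator hFm, ← lintegral_indicator hFm]
  refine Eq.trans (lintegral_congr fun ω => ?_) (e1.trans (Eq.trans (lintegral_congr fun ω => ?_)
    (e2.symm.trans (lintegral_congr fun ω => ?_))))
  · by_cases hs : s < (X k ω).1
    · by_cases h : ω ∈ F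
      · rw [indicator_of_mem h, indicator_of_mem ((hFS ω hs).1 h), Pi.one_apply, one_mul]
      · rw [indicator_of_notMem h, indicator_of_notMem (mt (hFS ω hs).2 h), zero_mul]
    · have h0 : (Ioc s t ×ˢ B).indicator (1 : ℝ≥0 × A → ℝ≥0∞) (X k ω) = 0 :=
        indicator_of_notMem (fun h => hs h.1.1) _
      rw [h0, mul_zero]
      by_cases h : ω ∈ F
      · rw [indicator_of_mem h, h0]
      · rw [indicator_of_notMem h]
  · have hsd : Measurable (stepDensity lam (g k) (lastTime k) (history X k ω)) :=
      ((hg k).measurable_stepDensity lam hT).comp measurable_prodMk_left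
    have c1 : ∀ p : ℝ≥0 × A, stepDensity lam (g k) (lastTime k) (history X k ω) p
        * (S.indicator 1 (history X k ω) * (Ioc s t ×ˢ B).indicator 1 p)
        = S.indicator 1 (history X k ω) * (stepDensity lam (g k) (lastTime k) (history X k ω) p
          * (Ioc s t ×ˢ B).indicator 1 p) := fun p => by ring
    have c2 : ∀ (p : ℝ≥0 × A) (x : ℝ≥0∞),
        stepDensity lam (g k) (lastTime k) (history X k ω) p * (S.indicator 1 (history X k ω) * x)
        = S.indicator 1 (history X k ω) * (stepDensity lam (g k) (lastTime k) (history X k ω) p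
          * x) := fun p x => by ring
    have d1 : Measurable fun p => stepDensity lam (g k) (lastTime k) (history X k ω) p
        * (Ioc s t ×ˢ B).indicator 1 p :=
      hsd.mul (measurable_one.indicator (measurableSet_Ioc.prod hB))
    have d2 : Measurable fun p : ℝ≥0 × A => stepDensity lam (g k) (lastTime k) (history X k ω) p
        * ∫⁻ u in Ioc (max s (lastTime k (history X k ω))) t,
          (Iic p.1).indicator (markRate lam (g k) B (history X k ω)) u ∂timeMeasure :=
      hsd.mul (m2.comp measurable_prodMk_left)
    simp only [Pi.mul_apply, Function.comp_apply]
    simp_rw [c2]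
    rw [lintegral_const_mul _ d1, lintegral_const_mul _ d2,
      (hg k).lintegral_stepDensity_Ioc lam hT _ s t hB,
      (hg k).lintegral_stepDensity_markRate lam hT hlam _ s t B]
  · have h0 : ∫⁻ u in Ioc (max s (lastTime k (history X k ω))) t,
          (Iic (X k ω).1).indicator (markRate lam (g k) B (history X k ω)) u ∂timeMeasure
        = intensityMeasure lam ν ω
          (Ioc (max s (prevTime X k ω)) (min t (X k ω).1) ×ˢ B) := by
      rw [intensityMeasure_eq_history hν hrep k ω (le_max_right _ _) (min_le_right _ _) hB,
        lastTime_history, setLIntegral_indicator measurableSet_Iic, inter_comm, Ioc_inter_Iic]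
    simp only [Pi.mul_apply, Function.comp_apply]
    rw [h0]
    by_cases hs : s < (X k ω).1
    · by_cases h : ω ∈ F
      · rw [indicator_of_mem h, indicator_of_mem ((hFS ω hs).1 h), Pi.one_apply, one_mul]
      · rw [indicator_of_notMem h, indicator_of_notMem (mt (hFS ω hs).2 h), zero_mul]
    · have h3 : intensityMeasure lam ν ω
          (Ioc (max s (prevTime X k ω)) (min t (X k ω).1) ×ˢ B) = 0 := by
        rw [Ioc_eq_empty, empty_prod, measure_empty]
        exact not_lt.2 ((min_le_right _ _).trans ((not_lt.1 hs).trans (le_max_left _ _)))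
      rw [h3, mul_zero]
      by_cases h : ω ∈ F
      · rw [indicator_of_mem h, h3]
      · rw [indicator_of_notMem h]

end Compensator

section CompensatorMartingale

/-- An adapted integrable process is a martingale if its integral over an event of the past does
not change with time. -/
theorem martingale_of_setIntegral_eq {Ω ι : Type*} [Preorder ι] {m : MeasurableSpace Ω}
    {ℱ : Filtration ι m} {Q : Measure Ω} [IsFiniteMeasure Q] {f : ι → Ω → ℝ}
    (hf : ∀ t, Measurable[ℱ t] (f t)) (hint : ∀ t, Integrable (f t) Q)
    (h : ∀ s t, s ≤ t → ∀ F, MeasurableSet[ℱ s] F → ∫ ω in F, f t ω ∂Q = ∫ ω in F, f s ω ∂Q) :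
    Martingale f ℱ Q := by
  refine ⟨fun t => (hf t).stronglyMeasurable, fun s t hst => ?_⟩
  refine (ae_eq_condExp_of_forall_setIntegral_eq (ℱ.le s) (hint t)
    (fun _ _ _ => (hint s).integrableOn) (fun F hF _ => (h s t hst F hF).symm)
    (hf s).stronglyMeasurable.aestronglyMeasurable).symm

variable {Ω A : Type*} [MeasurableSpace A] {m : MeasurableSpace Ω} {X : ℕ → Ω → ℝ≥0 × A}
  {lam : Measure A} [IsFiniteMeasure lam] {ν : Ω → ℝ≥0 → A → ℝ}
  {g : (n : ℕ) → (Fin n → ℝ≥0 × A) → ℝ≥0 → A → ℝ} {c C : ℝ}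

theorem intensityMeasure_Ioc_le_mul (hν : IsBoundedField ν c C) (ω : Ω) (a b : ℝ≥0) (B : Set A) :
    intensityMeasure lam ν ω (Ioc a b ×ˢ B) ≤ ENNReal.ofReal (C * lam.real univ * b) := by
  refine (hν.intensityMeasure_Ioc_le lam ω a b B).trans (ENNReal.ofReal_le_ofReal ?_)
  have := hν.setIntegral_rate_le lam ω (a := 0) (b := b) (zero_le)
  simpa [cumRate] using this

variable {Q : Measure Ω}

/-- Equality of the increments holds in `[0, ∞]`. The indicator is at most `1` and the intensity up
to `t` at most `C * lam.real univ * t`, so the difference of real parts is integrable and the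
identity can be subtracted. -/
theorem martingale_single_point [IsFiniteMeasure Q] (hm : naturalSigmaTop X ≤ m) (hlam : lam ≠ 0)
    (hX : ∀ ω, IsMarkedPath fun n => X n ω) (hXm : ∀ n, Measurable (X n))
    (hν : IsBoundedField ν c C) (hg : ∀ n, IsBoundedField (g n) c C)
    (hrep : IsFieldRepresentation X ν g) (hI : HasIntensity Q X lam g) {B : Set A}
    (hB : MeasurableSet B) (k : ℕ) :
    Martingale (fun (t : ℝ≥0) ω => ((Iic t ×ˢ B).indicator (1 : ℝ≥0 × A → ℝ≥0∞) (X k ω)).toReal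
      - (partialIntensity X lam ν B k t ω).toReal) (naturalFiltration X hm) Q := by
  have hI1 : ∀ t, Measurable[naturalSigma X t] fun ω =>
      (Iic t ×ˢ B).indicator (1 : ℝ≥0 × A → ℝ≥0∞) (X k ω) := fun t =>
    @Measurable.indicator Ω ℝ≥0∞ _ (fun _ => 1) (naturalSigma X t) _ _
      measurable_const (measurableSet_mem_Iic_prod hX hB k t)
  have hρ := measurable_partialIntensity_natural (lam := lam) hX hν hg hrep hB (k := k)
  have hle : ∀ t, naturalSigma X t ≤ m := (naturalFiltration X hm).le
  have hIle : ∀ (S : Set (ℝ≥0 × A)) p, S.indicator (1 : ℝ≥0 × A → ℝ≥0∞) p ≤ 1 := fun S p =>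
    indicator_le_self' (fun _ _ => zero_le) p
  have hρle : ∀ t ω, partialIntensity X lam ν B k t ω ≤ ENNReal.ofReal (C * lam.real univ * t) :=
    fun t ω => (measure_mono (prod_mono_left (Ioc_subset_Ioc_right (min_le_left _ _)))).trans
      (intensityMeasure_Ioc_le_mul hν ω _ t B)
  have hIi : ∀ (t) (F : Set Ω), ∫⁻ ω in F, (Iic t ×ˢ B).indicator (1 : ℝ≥0 × A → ℝ≥0∞) (X k ω) ∂Q ≠ ∞ :=
    fun t F => ((lintegral_mono fun ω => hIle _ _).trans_lt (by simp [measure_lt_top])).ne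
  have hρi : ∀ t (F : Set Ω), ∫⁻ ω in F, partialIntensity X lam ν B k t ω ∂Q ≠ ∞ :=
    fun t F => ((lintegral_mono fun ω => hρle t ω).trans_lt (by
      rw [lintegral_const]; exact ENNReal.mul_lt_top ENNReal.ofReal_lt_top (measure_lt_top _ _))).ne
  have hIint : ∀ t, Integrable (fun ω =>
      ((Iic t ×ˢ B).indicator (1 : ℝ≥0 × A → ℝ≥0∞) (X k ω)).toReal) Q := fun t =>
    integrable_toReal_of_lintegral_ne_top ((hI1 t).mono (hle t) le_rfl).aemeasurable
      (by simpa using hIi t univ)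
  have hρint : ∀ t, Integrable (fun ω => (partialIntensity X lam ν B k t ω).toReal) Q := fun t =>
    integrable_toReal_of_lintegral_ne_top ((hρ t).mono (hle t) le_rfl).aemeasurable
      (by simpa using hρi t univ)
  refine martingale_of_setIntegral_eq (fun t => (hI1 t).ennreal_toReal.sub (hρ t).ennreal_toReal)
    (fun t => (hIint t).sub (hρint t)) fun s t hst F hF => ?_
  have e1 : ∀ u, ∫ ω in F, (((Iic u ×ˢ B).indicator (1 : ℝ≥0 × A → ℝ≥0∞) (X k ω)).toReal
      - (partialIntensity X lam ν B k u ω).toReal) ∂Q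
      = (∫⁻ ω in F, (Iic u ×ˢ B).indicator (1 : ℝ≥0 × A → ℝ≥0∞) (X k ω) ∂Q).toReal
        - (∫⁻ ω in F, partialIntensity X lam ν B k u ω ∂Q).toReal := fun u => by
    rw [integral_sub (hIint u).integrableOn (hρint u).integrableOn,
      integral_toReal ((hI1 u).mono (hle u) le_rfl).aemeasurable
        (.of_forall fun ω => (hIle _ _).trans_lt ENNReal.one_lt_top),
      integral_toReal ((hρ u).mono (hle u) le_rfl).aemeasurable
        (.of_forall fun ω => (hρle u ω).trans_lt ENNReal.ofReal_lt_top)]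
  have e2 : ∀ ω, (Iic t ×ˢ B).indicator (1 : ℝ≥0 × A → ℝ≥0∞) (X k ω)
      = (Iic s ×ˢ B).indicator 1 (X k ω) + (Ioc s t ×ˢ B).indicator 1 (X k ω) := fun ω => by
    have hd : Disjoint (Iic s ×ˢ B) (Ioc s t ×ˢ B) :=
      disjoint_left.2 fun p h h' => absurd h.1 (not_le.2 h'.1.1)
    rw [← Iic_union_Ioc_eq_Iic hst, union_prod, indicator_union_of_disjoint hd]
  have e3 : ∀ ω, partialIntensity X lam ν B k t ω = partialIntensity X lam ν B k s ω
      + intensityMeasure lam ν ω (Ioc (max s (prevTime X k ω)) (min t (X k ω).1) ×ˢ B) := fun ω => by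
    rw [partialIntensity, partialIntensity, ← measure_union _ (measurableSet_Ioc.prod hB),
      ← union_prod]
    · congr 2
      ext u
      simp only [mem_union, mem_Ioc, le_min_iff, max_lt_iff]
      constructor
      · rintro ⟨h1, h2, h3⟩
        rcases le_or_gt u s with h | h
        · exact .inl ⟨h1, h, h3⟩
        · exact .inr ⟨⟨h, h1⟩, h2, h3⟩
      · rintro (⟨h1, h2, h3⟩ | ⟨⟨h, h1⟩, h2, h3⟩)
        · exact ⟨h1, h2.trans hst, h3⟩
        · exact ⟨h1, h2, h3⟩
    · refine disjoint_left.2 fun p h h' => ?_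
      exact absurd (h.1.2.trans (min_le_left _ _)) (not_le.2 ((le_max_left _ _).trans_lt h'.1.1))
  have e4 := setLIntegral_increment hlam hX hXm hν hg hrep hI hB k s t hF
  have hd : ∫⁻ ω in F, (Ioc s t ×ˢ B).indicator (1 : ℝ≥0 × A → ℝ≥0∞) (X k ω) ∂Q ≠ ∞ :=
    ((lintegral_mono fun ω => hIle _ _).trans_lt (by simp [measure_lt_top])).ne
  rw [e1, e1]
  simp_rw [e2, e3]
  rw [lintegral_add_left ((hI1 s).mono (hle s) le_rfl), lintegral_add_left ((hρ s).mono (hle s) le_rfl),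
    ← e4, ENNReal.toReal_add (hIi s F) hd, ENNReal.toReal_add (hρi s F) hd]
  ring

theorem isCompensator_intensityMeasure [IsFiniteMeasure Q] (hm : naturalSigmaTop X ≤ m)
    (hlam : lam ≠ 0)
    (hX : ∀ ω, IsMarkedPath fun n => X n ω) (hXm : ∀ n, Measurable (X n))
    (hν : IsBoundedField ν c C) (hg : ∀ n, IsBoundedField (g n) c C)
    (hrep : IsFieldRepresentation X ν g) (hI : HasIntensity Q X lam g) :
    IsCompensator (naturalFiltration X hm) Q X (intensityMeasure lam ν) where
  measurable := hν.measurable_intensityMeasure lam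
  zero_null ω := IsBoundedField.intensityMeasure_singleton_prod lam ω 0
  atom_le_one ω t := by
    rw [IsBoundedField.intensityMeasure_singleton_prod lam ω t]; exact zero_le
  ae_finite := .of_forall fun ω t =>
    (intensityMeasure_Ioc_le_mul hν ω 0 t univ).trans_lt ENNReal.ofReal_lt_top
  predictable B hB := by
    simp_rw [intensityMeasure_eq_tsum hX hB]
    exact measurable_tsum_of_measurable fun k =>
      measurable_partialIntensity_predictable hm hX hν hg hrep hB k
  martingale n B hB := by
    have hs : ∀ N : ℕ, Martingale (fun (t : ℝ≥0) ω => ∑ k ∈ Finset.range N,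
        (((Iic t ×ˢ B).indicator (1 : ℝ≥0 × A → ℝ≥0∞) (X k ω)).toReal
          - (partialIntensity X lam ν B k t ω).toReal)) (naturalFiltration X hm) Q := by
      intro N
      induction N with
      | zero => exact martingale_zero ℝ (naturalFiltration X hm) Q
      | succ N ih =>
        simp_rw [Finset.sum_range_succ]
        exact ih.add (martingale_single_point hm hlam hX hXm hν hg hrep hI hB N)
    convert hs (n + 1) using 3 with t ω
    rw [pointMeasure_stopped_eq_sum hX hB, intensityMeasure_stopped_eq_sum hX hB,
      ENNReal.toReal_sum, ENNReal.toReal_sum, Finset.sum_sub_distrib]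
    · intro k _
      exact ((measure_mono (prod_mono_left (Ioc_subset_Ioc_right (min_le_left _ _)))).trans_lt
        ((intensityMeasure_Ioc_le_mul hν ω _ t B).trans_lt ENNReal.ofReal_lt_top)).ne
    · intro k _
      exact ((indicator_le_self' (fun _ _ => zero_le) (X k ω)).trans_lt ENNReal.one_lt_top).ne

end CompensatorMartingale

/-! ### The lift to a measure without atoms -/

/-- The product with Lebesgue measure on `[0, 1]` destroys the atoms without changing the first
marginal, and `A × ℝ` is an uncountable standard Borel space, hence Borel isomorphic to `ℝ`. -/
theorem exists_isNonatomicLift {A : Type*} [MeasurableSpace A] [StandardBorelSpace A]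
    (lam : Measure A) [IsFiniteMeasure lam] (hlam : lam ≠ 0) :
    ∃ (lam' : Measure ℝ) (π : ℝ → A), IsNonatomicLift lam lam' π := by
  have hA : Nonempty A := by
    by_contra h
    rw [not_nonempty_iff] at h
    exact hlam (Measure.eq_zero_of_isEmpty lam)
  have hu : ¬ Countable (A × ℝ) := fun _ =>
    not_countable (α := ℝ) ((Prod.snd_surjective (α := A) (β := ℝ)).countable)
  let e : A × ℝ ≃ᵐ ℝ := PolishSpace.measurableEquivOfNotCountable hu not_countable
  let q : Measure (A × ℝ) := lam.prod (volume.restrict (Icc 0 1))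
  refine ⟨q.map e, fun r => (e.symm r).1, ⟨inferInstance, e.symm.measurable.fst, ?_, fun r => ?_⟩⟩
  · rw [Measure.map_map e.symm.measurable.fst e.measurable]
    have h1 : ((fun r => (e.symm r).1) ∘ e) = Prod.fst := funext fun p => by simp
    rw [h1, Measure.map_fst_prod]
    simp
  · rw [e.map_apply]
    have h1 : e ⁻¹' {r} ⊆ univ ×ˢ {(e.symm r).2} := fun p hp => by
      have : e p = r := hp
      simp [← this]
    refine measure_mono_null h1 ?_
    rw [Measure.prod_prod]
    simp

/-! ### The probability with density `expProcess` -/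

section GirsanovProbability

variable {Ω A : Type*} [MeasurableSpace A] {m : MeasurableSpace Ω} {X : ℕ → Ω → ℝ≥0 × A}
  {P : Measure Ω}

/-- The filtration is increasing, so the union of its σ-algebras is a π-system generating `ℱ_∞`. -/
theorem IsGirsanovProbability.unique {κ : ℝ≥0 → Ω → ℝ} {Q Q' : @Measure Ω (naturalSigmaTop X)}
    (hQ : IsGirsanovProbability P X κ Q) (hQ' : IsGirsanovProbability P X κ Q') : Q = Q' := by
  have h1 := hQ.1
  have h2 := hQ'.1
  refine @ext_of_generate_finite Ω (naturalSigmaTop X) Q Q'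
    {s | ∃ t, MeasurableSet[naturalSigma X t] s} (MeasurableSpace.measurableSpace_iSup_eq _) ?_ _ ?_
    (by rw [hQ.1.measure_univ, hQ'.1.measure_univ])
  · rintro s ⟨i, hs⟩ t ⟨j, ht⟩ _
    exact ⟨max i j, (naturalSigma_mono X (le_max_left i j) _ hs).inter
      (naturalSigma_mono X (le_max_right i j) _ ht)⟩
  · rintro s ⟨t, hs⟩
    rw [hQ.2 t s hs, hQ'.2 t s hs]

variable {lam : Measure A} [IsFiniteMeasure lam] {ν : Ω → ℝ≥0 → A → ℝ}
  {g : (n : ℕ) → (Fin n → ℝ≥0 × A) → ℝ≥0 → A → ℝ} {c C : ℝ}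

/-- The integral of the density over an event of the past of `s` is its probability under `Q`, both
at time `s` and at any later time. -/
theorem IsGirsanovProbability.martingale_expProcess [IsProbabilityMeasure P]
    (hm : naturalSigmaTop X ≤ m) (hX : ∀ ω, IsMarkedPath fun n => X n ω)
    (hν : IsBoundedField ν c C) (hg : ∀ n, IsBoundedField (g n) c C)
    (hrep : IsFieldRepresentation X ν g) {Q : @Measure Ω (naturalSigmaTop X)}
    (hQ : IsGirsanovProbability P X (expProcess X lam ν) Q) :
    Martingale (expProcess X lam ν) (naturalFiltration X hm) P := by
  have hκ := measurable_expProcess (lam := lam) hX hν hg hrep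
  have hκm : ∀ t, Measurable (expProcess X lam ν t) := fun t =>
    (hκ t).mono ((naturalFiltration X hm).le t) le_rfl
  have h0 : ∀ t, 0 ≤ᵐ[P] expProcess X lam ν t := fun t => .of_forall (expProcess_nonneg hν t)
  have hset : ∀ t F, MeasurableSet[naturalSigma X t] F →
      ∫ ω in F, expProcess X lam ν t ω ∂P = (Q F).toReal := fun t F hF => by
    rw [hQ.2 t F hF, integral_eq_lintegral_of_nonneg_ae (ae_restrict_of_ae (h0 t))
      (hκm t).aestronglyMeasurable]
  refine martingale_of_setIntegral_eq hκ (fun t => ⟨(hκm t).aestronglyMeasurable, ?_⟩)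
    fun s t hst F hF => ?_
  · have h1 := hQ.2 t univ MeasurableSet.univ
    rw [hQ.1.measure_univ, Measure.restrict_univ] at h1
    rw [hasFiniteIntegral_iff_ofReal (h0 t), ← h1]
    exact ENNReal.one_lt_top
  · rw [hset s F hF, hset t F (naturalSigma_mono X hst _ hF)]

variable {Ω' : Type*} {m' : MeasurableSpace Ω'} {P' : Measure Ω'}

/-- An image measure has total mass one and is defined on all of `ℱ_∞` at once, so consistency of
the densities comes for free. -/
theorem isGirsanovProbability_map [IsProbabilityMeasure P] [IsProbabilityMeasure P']
    (hlam : lam ≠ 0) (hX : ∀ ω, IsMarkedPath fun n => X n ω) (hXm : ∀ n, Measurable (X n))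
    (hν : IsBoundedField ν c C) (hg : ∀ n, IsBoundedField (g n) c C)
    (hrep : IsFieldRepresentation X ν g) (hI : HasIntensity P X lam fun _ _ _ _ => 1)
    {Z : Ω' → Ω} (hZ : Measurable Z) (hI' : HasIntensity P' (fun n ω => X n (Z ω)) lam g) :
    IsGirsanovProbability P X (expProcess X lam ν)
      (@Measure.map Ω' Ω m' (naturalSigmaTop X) Z P') := by
  have hle := naturalSigmaTop_le hXm
  have hZ' : Measurable[m', naturalSigmaTop X] Z := hZ.mono le_rfl hle
  refine ⟨⟨?_⟩, fun t F hF => ?_⟩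
  · rw [@Measure.map_apply Ω' Ω m' (naturalSigmaTop X) P' Z hZ' univ MeasurableSet.univ,
      preimage_univ, measure_univ]
  rw [@Measure.map_apply Ω' Ω m' (naturalSigmaTop X) P' Z hZ' F (le_iSup (naturalSigma X) t _ hF),
    measure_preimage_eq_lintegral_expProcess hlam hX hXm hν hg hrep hI hZ hI' t hF]

/-- Only integrals of functions of the points occur, so a change of variables suffices. This moves
the intensity to the image measure, also when the target carries just `ℱ_∞`. -/
theorem HasIntensity.map (hX : ∀ n, Measurable (X n)) (hg : ∀ n, IsBoundedField (g n) c C)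
    {Z : Ω' → Ω} (hZ : Measurable Z) (hI : HasIntensity P' (fun n ω => X n (Z ω)) lam g) :
    HasIntensity (P'.map Z) X lam g := by
  intro n f hf
  have hh : Measurable (history X n) := measurable_pi_lambda _ fun i => hX i
  have h1 : Measurable fun q : (Fin n → ℝ≥0 × A) × (ℝ≥0 × A) =>
      stepDensity lam (g n) (lastTime n) q.1 q.2 * f (q.1, q.2) :=
    ((hg n).measurable_stepDensity lam (measurable_lastTime n)).mul hf
  exact (lintegral_map (hf.comp (hh.prodMk (hX n))) hZ).trans ((hI n f hf).trans
    (lintegral_map ((h1.lintegral_prod_right' (ν := timeMeasure.prod lam)).comp hh) hZ).symm)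

end GirsanovProbability

/-! ### The time-changed Poisson process -/

section TimeChange

variable {Ω A : Type*} [MeasurableSpace A] {m : MeasurableSpace Ω} {P : Measure Ω}
  {lam : Measure A} [IsFiniteMeasure lam] {lam' : Measure ℝ} {π : ℝ → A} {Y : ℕ → Ω → ℝ≥0 × ℝ}
  {g : (n : ℕ) → (Fin n → ℝ≥0 × A) → ℝ≥0 → A → ℝ} {c C : ℝ}

/-- The time change of `Y`, with real marks. -/
noncomputable def timeChange (lam : Measure A) (lam' : Measure ℝ) (π : ℝ → A)
    (g : (n : ℕ) → (Fin n → ℝ≥0 × A) → ℝ≥0 → A → ℝ) (Y : ℕ → Ω → ℝ≥0 × ℝ) (n : ℕ) (ω : Ω) :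
    ℝ≥0 × ℝ :=
  realStep lam lam' π g n
    (drivenHistory (pointStep lam lam' π g) (fun k => innovation Y k ω) n) (innovation Y n ω)

theorem timeChange_eq (n : ℕ) (ω : Ω) : timeChange lam lam' π g Y n ω
    = realStep lam lam' π g n (history (mapMarks π (timeChange lam lam' π g Y)) n ω)
      (innovation Y n ω) := by
  rw [timeChange, drivenHistory_eq]
  rfl

theorem mapMarks_timeChange_eq (n : ℕ) (ω : Ω) : mapMarks π (timeChange lam lam' π g Y) n ω
    = pointStep lam lam' π g n (history (mapMarks π (timeChange lam lam' π g Y)) n ω)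
      (innovation Y n ω) := by
  rw [pointStep, ← timeChange_eq]
  rfl

theorem measurable_timeChange (hl : IsNonatomicLift lam lam' π) (hlam : lam ≠ 0)
    (hg : ∀ n, IsBoundedField (g n) c C) (hY : ∀ n, Measurable (Y n)) (n : ℕ) :
    Measurable (timeChange lam lam' π g Y n) := by
  have h1 := measurable_history_of_innovations (measurable_pointStep hl hlam hg)
    (mapMarks_timeChange_eq (Y := Y)) n fun k _ => measurable_innovation hY k
  rw [funext (timeChange_eq n)]
  exact (measurable_realStep hl hlam hg n).comp (h1.prodMk (measurable_innovation hY n))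

theorem prevTime_timeChange (n : ℕ) (ω : Ω) :
    lastTime n (history (mapMarks π (timeChange lam lam' π g Y)) n ω)
      = prevTime (timeChange lam lam' π g Y) n ω := by
  cases n <;> rfl

theorem interarrival_pos (hpath : ∀ ω, IsMarkedPath fun n => Y n ω) (n : ℕ) (ω : Ω) :
    0 < interarrival Y n ω := by
  refine sub_pos.2 ?_
  cases n with
  | zero => exact_mod_cast (hpath ω).1 0
  | succ n => exact_mod_cast (hpath ω).2.1 n

theorem prevTime_lt_timeChange (hlam : lam ≠ 0) (hg : ∀ n, IsBoundedField (g n) c C)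
    (hpath : ∀ ω, IsMarkedPath fun n => Y n ω) (n : ℕ) (ω : Ω) :
    prevTime (timeChange lam lam' π g Y) n ω < (timeChange lam lam' π g Y n ω).1 := by
  rw [← prevTime_timeChange, timeChange_eq n ω]
  exact (hg n).lt_timeStep lam hlam _ (interarrival_pos hpath n ω)

/-- Over the new interarrival interval the cumulated rate equals `lam.real univ` times the old
interarrival time, and the rate is at most `C * lam.real univ`. -/
theorem interarrival_le_timeChange (hlam : lam ≠ 0) (hg : ∀ n, IsBoundedField (g n) c C)
    (hpath : ∀ ω, IsMarkedPath fun n => Y n ω) (n : ℕ) (ω : Ω) :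
    interarrival Y n ω ≤ C * interarrival (timeChange lam lam' π g Y) n ω := by
  have hL := IsBoundedField.measureReal_univ_pos lam hlam
  have h1 := (hg n).cumRate_timeStep lam hlam (T := lastTime n)
    (history (mapMarks π (timeChange lam lam' π g Y)) n ω) (interarrival_pos hpath n ω)
  have h2 : timeStep lam (g n) (lastTime n) (history (mapMarks π (timeChange lam lam' π g Y)) n ω)
      (interarrival Y n ω) = (timeChange lam lam' π g Y n ω).1 := by
    rw [timeChange_eq n ω]; rfl
  rw [h2, cumRate, prevTime_timeChange] at h1
  have h3 := (hg n).setIntegral_rate_le lam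
    (history (mapMarks π (timeChange lam lam' π g Y)) n ω)
    (prevTime_lt_timeChange (lam' := lam') (π := π) hlam hg hpath n ω).le
  rw [h1] at h3
  refine le_of_mul_le_mul_left (h3.trans_eq ?_) hL
  rw [interarrival]
  ring

theorem time_le_timeChange (hlam : lam ≠ 0) (hg : ∀ n, IsBoundedField (g n) c C)
    (hpath : ∀ ω, IsMarkedPath fun n => Y n ω) (n : ℕ) (ω : Ω) :
    ((Y n ω).1 : ℝ) ≤ C * (timeChange lam lam' π g Y n ω).1 := by
  induction n with
  | zero =>
    simpa [interarrival, prevTime]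
      using interarrival_le_timeChange (lam' := lam') (π := π) hlam hg hpath 0 ω
  | succ n ih =>
    have h := interarrival_le_timeChange (lam' := lam') (π := π) hlam hg hpath (n + 1) ω
    simp only [interarrival, prevTime] at h
    linarith

theorem isMarkedPath_timeChange (hlam : lam ≠ 0) (hg : ∀ n, IsBoundedField (g n) c C)
    (hpath : ∀ ω, IsMarkedPath fun n => Y n ω) (ω : Ω) :
    IsMarkedPath fun n => timeChange lam lam' π g Y n ω := by
  have hlt := prevTime_lt_timeChange (lam' := lam') (π := π) hlam hg hpath
  refine ⟨fun n => zero_le.trans_lt (hlt n ω), fun n => hlt (n + 1) ω, tendsto_atTop.2 fun b => ?_⟩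
  -- Old times are at most `C` times the new ones, so the new time exceeds `b` as soon as the old
  -- one exceeds `C * b`.
  filter_upwards [tendsto_atTop.1 (hpath ω).2.2 (C.toNNReal * b)] with n hn
  have h1 := time_le_timeChange (lam' := lam') (π := π) hlam hg hpath n ω
  have h0 : 0 < C := (hg 0).pos.trans_le (((hg 0).bounds Fin.elim0 0
    (π 0)).1.trans ((hg 0).bounds Fin.elim0 0 (π 0)).2)
  have h2 : C * (b : ℝ) ≤ (Y n ω).1 := by
    have : ((C.toNNReal * b : ℝ≥0) : ℝ) ≤ (Y n ω).1 := by exact_mod_cast hn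
    rwa [NNReal.coe_mul, Real.coe_toNNReal _ h0.le] at this
  exact_mod_cast le_of_mul_le_mul_left (h2.trans h1) h0

theorem isTimeChange_timeChange (hP : IsPoissonProcess Y lam' P) (hl : IsNonatomicLift lam lam' π)
    (hlam : lam ≠ 0) (hg : ∀ n, IsBoundedField (g n) c C) :
    IsTimeChange P lam lam' π g Y (timeChange lam lam' π g Y) := by
  refine ⟨fun n ω => ?_, ?_⟩
  · have h := (hg n).isLeast_timeStep lam hlam (T := lastTime n)
      (history (mapMarks π (timeChange lam lam' π g Y)) n ω) (interarrival Y n ω)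
    simp only [cumRate, prevTime_timeChange] at h
    rw [timeChange_eq n ω]
    exact h
  · have := hl.isProbabilityMeasure hlam
    have hq : ∀ r, ((lam' univ)⁻¹ • lam') {r} = 0 := fun r => by simp [hl.nonatomic r]
    rw [ae_all_iff]
    intro n
    have h1 : ∀ᵐ r ∂P.map (fun ω => (Y n ω).2), cdf ((lam' univ)⁻¹ • lam') r ∈ Ioo (0 : ℝ) 1 := by
      rw [(hP.hasLaw_mark n).map_eq]
      exact ae_cdf_mem_Ioo _ hq
    filter_upwards [ae_of_ae_map (hP.hasLaw_mark n).aemeasurable h1] with ω hω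
    have h := (hg n).isLeast_markStep hl hlam
      (history (mapMarks π (timeChange lam lam' π g Y)) n ω, (timeChange lam lam' π g Y n ω).1) hω
    have h2 : (timeChange lam lam' π g Y n ω).2 = markStep lam' π (g n)
        (history (mapMarks π (timeChange lam lam' π g Y)) n ω, (timeChange lam lam' π g Y n ω).1)
        (Y n ω).2 := by
      rw [timeChange_eq n ω]; rfl
    rw [h2]
    exact h

end TimeChange

/-! ### Assembly: the image of `P` under the time change -/

theorem mainTheorem6 {A : Type*} [MeasurableSpace A] [StandardBorelSpace A]
    (lam : Measure A) [IsFiniteMeasure lam] (hlam : lam ≠ 0) :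
    (∃ (lam' : Measure ℝ) (π : ℝ → A), IsNonatomicLift lam lam' π) ∧
    ∀ (lam' : Measure ℝ) (π : ℝ → A) (hlift : IsNonatomicLift lam lam' π)
      (P : Measure (MarkedPath ℝ)), IsProbabilityMeasure P →
      IsPoissonProcess (canonicalProcess ℝ) lam' P →
    ∀ (ν : MarkedPath ℝ → ℝ≥0 → A → ℝ) (c C : ℝ), 0 < c →
      (∀ ω t a, c ≤ ν ω t a ∧ ν ω t a ≤ C) →
      IsPredictableField (liftedFiltration hlift.measurable) ν →
      Martingale (expProcess (liftedProcess π) lam ν) (liftedFiltration hlift.measurable) P ∧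
      (∃! Q : @Measure (MarkedPath ℝ) (naturalSigmaTop (liftedProcess π)),
        IsGirsanovProbability P (liftedProcess π) (expProcess (liftedProcess π) lam ν) Q) ∧
      ∀ Q : @Measure (MarkedPath ℝ) (naturalSigmaTop (liftedProcess π)),
        IsGirsanovProbability P (liftedProcess π) (expProcess (liftedProcess π) lam ν) Q →
        IsCompensator (naturalFiltration (liftedProcess π) le_rfl) Q (liftedProcess π)
          (intensityMeasure lam ν) ∧
        ∃ X' : ℕ → MarkedPath ℝ → ℝ≥0 × A,
          (∀ n, Measurable (X' n)) ∧
          (∀ n ω, 0 < (X' n ω).1) ∧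
          (∀ n ω, (X' n ω).1 < (X' (n + 1) ω).1) ∧
          (∀ ω, Tendsto (fun n => (X' n ω).1) atTop atTop) ∧
          seqLaw P X' = seqLaw Q (liftedProcess π) ∧
          ∃ (g : (n : ℕ) → (Fin n → ℝ≥0 × A) → ℝ≥0 → A → ℝ)
            (Z : ℕ → MarkedPath ℝ → ℝ≥0 × ℝ),
            IsFieldRepresentation (liftedProcess π) ν g ∧
            (∀ n h t a, c ≤ g n h t a ∧ g n h t a ≤ C) ∧
            (∀ n, Measurable (Z n)) ∧
            IsTimeChange P lam lam' π g (canonicalProcess ℝ) Z ∧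
            X' = mapMarks π Z := by
  refine ⟨exists_isNonatomicLift lam hlam, fun lam' π hl P _ hP ν c C hc hb hpred => ?_⟩
  have hY : ∀ n, Measurable (canonicalProcess ℝ n) := fun n =>
    (measurable_pi_apply n).comp measurable_subtype_coe
  have hpath : ∀ ω, IsMarkedPath fun n => canonicalProcess ℝ n ω := fun ω => ω.2
  have hXm : ∀ n, Measurable (liftedProcess π n) := measurable_mapMarks_canonical hl.measurable
  have hX : ∀ ω, IsMarkedPath fun n => liftedProcess π n ω := fun ω => ω.2
  have hle := naturalSigmaTop_le hXm
  -- A sample point is needed to see that `c ≤ C`.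
  obtain ⟨ω₀⟩ : Nonempty (MarkedPath ℝ) := nonempty_of_isProbabilityMeasure P
  have hcC : c ≤ C := (hb ω₀ 0 (π 0)).1.trans (hb ω₀ 0 (π 0)).2
  obtain ⟨g, hrep, hg⟩ := exists_fieldRepresentation hle hX hc hcC hb hpred
  have hν : IsBoundedField ν c C := hpred.isBoundedField hc hb
  -- The compensator must be a kernel from `ℱ_∞`, which requires the field to be measurable for that
  -- smaller σ-algebra as well.
  have hν' : @IsBoundedField _ A (naturalSigmaTop (liftedProcess π)) _ ν c C :=
    @IsPredictableField.isBoundedField _ A _ (naturalSigmaTop (liftedProcess π))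
      (naturalFiltration (liftedProcess π) le_rfl) ν hpred c C hc hb
  let Z := timeChange lam lam' π g (canonicalProcess ℝ)
  have hZm : ∀ n, Measurable (Z n) := measurable_timeChange hl hlam hg hY
  have hZ : ∀ ω, IsMarkedPath fun n => Z n ω := isMarkedPath_timeChange hlam hg hpath
  -- The time-changed sequence is itself a path of the canonical space, so composing the lifted
  -- process with `W` gives the time-changed points.
  let W : MarkedPath ℝ → MarkedPath ℝ := fun ω => ⟨fun n => Z n ω, hZ ω⟩
  have hW : Measurable W := (measurable_pi_lambda _ hZm).subtype_mk
  have hW' : Measurable[_, naturalSigmaTop (liftedProcess π)] W := hW.mono le_rfl hle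
  have hI' : HasIntensity P (fun n ω => liftedProcess π n (W ω)) lam g :=
    hP.hasIntensity_of_pointStep hY hl hlam hg mapMarks_timeChange_eq
  have hQ₀ := isGirsanovProbability_map hlam hX hXm hν hg hrep
    (hP.hasIntensity_one hY hpath hl hlam) hW hI'
  have hXt := measurable_natural_top hX
  refine ⟨hQ₀.martingale_expProcess hle hX hν hg hrep, ⟨_, hQ₀, fun Q hQ => hQ.unique hQ₀⟩,
    fun Q hQ => ?_⟩
  rw [hQ.unique hQ₀]
  refine ⟨?_, mapMarks π Z, fun n => ?_, fun n ω => (hZ ω).1 n, fun n ω => (hZ ω).2.1 n,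
    fun ω => (hZ ω).2.2, ?_, g, Z, hrep, fun n => (hg n).bounds, hZm,
    isTimeChange_timeChange hP hl hlam hg, rfl⟩
  · have := hQ₀.1
    exact @isCompensator_intensityMeasure _ A _ (naturalSigmaTop (liftedProcess π)) _ lam _ ν g c C
      _ _ le_rfl hlam hX hXt hν' hg hrep
      (@HasIntensity.map _ A _ (naturalSigmaTop (liftedProcess π)) _ lam _ g c C _ _ P hXt hg W hW'
        hI')
  · exact (hZm n).fst.prodMk (hl.measurable.comp (hZm n).snd)
  -- The law of the lifted process under the image of `P` by `W` is the law of its composition with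
  -- `W` under `P`.
  · have h := @Measure.map_map _ _ _ _ (naturalSigmaTop (liftedProcess π)) _ P
      (fun ω n => liftedProcess π n ω) W
      (@measurable_pi_lambda _ _ _ (naturalSigmaTop (liftedProcess π)) _ _ hXt) hW'
    exact h.symm
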